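/- Let $N\ge 1$ and let $\Omega\subset\mathbb R^N$ be a bounded Lipschitz domain (a nonempty bounded connected open set which, near each boundary point and after a rigid motion, is the region above the graph of a Lipschitz function). Put $$c_N=\pi^{-N/2}\,\Gamma(\tfrac N2),\quad \rho_N=2\log 2+\frac{\Gamma'(N/2)}{\Gamma(N/2)}-\gamma,\quad c_{N,s}=2^{2s}\pi^{-N/2}\,s\,\frac{\Gamma(\frac{N+2s}{2})}{\Gamma(1-s)}\quad(0<s<1),$$ where $\gamma$ is the Euler–Mascheroni constant. Let $\mathbb H(\Omega)$ be the space of measurable $u:\mathbb R^N\to\mathbb R$ with $u\equiv0$ on $\mathbb R^N\setminus\Omega$ and $\iint_{|x-y|\le1}\frac{(u(x)-u(y))^2}{|x-y|^N}\,dx\,dy<\infty$, and for $u,w\in\mathbb H(\Omega)$ let $$\mathcal E_L(u,w)=\frac{c_N}{2}\iint_{|x-y|\le1}\frac{(u(x)-u(y))(w(x)-w(y))}{|x-y|^N}\,dx\,dy-c_N\iint_{|x-y|\ge1}\frac{u(x)w(y)}{|x-y|^N}\,dx\,dy+\rho_N\int_{\mathbb R^N}uw\,dx .$$ A real number $\lambda$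 is a Dirichlet eigenvalue of the logarithmic Laplacian on $\Omega$, with eigenfunction $u$, if $u\in\mathbb H(\Omega)$, $u\ne0$ and $\mathcal E_L(u,\varphi)=\lambda\int_\Omega u\varphi\,dx$ for all $\varphi\in\mathbb H(\Omega)$. For $s\in(0,1)$ let $\mathcal H^s_0(\Omega)=\{u\in H^s(\mathbb R^N): u\equiv0 \text{ on }\mathbb R^N\setminus\Omega\}$ and $$\mathcal E_s(u,w)=\frac{c_{N,s}}{2}\int_{\mathbb R^N}\!\int_{\mathbb R^N}\frac{(u(x)-u(y))(w(x)-w(y))}{|x-y|^{N+2s}}\,dx\,dy .$$ A real number $\lambda$ is a Dirichlet eigenvalue of $(-\Delta)^s$ on $\Omega$, with eigenfunction $u$, if $u\in\mathcal H^s_0(\Omega)$, $u\neq0$ and $\mathcal E_s(u,\varphi)=\lambda\int_\Omega u\varphi\,dx$ for all $\varphi\in\mathcal H_0^s(\Omega)$. Then the logarithmic Laplacian has a smallest Dirichlet eigenvalue $\lambda_1^L(\Omega)$ on $\Omega$, $(-\Delta)^s$ has a smallest Dirichlet eigenvalue $\lambda_1^s(\Omega)$ on $\Omega$ for every $s\in(0,1)$,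 and, with $\lambda_1^0(\Omega):=1$, $$\lambda_1^L(\Omega)=\frac{d}{ds}\Big|_{s=0}\lambda_1^s(\Omega)=\lim_{s\to0^+}\frac{\lambda_1^s(\Omega)-1}{s}.$$ Moreover, there is a unique (up to equality almost everywhere) nonnegative $L^2(\Omega)$-normalized eigenfunction $\xi_1$ of the logarithmic Laplacian corresponding to $\lambda_1^L(\Omega)$, for every $s\in(0,1)$ there is a unique nonnegative $L^2(\Omega)$-normalized eigenfunction $u_s$ of $(-\Delta)^s$ corresponding to $\lambda_1^s(\Omega)$, and $$u_s\to\xi_1\quad\text{in }L^2(\Omega)\text{ as }s\to0^+ .$$ -/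

import Mathlib

open MeasureTheory Set Filter Topology

noncomputable section

namespace LogLaplace

/-- A bounded Lipschitz domain in `ℝ^N`: a bounded, nonempty, connected open set which, in a ball
around each of its boundary points `z`, is the region strictly above the graph of a Lipschitz
function, in the Cartesian coordinates determined by some unit vector `ν` ("vertical direction"):
the vertical coordinate of `x` is `⟪ν, x⟫` and `x - ⟪ν, x⟫ • ν` is its projection
onto the hyperplane orthogonal to `ν`. -/
structure IsBoundedLipschitzDomain {N : ℕ} (Ω : Set (EuclideanSpace ℝ (Fin N))) : Prop where
  isOpen : IsOpen Ω
  isConnected : IsConnected Ω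
  isBounded : Bornology.IsBounded Ω
  lipschitz_boundary : ∀ z ∈ frontier Ω, ∃ r : ℝ, 0 < r ∧
    ∃ ν : EuclideanSpace ℝ (Fin N), ‖ν‖ = 1 ∧
    ∃ (K : NNReal) (g : EuclideanSpace ℝ (Fin N) → ℝ), LipschitzWith K g ∧
      ∀ x ∈ Metric.ball z r, (x ∈ Ω ↔ g (x - inner ℝ ν x • ν) < inner ℝ ν x)

/-! ### Constants -/

/-- `c_N = π^{-N/2} Γ(N/2)`. -/
def cLog (N : ℕ) : ℝ := Real.pi ^ (-(N : ℝ) / 2) * Real.Gamma ((N : ℝ) / 2)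

/-- `ρ_N = 2 log 2 + ψ(N/2) - γ`, where `ψ = Γ'/Γ` and `γ` is the Euler-Mascheroni constant. -/
def rhoLog (N : ℕ) : ℝ :=
  2 * Real.log 2 + deriv Real.Gamma ((N : ℝ) / 2) / Real.Gamma ((N : ℝ) / 2)
    - Real.eulerMascheroniConstant

/-- `c_{N,s} = 2^{2s} π^{-N/2} s Γ((N+2s)/2) / Γ(1-s)`. -/
def cFrac (N : ℕ) (s : ℝ) : ℝ :=
  (2 : ℝ) ^ (2 * s) * Real.pi ^ (-(N : ℝ) / 2) * s *
    (Real.Gamma (((N : ℝ) + 2 * s) / 2) / Real.Gamma (1 - s))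

variable {N : ℕ}

/-! ### The logarithmic Laplacian: energy space, quadratic form, weak eigenfunctions -/

/-- Membership in `ℍ(Ω)`: measurable `u : ℝ^N → ℝ` with `u ≡ 0` on `ℝ^N ∖ Ω` and
`∬_{|x-y| ≤ 1} (u(x)-u(y))² / |x-y|^N dx dy < ∞`. -/
structure MemLogSpace (Ω : Set (EuclideanSpace ℝ (Fin N)))
    (u : EuclideanSpace ℝ (Fin N) → ℝ) : Prop where
  aemeasurable : AEMeasurable u volume
  eq_zero : ∀ x ∉ Ω, u x = 0
  finite_energy : IntegrableOn
    (fun p : EuclideanSpace ℝ (Fin N) × EuclideanSpace ℝ (Fin N) =>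
      (u p.1 - u p.2) ^ 2 / ‖p.1 - p.2‖ ^ N) {p | ‖p.1 - p.2‖ ≤ 1} volume

/-- The quadratic form `ℰ_L` of the logarithmic Laplacian. -/
def logForm (u w : EuclideanSpace ℝ (Fin N) → ℝ) : ℝ :=
  cLog N / 2 *
      (∫ p in {p : EuclideanSpace ℝ (Fin N) × EuclideanSpace ℝ (Fin N) | ‖p.1 - p.2‖ ≤ 1},
        (u p.1 - u p.2) * (w p.1 - w p.2) / ‖p.1 - p.2‖ ^ N)
    - cLog N *
      (∫ p in {p : EuclideanSpace ℝ (Fin N) × EuclideanSpace ℝ (Fin N) | 1 ≤ ‖p.1 - p.2‖},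
        u p.1 * w p.2 / ‖p.1 - p.2‖ ^ N)
    + rhoLog N * ∫ x, u x * w x

/-- `u` is a weak solution of `L_Δ u = lam u` in `Ω`, `u = 0` in `ℝ^N ∖ Ω`. -/
def IsWeakLogSolution (Ω : Set (EuclideanSpace ℝ (Fin N))) (lam : ℝ)
    (u : EuclideanSpace ℝ (Fin N) → ℝ) : Prop :=
  MemLogSpace Ω u ∧
    ∀ φ : EuclideanSpace ℝ (Fin N) → ℝ, MemLogSpace Ω φ →
      logForm u φ = lam * ∫ x in Ω, u x * φ x

/-- The set of Dirichlet eigenvalues of the logarithmic Laplacian on `Ω`. -/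
def logEigenvalues (Ω : Set (EuclideanSpace ℝ (Fin N))) : Set ℝ :=
  {lam | ∃ u : EuclideanSpace ℝ (Fin N) → ℝ, ¬ (u =ᵐ[volume] 0) ∧ IsWeakLogSolution Ω lam u}

/-- `λ_1^L(Ω)`, the first Dirichlet eigenvalue of the logarithmic Laplacian on `Ω`. -/
def firstLogEigenvalue (Ω : Set (EuclideanSpace ℝ (Fin N))) : ℝ := sInf (logEigenvalues Ω)

/-- `ξ` is a nonnegative, `L²`-normalized eigenfunction of the logarithmic Laplacian for
`λ_1^L(Ω)`. -/
structure IsFirstLogEigenfunction (Ω : Set (EuclideanSpace ℝ (Fin N)))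
    (ξ : EuclideanSpace ℝ (Fin N) → ℝ) : Prop where
  weak_solution : IsWeakLogSolution Ω (firstLogEigenvalue Ω) ξ
  nonneg : ∀ᵐ x ∂(volume : Measure (EuclideanSpace ℝ (Fin N))), 0 ≤ ξ x
  normalized : ∫ x in Ω, ξ x ^ 2 = 1

/-! ### The fractional Laplacian: energy space, quadratic form, weak eigenfunctions -/

/-- Membership in the fractional Sobolev space of functions `u ∈ H^s(ℝ^N)` with `u ≡ 0` on
`ℝ^N ∖ Ω`. -/
structure MemFracSpace (Ω : Set (EuclideanSpace ℝ (Fin N))) (s : ℝ)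
    (u : EuclideanSpace ℝ (Fin N) → ℝ) : Prop where
  memLp : MemLp u 2 volume
  eq_zero : ∀ x ∉ Ω, u x = 0
  finite_energy : Integrable
    (fun p : EuclideanSpace ℝ (Fin N) × EuclideanSpace ℝ (Fin N) =>
      (u p.1 - u p.2) ^ 2 / ‖p.1 - p.2‖ ^ ((N : ℝ) + 2 * s)) volume

/-- The quadratic form `ℰ_s` of `(-Δ)^s`. -/
def fracForm (s : ℝ) (u w : EuclideanSpace ℝ (Fin N) → ℝ) : ℝ :=
  cFrac N s / 2 *
    ∫ p : EuclideanSpace ℝ (Fin N) × EuclideanSpace ℝ (Fin N),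
      (u p.1 - u p.2) * (w p.1 - w p.2) / ‖p.1 - p.2‖ ^ ((N : ℝ) + 2 * s)

/-- `u` is a weak solution of `(-Δ)^s u = lam u` in `Ω`, `u = 0` in `ℝ^N ∖ Ω`. -/
def IsWeakFracSolution (Ω : Set (EuclideanSpace ℝ (Fin N))) (s lam : ℝ)
    (u : EuclideanSpace ℝ (Fin N) → ℝ) : Prop :=
  MemFracSpace Ω s u ∧
    ∀ φ : EuclideanSpace ℝ (Fin N) → ℝ, MemFracSpace Ω s φ →
      fracForm s u φ = lam * ∫ x in Ω, u x * φ x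

/-- The set of Dirichlet eigenvalues of `(-Δ)^s` on `Ω`. -/
def fracEigenvalues (Ω : Set (EuclideanSpace ℝ (Fin N))) (s : ℝ) : Set ℝ :=
  {lam | ∃ u : EuclideanSpace ℝ (Fin N) → ℝ, ¬ (u =ᵐ[volume] 0) ∧ IsWeakFracSolution Ω s lam u}

/-- `λ_1^s(Ω)`, the first Dirichlet eigenvalue of `(-Δ)^s` on `Ω`; used for `0 < s < 1`. -/
def firstFracEigenvalue (Ω : Set (EuclideanSpace ℝ (Fin N))) (s : ℝ) : ℝ :=
  sInf (fracEigenvalues Ω s)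

/-- `u` is a nonnegative, `L²`-normalized Dirichlet eigenfunction of `(-Δ)^s` for `λ_1^s(Ω)`. -/
structure IsFirstFracEigenfunction (Ω : Set (EuclideanSpace ℝ (Fin N))) (s : ℝ)
    (u : EuclideanSpace ℝ (Fin N) → ℝ) : Prop where
  weak_solution : IsWeakFracSolution Ω s (firstFracEigenvalue Ω s) u
  nonneg : ∀ᵐ x ∂(volume : Measure (EuclideanSpace ℝ (Fin N))), 0 ≤ u x
  normalized : ∫ x in Ω, u x ^ 2 = 1

end LogLaplace

end

/-!
Why the theorem holds. Split the kernel `|z|^{-N-2s}` of `(-Δ)^s` at `|z| = 1`. The tail is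
integrable with mass `N |B₁| / (2s)`, so multiplying out the differences there turns the form of
`(-Δ)^s` into `ℰ_s(u, w) = ∫ u w + s Q_s(u, w)` (`fracForm_eq`), where `Q_s` has exactly the shape
of the form `ℰ_L` of the logarithmic Laplacian: a Gagliardo form with a kernel supported in `|z| ≤
1`, minus an interaction with a bounded kernel supported in `|z| ≥ 1`, plus a multiple `(d(s) - 1)
/ s` of the `L²` inner product. Here `d` is an explicit quotient of Gamma functions with `d(0) =
1` and `d'(0) = ρ_N` (`hasDerivAt_dFrac`), so the coefficients of `Q_s` converge to those of `Q_0
= ℰ_L` (`logForm_eq`, `tendsto_bFrac`). The eigenvalues of `(-Δ)^s` are `1 + s μ` with `μ` an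
eigenvalue of `Q_s`, and the claim becomes: the first eigenpair of `Q_s` converges to that of
`Q_0`.

All these forms are treated at once as `kernelForm k j b` for an admissible pair of kernels
(`Admissible`), `k` being at least as singular as a multiple of `|z|^{-N}` near the origin. A
function of finite energy vanishing outside a bounded set is square integrable (`MemForm.memLp`),
and since `|z|^{-N}` has infinite mass at the origin (`exists_le_integral_kAnnulus`), the energy
space embeds compactly into `L²` (`exists_subseq_tendsto`). With Fatou's lemma this gives
compactness and lower semicontinuity along sequences of forms with converging kernels
(`exists_subseq_kernelForm_le`). For a fixed form it yields a minimizer of the Rayleigh quotient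
(`exists_minimizer`). Replacing `u` by `|u|` strictly lowers the form unless `u(x) u(y) ≥ 0`
almost everywhere, because at each distance one of the two kernels is positive; so minimizers have
one sign (`IsRayleighBound.nonneg_or_nonpos`), and the nonnegative normalized one is unique
(`IsRayleighBound.ae_eq`).

For the limit `s → 0⁺`, lower semicontinuity bounds the first eigenvalues of `Q_s` from below. For
the upper bound a competitor for `Q_0` is needed that has finite `Q_s`-energy for small `s > 0`:
Lipschitz functions vanishing outside `Ω` will do, and they are dense in the logarithmic energy
space (`IsBoundedLipschitzDomain.isLipschitzLimit`). The density is where the Lipschitz boundary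
enters: after localization, small translations push the support into `Ω`, and averaging over such
translations mollifies. Finally, subsequential `L²` limits of the first eigenfunctions of `Q_s`
are nonnegative normalized minimizers of `Q_0`, hence equal to its first eigenfunction
(`tendsto_firstFracEigenfunction`).
-/

namespace LogLaplace

/-! ### Bilinear forms with a translation-invariant kernel -/

/-- Shorthand for the Euclidean space `ℝ^N`. -/
abbrev Eu (N : ℕ) : Type := EuclideanSpace ℝ (Fin N)

/-- The Gagliardo-type form `∬ k(x-y) (u(x)-u(y)) (w(x)-w(y)) dx dy` of a kernel `k`. -/
noncomputable def gagliardo {N : ℕ} (k u w : Eu N → ℝ) : ℝ :=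
  ∫ p : Eu N × Eu N, k (p.1 - p.2) * ((u p.1 - u p.2) * (w p.1 - w p.2))

/-- The form `∬ j(x-y) u(x) w(y) dx dy` of a kernel `j`. -/
noncomputable def interaction {N : ℕ} (j u w : Eu N → ℝ) : ℝ :=
  ∫ p : Eu N × Eu N, j (p.1 - p.2) * (u p.1 * w p.2)

/-- The common shape of all quadratic forms considered here: a Gagliardo form with kernel `k`, minus
an interaction with kernel `j`, plus `b` times the `L²` inner product. -/
noncomputable def kernelForm {N : ℕ} (k j : Eu N → ℝ) (b : ℝ) (u w : Eu N → ℝ) : ℝ :=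
  gagliardo k u w - interaction j u w + b * ∫ x, u x * w x

/-- The functions of finite energy for the kernel `k` that vanish outside `Ω`. -/
structure MemForm {N : ℕ} (Ω : Set (Eu N)) (k u : Eu N → ℝ) : Prop where
  aemeasurable : AEMeasurable u volume
  eq_zero : ∀ x ∉ Ω, u x = 0
  integrable : Integrable
    (fun p : Eu N × Eu N => k (p.1 - p.2) * ((u p.1 - u p.2) * (u p.1 - u p.2)))

section Algebra

variable {N : ℕ} {Ω : Set (Eu N)} {k j u v w : Eu N → ℝ} {b : ℝ}

lemma aestronglyMeasurable_fst (hu : AEMeasurable u volume) :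
    AEStronglyMeasurable (fun p : Eu N × Eu N => u p.1) volume :=
  hu.aestronglyMeasurable.comp_fst

lemma aestronglyMeasurable_snd (hu : AEMeasurable u volume) :
    AEStronglyMeasurable (fun p : Eu N × Eu N => u p.2) volume :=
  hu.aestronglyMeasurable.comp_snd

lemma aestronglyMeasurable_kernel (hk : Measurable k) :
    AEStronglyMeasurable (fun p : Eu N × Eu N => k (p.1 - p.2)) volume :=
  (hk.comp (measurable_fst.sub measurable_snd)).aestronglyMeasurable

lemma aestronglyMeasurable_gagliardo (hk : Measurable k) (hu : AEMeasurable u volume)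
    (hw : AEMeasurable w volume) :
    AEStronglyMeasurable
      (fun p : Eu N × Eu N => k (p.1 - p.2) * ((u p.1 - u p.2) * (w p.1 - w p.2))) volume :=
  (aestronglyMeasurable_kernel hk).mul
    (((aestronglyMeasurable_fst hu).sub (aestronglyMeasurable_snd hu)).mul
      ((aestronglyMeasurable_fst hw).sub (aestronglyMeasurable_snd hw)))

lemma aestronglyMeasurable_interaction (hj : Measurable j) (hu : AEMeasurable u volume)
    (hw : AEMeasurable w volume) :
    AEStronglyMeasurable (fun p : Eu N × Eu N => j (p.1 - p.2) * (u p.1 * w p.2)) volume :=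
  (aestronglyMeasurable_kernel hj).mul
    ((aestronglyMeasurable_fst hu).mul (aestronglyMeasurable_snd hw))

lemma MemForm.integrable_mul (hk : Measurable k) (hk0 : ∀ z, 0 ≤ k z) (hu : MemForm Ω k u)
    (hw : MemForm Ω k w) :
    Integrable
      (fun p : Eu N × Eu N => k (p.1 - p.2) * ((u p.1 - u p.2) * (w p.1 - w p.2))) := by
  refine (hu.integrable.add hw.integrable).mono'
    (aestronglyMeasurable_gagliardo hk hu.aemeasurable hw.aemeasurable) (ae_of_all _ fun p => ?_)
  rw [Real.norm_eq_abs, abs_mul, abs_of_nonneg (hk0 _), Pi.add_apply, ← mul_add]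
  refine mul_le_mul_of_nonneg_left ?_ (hk0 _)
  rw [abs_le]
  constructor <;> nlinarith [sq_nonneg ((u p.1 - u p.2) + (w p.1 - w p.2)),
    sq_nonneg ((u p.1 - u p.2) - (w p.1 - w p.2)), sq_nonneg (u p.1 - u p.2),
    sq_nonneg (w p.1 - w p.2)]

lemma MemForm.add (hk : Measurable k) (hk0 : ∀ z, 0 ≤ k z) (hu : MemForm Ω k u)
    (hw : MemForm Ω k w) : MemForm Ω k (fun x => u x + w x) where
  aemeasurable := hu.aemeasurable.add hw.aemeasurable
  eq_zero x hx := by simp [hu.eq_zero x hx, hw.eq_zero x hx]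
  integrable := by
    have h := (hu.integrable.add hw.integrable).add ((hu.integrable_mul hk hk0 hw).const_mul 2)
    refine h.congr (ae_of_all _ fun p => ?_)
    simp only [Pi.add_apply]
    ring

lemma MemForm.const_mul (hu : MemForm Ω k u) (t : ℝ) : MemForm Ω k (fun x => t * u x) where
  aemeasurable := hu.aemeasurable.const_mul t
  eq_zero x hx := by simp [hu.eq_zero x hx]
  integrable := by
    refine (hu.integrable.const_mul (t * t)).congr (ae_of_all _ fun p => ?_)
    ring

lemma MemForm.sub (hk : Measurable k) (hk0 : ∀ z, 0 ≤ k z) (hu : MemForm Ω k u)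
    (hw : MemForm Ω k w) : MemForm Ω k (fun x => u x - w x) := by
  have := hu.add hk hk0 (hw.const_mul (-1))
  convert! this using 2
  ring

/-- A function whose differences are dominated by those of a function of finite energy has finite
energy. -/
lemma MemForm.of_abs_sub_le (hk : Measurable k) (hk0 : ∀ z, 0 ≤ k z) (hu : MemForm Ω k u)
    (hw : AEMeasurable w volume) (hw0 : ∀ x ∉ Ω, w x = 0)
    (h : ∀ x y, |w x - w y| ≤ |u x - u y|) : MemForm Ω k w where
  aemeasurable := hw
  eq_zero := hw0
  integrable := by
    refine hu.integrable.mono' (aestronglyMeasurable_gagliardo hk hw hw) (ae_of_all _ fun p => ?_)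
    rw [Real.norm_eq_abs, abs_mul, abs_of_nonneg (hk0 _)]
    refine mul_le_mul_of_nonneg_left ?_ (hk0 _)
    rw [abs_mul_self, ← abs_mul_abs_self (w _ - _), ← abs_mul_abs_self (u _ - _)]
    exact mul_self_le_mul_self (abs_nonneg _) (h _ _)

lemma MemForm.abs (hk : Measurable k) (hk0 : ∀ z, 0 ≤ k z) (hu : MemForm Ω k u) :
    MemForm Ω k (fun x => |u x|) :=
  hu.of_abs_sub_le hk hk0 (continuous_abs.measurable.comp_aemeasurable hu.aemeasurable)
    (fun x hx => by simp [hu.eq_zero x hx]) fun x y => abs_abs_sub_abs_le (u x) (u y)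

lemma MemForm.mono {k' : Eu N → ℝ} {c : ℝ} (hu : MemForm Ω k u) (hc : 0 < c)
    (hk' : Measurable k') (hk0 : ∀ z, 0 ≤ k' z) (h : ∀ z, c * k' z ≤ k z) : MemForm Ω k' u where
  aemeasurable := hu.aemeasurable
  eq_zero := hu.eq_zero
  integrable := by
    refine (hu.integrable.const_mul c⁻¹).mono'
      (aestronglyMeasurable_gagliardo hk' hu.aemeasurable hu.aemeasurable) (ae_of_all _ fun p => ?_)
    rw [Real.norm_eq_abs,
      abs_of_nonneg (mul_nonneg (hk0 _) (mul_self_nonneg (u p.1 - u p.2))), le_inv_mul_iff₀ hc,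
      ← mul_assoc]
    exact mul_le_mul_of_nonneg_right (h _) (mul_self_nonneg _)

lemma gagliardo_nonneg (hk0 : ∀ z, 0 ≤ k z) (u : Eu N → ℝ) : 0 ≤ gagliardo k u u :=
  integral_nonneg fun _ => mul_nonneg (hk0 _) (mul_self_nonneg _)

lemma gagliardo_comm (k u w : Eu N → ℝ) : gagliardo k u w = gagliardo k w u := by
  simp only [gagliardo, mul_comm]

lemma gagliardo_mono {k' : Eu N → ℝ} {c : ℝ} (hu : MemForm Ω k u)
    (hu' : MemForm Ω k' u) (h : ∀ z, c * k' z ≤ k z) :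
    c * gagliardo k' u u ≤ gagliardo k u u := by
  unfold gagliardo
  rw [← integral_const_mul]
  refine integral_mono (hu'.integrable.const_mul c) hu.integrable fun p => ?_
  rw [← mul_assoc]
  exact mul_le_mul_of_nonneg_right (h _) (mul_self_nonneg _)

lemma gagliardo_add_left (hk : Measurable k) (hk0 : ∀ z, 0 ≤ k z) (hu : MemForm Ω k u)
    (hv : MemForm Ω k v) (hw : MemForm Ω k w) :
    gagliardo k (fun x => u x + v x) w = gagliardo k u w + gagliardo k v w := by
  unfold gagliardo
  rw [← integral_add (hu.integrable_mul hk hk0 hw) (hv.integrable_mul hk hk0 hw)]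
  congr 1 with p
  ring

lemma gagliardo_const_mul_left (k u w : Eu N → ℝ) (t : ℝ) :
    gagliardo k (fun x => t * u x) w = t * gagliardo k u w := by
  unfold gagliardo
  rw [← integral_const_mul]
  congr 1 with p
  ring

lemma integrable_of_memLp (hΩ : Bornology.IsBounded Ω) (hu : MemLp u 2 volume)
    (hu0 : ∀ x ∉ Ω, u x = 0) : Integrable u := by
  obtain ⟨R, hR⟩ := hΩ.subset_closedBall 0
  have h : IntegrableOn u (Metric.closedBall 0 R) := by
    have : IsFiniteMeasure (volume.restrict (Metric.closedBall (0 : Eu N) R)) :=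
      ⟨by rw [Measure.restrict_apply_univ]; exact measure_closedBall_lt_top⟩
    exact (hu.restrict _).integrable one_le_two
  refine (integrableOn_iff_integrable_of_support_subset fun x hx => ?_).1 h
  by_contra hx'
  exact hx (hu0 x fun h => hx' (hR h))

/-- Cauchy-Schwarz for a function supported in a bounded set. -/
lemma integral_abs_sq_le (hΩ : Bornology.IsBounded Ω) (hu : MemLp u 2 volume)
    (hu0 : ∀ x ∉ Ω, u x = 0) :
    (∫ x, |u x|) ^ 2 ≤ volume.real (closure Ω) * ∫ x, u x * u x := by
  have hcl : volume (closure Ω) < ⊤ := hΩ.closure.measure_lt_top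
  have hm : MeasurableSet (closure Ω) := isClosed_closure.measurableSet
  have hint := integrable_of_memLp hΩ hu hu0
  have hsq : Integrable fun x => u x * u x := by simpa [sq] using hu.integrable_sq
  have hone : Integrable ((closure Ω).indicator fun _ => (1 : ℝ)) :=
    (integrable_indicator_iff hm).2 (integrableOn_const hcl.ne)
  set A := ∫ x, |u x|
  set V := volume.real (closure Ω)
  set S := ∫ x, u x * u x
  -- the quadratic polynomial `t ↦ ∫ (t 1_Ω - |u|)²` is nonnegative
  have key : ∀ t : ℝ, 0 ≤ V * (t * t) + (-2 * A) * t + S := by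
    intro t
    have h1 : 0 ≤ ∫ x, (t * (closure Ω).indicator (fun _ => (1 : ℝ)) x - |u x|) ^ 2 :=
      integral_nonneg fun x => sq_nonneg _
    have h2 : ∀ x, (t * (closure Ω).indicator (fun _ => (1 : ℝ)) x - |u x|) ^ 2
        = t * t * (closure Ω).indicator (fun _ => (1 : ℝ)) x + (-2 * t) * |u x| + u x * u x := by
      intro x
      by_cases hx : x ∈ closure Ω
      · simp only [indicator_of_mem hx]
        nlinarith [abs_mul_abs_self (u x)]
      · simp [indicator_of_notMem hx, hu0 x fun h => hx (subset_closure h)]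
    simp only [h2] at h1
    have h3 : Integrable fun x => t * t * (closure Ω).indicator (fun _ => (1 : ℝ)) x
        + (-2 * t) * |u x| := (hone.const_mul _).add (hint.abs.const_mul _)
    rw [integral_add h3 hsq, integral_add (hone.const_mul _) (hint.abs.const_mul _),
      integral_const_mul, integral_const_mul, integral_indicator hm, setIntegral_const] at h1
    simp only [smul_eq_mul, mul_one] at h1
    change 0 ≤ t * t * V + -2 * t * A + S at h1
    linarith
  have := discrim_le_zero key
  unfold discrim at this
  nlinarith

lemma integrable_mul_of_memLp (hu : MemLp u 2 volume) (hw : MemLp w 2 volume) :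
    Integrable fun x => u x * w x := hu.integrable_mul hw

lemma integrable_interaction {C : ℝ} (hj : Measurable j) (hjC : ∀ z, |j z| ≤ C)
    (hu : Integrable u) (hw : Integrable w) :
    Integrable (fun p : Eu N × Eu N => j (p.1 - p.2) * (u p.1 * w p.2)) := by
  refine ((hu.mul_prod hw).norm.const_mul C).mono'
    (aestronglyMeasurable_interaction hj hu.aemeasurable hw.aemeasurable) (ae_of_all _ fun p => ?_)
  rw [norm_mul]
  exact mul_le_mul_of_nonneg_right (hjC _) (norm_nonneg _)

lemma abs_interaction_le {C : ℝ} (hjC : ∀ z, |j z| ≤ C)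
    (hu : Integrable u) (hw : Integrable w) :
    |interaction j u w| ≤ C * ((∫ x, |u x|) * ∫ x, |w x|) := by
  have h := norm_integral_le_of_norm_le (f := fun p : Eu N × Eu N =>
    j (p.1 - p.2) * (u p.1 * w p.2)) ((hu.mul_prod hw).norm.const_mul C) (ae_of_all _ fun p => by
      rw [norm_mul]; exact mul_le_mul_of_nonneg_right (hjC _) (norm_nonneg _))
  refine (Real.norm_eq_abs _ ▸ h).trans_eq ?_
  rw [integral_const_mul]
  congr 1
  simp only [norm_mul, Real.norm_eq_abs]
  exact integral_prod_mul (fun x => |u x|) (fun x => |w x|)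

lemma interaction_add_left {C : ℝ} (hj : Measurable j) (hjC : ∀ z, |j z| ≤ C)
    (hu : Integrable u) (hv : Integrable v) (hw : Integrable w) :
    interaction j (fun x => u x + v x) w = interaction j u w + interaction j v w := by
  unfold interaction
  rw [← integral_add (integrable_interaction hj hjC hu hw) (integrable_interaction hj hjC hv hw)]
  congr 1 with p
  ring

lemma interaction_const_mul_left (j u w : Eu N → ℝ) (t : ℝ) :
    interaction j (fun x => t * u x) w = t * interaction j u w := by
  unfold interaction
  rw [← integral_const_mul]
  congr 1 with p
  ring

lemma interaction_comm (hj : ∀ z, j (-z) = j z) (u w : Eu N → ℝ) :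
    interaction j u w = interaction j w u := by
  unfold interaction
  rw [Measure.volume_eq_prod, ← integral_prod_swap]
  congr 1 with p
  rw [Prod.fst_swap, Prod.snd_swap, ← hj, neg_sub]
  ring

lemma integrable_kernel_mul_fst {f : Eu N → ℝ} (hk : Integrable k) (hk' : ∀ z, k (-z) = k z)
    (hf : Integrable f) : Integrable (fun p : Eu N × Eu N => k (p.1 - p.2) * f p.1) := by
  have h := (hf.convolution_integrand (ContinuousLinearMap.mul ℝ ℝ) hk).swap
  refine h.congr (ae_of_all _ fun p => ?_)
  simp only [Function.comp, Prod.fst_swap, Prod.snd_swap, ContinuousLinearMap.mul_apply']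
  rw [mul_comm, ← hk', neg_sub]

lemma integrable_kernel_mul_snd {f : Eu N → ℝ} (hk : Integrable k)
    (hf : Integrable f) : Integrable (fun p : Eu N × Eu N => k (p.1 - p.2) * f p.2) := by
  have h := (hf.convolution_integrand (ContinuousLinearMap.mul ℝ ℝ) hk)
  refine h.congr (ae_of_all _ fun p => ?_)
  simp only [ContinuousLinearMap.mul_apply']
  rw [mul_comm]

lemma integral_kernel_mul_snd {f : Eu N → ℝ} (hk : Integrable k)
    (hf : Integrable f) : ∫ p : Eu N × Eu N, k (p.1 - p.2) * f p.2 = (∫ z, k z) * ∫ x, f x := by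
  rw [Measure.volume_eq_prod, integral_prod_symm _ (integrable_kernel_mul_snd hk hf)]
  simp only [integral_mul_const, integral_sub_right_eq_self (fun z => k z), integral_const_mul]

lemma integral_kernel_mul_fst {f : Eu N → ℝ} (hk : Integrable k) (hk' : ∀ z, k (-z) = k z)
    (hf : Integrable f) : ∫ p : Eu N × Eu N, k (p.1 - p.2) * f p.1 = (∫ z, k z) * ∫ x, f x := by
  rw [← integral_kernel_mul_snd hk hf, Measure.volume_eq_prod, ← integral_prod_swap]
  congr 1 with p
  rw [Prod.fst_swap, Prod.snd_swap, ← hk', neg_sub]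

lemma integrable_interaction_of_memLp (hk : Integrable k) (hkm : Measurable k)
    (hk' : ∀ z, k (-z) = k z)
    (hu : MemLp u 2 volume) (hw : MemLp w 2 volume) :
    Integrable (fun p : Eu N × Eu N => k (p.1 - p.2) * (u p.1 * w p.2)) := by
  have hk'' : ∀ z, |k (-z)| = |k z| := fun z => by rw [hk']
  refine ((integrable_kernel_mul_fst hk.abs hk'' (hu.integrable_mul hu)).add
    (integrable_kernel_mul_snd hk.abs (hw.integrable_mul hw))).mono'
    (aestronglyMeasurable_interaction hkm hu.aemeasurable hw.aemeasurable) (ae_of_all _ fun p => ?_)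
  rw [Real.norm_eq_abs, abs_mul, Pi.add_apply, ← mul_add]
  refine mul_le_mul_of_nonneg_left ?_ (abs_nonneg _)
  simp only [Pi.mul_apply]
  rw [abs_le]
  constructor <;> nlinarith [sq_nonneg (u p.1 + w p.2), sq_nonneg (u p.1 - w p.2),
    sq_nonneg (u p.1), sq_nonneg (w p.2)]

/-- For an integrable even kernel the Gagliardo integrand is integrable on `L²`. -/
lemma integrable_gagliardo_of_memLp (hk : Integrable k) (hkm : Measurable k)
    (hk' : ∀ z, k (-z) = k z) (hu : MemLp u 2 volume) (hw : MemLp w 2 volume) :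
    Integrable
      (fun p : Eu N × Eu N => k (p.1 - p.2) * ((u p.1 - u p.2) * (w p.1 - w p.2))) := by
  have h1 := integrable_kernel_mul_fst hk hk' (hu.integrable_mul hw)
  have h2 := integrable_kernel_mul_snd hk (hu.integrable_mul hw)
  have h3 := integrable_interaction_of_memLp hk hkm hk' hu hw
  have h4 := integrable_interaction_of_memLp hk hkm hk' hw hu
  refine ((h1.add h2).sub (h3.add h4)).congr (ae_of_all _ fun p => ?_)
  simp only [Pi.sub_apply, Pi.add_apply, Pi.mul_apply]
  ring

/-- Multiplying out the differences in the Gagliardo form of an integrable even kernel. -/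
lemma gagliardo_eq_of_integrable (hk : Integrable k) (hkm : Measurable k)
    (hk' : ∀ z, k (-z) = k z) (hu : MemLp u 2 volume) (hw : MemLp w 2 volume) :
    gagliardo k u w = 2 * (∫ z, k z) * (∫ x, u x * w x) - 2 * interaction k u w := by
  have huw : Integrable (fun x => u x * w x) := hu.integrable_mul hw
  have h1 := integrable_kernel_mul_fst hk hk' huw
  have h2 := integrable_kernel_mul_snd hk huw
  have h3 := integrable_interaction_of_memLp hk hkm hk' hu hw
  have h4 := integrable_interaction_of_memLp hk hkm hk' hw hu
  have e1 := integral_kernel_mul_fst hk hk' huw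
  have e2 := integral_kernel_mul_snd hk huw
  have e4 := interaction_comm hk' w u
  have : gagliardo k u w = ∫ p : Eu N × Eu N, (k (p.1 - p.2) * (u p.1 * w p.1)
      + k (p.1 - p.2) * (u p.2 * w p.2)) - (k (p.1 - p.2) * (u p.1 * w p.2)
      + k (p.1 - p.2) * (w p.1 * u p.2)) := by
    unfold gagliardo
    congr 1 with p
    ring
  have h12 : Integrable fun p : Eu N × Eu N => k (p.1 - p.2) * (u p.1 * w p.1)
      + k (p.1 - p.2) * (u p.2 * w p.2) := h1.add h2
  have h34 : Integrable fun p : Eu N × Eu N => k (p.1 - p.2) * (u p.1 * w p.2)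
      + k (p.1 - p.2) * (w p.1 * u p.2) := h3.add h4
  rw [this, integral_sub h12 h34, integral_add h1 h2, integral_add h3 h4, e1, e2]
  change _ - (interaction k u w + interaction k w u) = _
  rw [e4]
  ring

end Algebra

/-! ### The kernels -/

/-- The singular part `1_{|z| ≤ 1} |z|^{-N-2s}` of the kernel of order `2s`. -/
noncomputable def kNear {N : ℕ} (s : ℝ) (z : Eu N) : ℝ :=
  (Iic (1 : ℝ)).indicator (fun r => (r ^ ((N : ℝ) + 2 * s))⁻¹) ‖z‖

/-- The tail `1_{|z| ≥ 1} |z|^{-N-2s}` of the kernel of order `2s`. -/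
noncomputable def kFar {N : ℕ} (s : ℝ) (z : Eu N) : ℝ :=
  (Ici (1 : ℝ)).indicator (fun r => (r ^ ((N : ℝ) + 2 * s))⁻¹) ‖z‖

/-- The logarithmic kernel `|z|^{-N}` restricted to the annulus `δ ≤ |z| ≤ 1`. -/
noncomputable def kAnnulus {N : ℕ} (δ : ℝ) (z : Eu N) : ℝ :=
  (Icc δ 1).indicator (fun r => (r ^ ((N : ℝ) + 2 * 0))⁻¹) ‖z‖

section Kernels

variable {N : ℕ}

lemma measurable_kNear (s : ℝ) : Measurable (kNear s : Eu N → ℝ) :=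
  Measurable.comp (Measurable.indicator (by fun_prop) measurableSet_Iic) measurable_norm

lemma measurable_kFar (s : ℝ) : Measurable (kFar s : Eu N → ℝ) :=
  Measurable.comp (Measurable.indicator (by fun_prop) measurableSet_Ici) measurable_norm

lemma measurable_kAnnulus (δ : ℝ) : Measurable (kAnnulus δ : Eu N → ℝ) :=
  Measurable.comp (Measurable.indicator (by fun_prop) measurableSet_Icc) measurable_norm

lemma kNear_neg (s : ℝ) (z : Eu N) : kNear s (-z) = kNear s z := by simp [kNear]

lemma kFar_neg (s : ℝ) (z : Eu N) : kFar s (-z) = kFar s z := by simp [kFar]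

lemma kAnnulus_neg (δ : ℝ) (z : Eu N) : kAnnulus δ (-z) = kAnnulus δ z := by simp [kAnnulus]

lemma kNear_of_le {s : ℝ} {z : Eu N} (h : ‖z‖ ≤ 1) :
    kNear s z = (‖z‖ ^ ((N : ℝ) + 2 * s))⁻¹ := indicator_of_mem (s := Iic (1 : ℝ)) h _

lemma kNear_of_lt {s : ℝ} {z : Eu N} (h : 1 < ‖z‖) : kNear s z = 0 :=
  indicator_of_notMem (s := Iic (1 : ℝ)) (not_le.2 h) _

lemma kFar_of_le {s : ℝ} {z : Eu N} (h : 1 ≤ ‖z‖) :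
    kFar s z = (‖z‖ ^ ((N : ℝ) + 2 * s))⁻¹ := indicator_of_mem (s := Ici (1 : ℝ)) h _

lemma kFar_of_lt {s : ℝ} {z : Eu N} (h : ‖z‖ < 1) : kFar s z = 0 :=
  indicator_of_notMem (s := Ici (1 : ℝ)) (not_le.2 h) _

lemma kNear_nonneg (s : ℝ) (z : Eu N) : 0 ≤ kNear s z :=
  indicator_apply_nonneg fun _ => inv_nonneg.2 (Real.rpow_nonneg (norm_nonneg z) _)

lemma kFar_nonneg (s : ℝ) (z : Eu N) : 0 ≤ kFar s z :=
  indicator_apply_nonneg fun _ => inv_nonneg.2 (Real.rpow_nonneg (norm_nonneg z) _)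

lemma kAnnulus_nonneg (δ : ℝ) (z : Eu N) : 0 ≤ kAnnulus δ z :=
  indicator_apply_nonneg fun _ => inv_nonneg.2 (Real.rpow_nonneg (norm_nonneg z) _)

lemma kAnnulus_le_kNear (δ : ℝ) (z : Eu N) : kAnnulus δ z ≤ kNear 0 z := by
  unfold kAnnulus
  rw [indicator_apply]
  split_ifs with h
  · rw [kNear_of_le h.2]
  · exact kNear_nonneg 0 z

lemma kNear_mono (hN : 1 ≤ N) {s t : ℝ} (hs : 0 ≤ s) (hst : s ≤ t) (z : Eu N) :
    kNear s z ≤ kNear t z := by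
  have hN' : (1 : ℝ) ≤ N := by exact_mod_cast hN
  rcases lt_or_ge 1 ‖z‖ with h | h
  · rw [kNear_of_lt h, kNear_of_lt h]
  rw [kNear_of_le h, kNear_of_le h]
  rcases (norm_nonneg z).eq_or_lt with h0 | h0
  · rw [← h0, Real.zero_rpow (by linarith), Real.zero_rpow (by linarith)]
  · exact inv_anti₀ (Real.rpow_pos_of_pos h0 _)
      (Real.rpow_le_rpow_of_exponent_ge h0 h (by linarith))

lemma kFar_le_one {s : ℝ} (hs : 0 ≤ s) (z : Eu N) : kFar s z ≤ 1 := by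
  rcases lt_or_ge ‖z‖ 1 with h | h
  · rw [kFar_of_lt h]; exact zero_le_one
  · rw [kFar_of_le h]
    exact inv_le_one_of_one_le₀ (Real.one_le_rpow h (by positivity))

lemma tendsto_rpow_exponent (hN : 1 ≤ N) {ι : Type*} {l : Filter ι} {s : ι → ℝ} {σ : ℝ}
    (hσ : 0 ≤ σ) (hs : Tendsto s l (𝓝 σ)) (r : ℝ) :
    Tendsto (fun i => (r ^ ((N : ℝ) + 2 * s i))) l (𝓝 (r ^ ((N : ℝ) + 2 * σ))) := by
  have hN' : (1 : ℝ) ≤ N := by exact_mod_cast hN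
  exact tendsto_const_nhds.rpow (tendsto_const_nhds.add (hs.const_mul 2)) (Or.inr (by positivity))

lemma tendsto_kNear (hN : 1 ≤ N) {ι : Type*} {l : Filter ι} {s : ι → ℝ} {σ : ℝ}
    (hσ : 0 ≤ σ) (hs : Tendsto s l (𝓝 σ)) (z : Eu N) :
    Tendsto (fun i => kNear (s i) z) l (𝓝 (kNear σ z)) := by
  have hN' : (1 : ℝ) ≤ N := by exact_mod_cast hN
  rcases lt_or_ge 1 ‖z‖ with h | h
  · simp only [kNear_of_lt h]; exact tendsto_const_nhds
  simp only [kNear_of_le h]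
  rcases (norm_nonneg z).eq_or_lt with h0 | h0
  · have : ∀ᶠ i in l, (‖z‖ ^ ((N : ℝ) + 2 * s i))⁻¹ = (‖z‖ ^ ((N : ℝ) + 2 * σ))⁻¹ := by
      filter_upwards [hs.eventually (lt_mem_nhds (by linarith : (-1 / 4 : ℝ) < σ))] with i hi
      rw [← h0, Real.zero_rpow (by linarith), Real.zero_rpow (by linarith)]
    exact tendsto_const_nhds.congr' (this.mono fun i hi => hi.symm)
  · exact (tendsto_rpow_exponent hN hσ hs _).inv₀ (Real.rpow_pos_of_pos h0 _).ne'

lemma tendsto_kFar (hN : 1 ≤ N) {ι : Type*} {l : Filter ι} {s : ι → ℝ} {σ : ℝ}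
    (hσ : 0 ≤ σ) (hs : Tendsto s l (𝓝 σ)) (z : Eu N) :
    Tendsto (fun i => kFar (s i) z) l (𝓝 (kFar σ z)) := by
  rcases lt_or_ge ‖z‖ 1 with h | h
  · simp only [kFar_of_lt h]; exact tendsto_const_nhds
  simp only [kFar_of_le h]
  exact (tendsto_rpow_exponent hN hσ hs _).inv₀ (Real.rpow_pos_of_pos (by linarith) _).ne'

lemma nontrivial_eu (hN : 1 ≤ N) : Nontrivial (Eu N) := by
  have : Nonempty (Fin N) := ⟨⟨0, hN⟩⟩
  infer_instance

lemma pow_pred_mul_rpow (hN : 1 ≤ N) {s y : ℝ} (hy : 0 < y) :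
    y ^ (N - 1) * (y ^ ((N : ℝ) + 2 * s))⁻¹ = y ^ (-1 - 2 * s) := by
  rw [← Real.rpow_natCast, ← Real.rpow_neg hy.le, ← Real.rpow_add hy, Nat.cast_sub hN]
  congr 1
  push_cast
  ring

lemma integrable_kFar (hN : 1 ≤ N) {s : ℝ} (hs : 0 < s) : Integrable (kFar s : Eu N → ℝ) := by
  have := nontrivial_eu hN
  unfold kFar
  rw [integrable_fun_norm_addHaar volume
    (f := (Ici (1 : ℝ)).indicator (fun r => (r ^ ((N : ℝ) + 2 * s))⁻¹))]
  have h1 : IntegrableOn (fun y : ℝ => y ^ (-1 - 2 * s)) (Ici 1) := by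
    rw [integrableOn_Ici_iff_integrableOn_Ioi]
    exact integrableOn_Ioi_rpow_of_lt (by linarith) one_pos
  have h2 := (integrable_indicator_iff measurableSet_Ici).2 h1
  refine (h2.integrableOn (s := Ioi 0)).congr_fun (fun y hy => ?_) measurableSet_Ioi
  simp only [indicator_apply, finrank_euclideanSpace, Fintype.card_fin, smul_eq_mul]
  split_ifs
  · rw [pow_pred_mul_rpow hN hy]
  · simp

lemma integral_kFar (hN : 1 ≤ N) {s : ℝ} (hs : 0 < s) :
    ∫ z : Eu N, kFar s z = N * volume.real (Metric.ball (0 : Eu N) 1) / (2 * s) := by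
  have := nontrivial_eu hN
  unfold kFar
  rw [integral_fun_norm_addHaar volume
    ((Ici (1 : ℝ)).indicator (fun r => (r ^ ((N : ℝ) + 2 * s))⁻¹))]
  have h : ∀ y ∈ Ioi (0 : ℝ), y ^ (N - 1) •
      (Ici (1 : ℝ)).indicator (fun r => (r ^ ((N : ℝ) + 2 * s))⁻¹) y
      = (Ici (1 : ℝ)).indicator (fun y => y ^ (-1 - 2 * s)) y := by
    intro y hy
    simp only [indicator_apply, smul_eq_mul]
    split_ifs
    · rw [pow_pred_mul_rpow hN hy]
    · simp
  rw [finrank_euclideanSpace, Fintype.card_fin, setIntegral_congr_fun measurableSet_Ioi h,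
    setIntegral_indicator measurableSet_Ici,
    inter_eq_self_of_subset_right (Ici_subset_Ioi.2 one_pos),
    integral_Ici_eq_integral_Ioi, integral_Ioi_rpow_of_lt (by linarith) one_pos]
  simp only [Real.one_rpow, nsmul_eq_mul, smul_eq_mul]
  have : s ≠ 0 := hs.ne'
  have h2 : (-1 - 2 * s + 1) ≠ 0 := by
    intro h; apply this; linarith
  field_simp
  ring

lemma integrable_sq_mul_kNear (hN : 1 ≤ N) {s : ℝ} (hs : s < 1) :
    Integrable (fun z : Eu N => ‖z‖ ^ 2 * kNear s z) := by
  have := nontrivial_eu hN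
  unfold kNear
  rw [integrable_fun_norm_addHaar volume
    (f := fun r => r ^ 2 * (Iic (1 : ℝ)).indicator (fun r => (r ^ ((N : ℝ) + 2 * s))⁻¹) r)]
  have h1 : IntegrableOn (fun y : ℝ => y ^ (1 - 2 * s)) (Ioc 0 1) := by
    rw [← intervalIntegrable_iff_integrableOn_Ioc_of_le zero_le_one]
    exact intervalIntegral.intervalIntegrable_rpow' (by linarith)
  have h2 := (integrable_indicator_iff measurableSet_Ioc).2 h1
  refine (h2.integrableOn (s := Ioi 0)).congr_fun (fun y (hy : 0 < y) => ?_) measurableSet_Ioi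
  simp only [indicator_apply, finrank_euclideanSpace, Fintype.card_fin, smul_eq_mul, mem_Ioc, hy,
    true_and, mem_Iic]
  split_ifs
  · rw [mul_left_comm, pow_pred_mul_rpow hN hy, ← Real.rpow_two, ← Real.rpow_add hy]
    congr 1
    ring
  · simp

lemma kAnnulus_le {δ : ℝ} (hδ : 0 < δ) (z : Eu N) : kAnnulus δ z ≤ (δ ^ N)⁻¹ := by
  unfold kAnnulus
  rw [indicator_apply]
  split_ifs with h
  · rw [mul_zero, add_zero, Real.rpow_natCast]
    exact inv_anti₀ (pow_pos hδ _) (pow_le_pow_left₀ hδ.le h.1 _)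
  · positivity

lemma kAnnulus_eq_zero {δ : ℝ} {z : Eu N} (h : 1 < ‖z‖) : kAnnulus δ z = 0 :=
  indicator_of_notMem (s := Icc δ 1) (fun h' => absurd h'.2 (not_le.2 h)) _

lemma integrable_kAnnulus {δ : ℝ} (hδ : 0 < δ) : Integrable (kAnnulus δ : Eu N → ℝ) := by
  have h : Integrable ((Metric.closedBall (0 : Eu N) 1).indicator fun _ => (δ ^ N)⁻¹) :=
    (integrable_indicator_iff Metric.isClosed_closedBall.measurableSet).2
      (integrableOn_const measure_closedBall_lt_top.ne)
  refine h.mono' (measurable_kAnnulus δ).aestronglyMeasurable (ae_of_all _ fun z => ?_)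
  rw [Real.norm_eq_abs, abs_of_nonneg (kAnnulus_nonneg δ z)]
  by_cases hz : z ∈ Metric.closedBall (0 : Eu N) 1
  · rw [indicator_of_mem hz]
    exact kAnnulus_le hδ z
  · rw [indicator_of_notMem hz, kAnnulus_eq_zero (by simpa using hz)]

lemma integral_kAnnulus (hN : 1 ≤ N) {δ : ℝ} (hδ : 0 < δ) (hδ1 : δ ≤ 1) :
    ∫ z : Eu N, kAnnulus δ z = N * volume.real (Metric.ball (0 : Eu N) 1) * -Real.log δ := by
  have := nontrivial_eu hN
  unfold kAnnulus
  rw [integral_fun_norm_addHaar volume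
    ((Icc δ 1).indicator (fun r => (r ^ ((N : ℝ) + 2 * 0))⁻¹))]
  have h : ∀ y ∈ Ioi (0 : ℝ), y ^ (N - 1) •
      (Icc δ 1).indicator (fun r => (r ^ ((N : ℝ) + 2 * 0))⁻¹) y
      = (Icc δ 1).indicator (fun y => 1 / y) y := by
    intro y hy
    simp only [indicator_apply, smul_eq_mul]
    split_ifs
    · rw [pow_pred_mul_rpow hN hy, mul_zero, sub_zero, Real.rpow_neg_one, one_div]
    · simp
  rw [finrank_euclideanSpace, Fintype.card_fin, setIntegral_congr_fun measurableSet_Ioi h,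
    setIntegral_indicator measurableSet_Icc,
    inter_eq_self_of_subset_right (fun y hy => mem_Ioi.2 (lt_of_lt_of_le hδ hy.1)),
    integral_Icc_eq_integral_Ioc, ← intervalIntegral.integral_of_le hδ1,
    integral_one_div_of_pos hδ one_pos]
  simp only [nsmul_eq_mul, smul_eq_mul, one_div, Real.log_inv, mul_assoc]

/-- The logarithmic kernel has infinite mass at the origin; this is what makes the embedding of the
energy space into `L²` compact. -/
lemma exists_le_integral_kAnnulus (hN : 1 ≤ N) (M : ℝ) :
    ∃ δ : ℝ, 0 < δ ∧ M ≤ ∫ z : Eu N, kAnnulus δ z := by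
  have hV : 0 < N * volume.real (Metric.ball (0 : Eu N) 1) :=
    mul_pos (by exact_mod_cast hN)
      (ENNReal.toReal_pos (Metric.measure_ball_pos _ _ one_pos).ne' measure_ball_lt_top.ne)
  set V := N * volume.real (Metric.ball (0 : Eu N) 1)
  refine ⟨Real.exp (-(|M| / V)), Real.exp_pos _, ?_⟩
  rw [integral_kAnnulus hN (Real.exp_pos _) (Real.exp_le_one_iff.2 (by
    rw [neg_nonpos]; positivity)), Real.log_exp, neg_neg, mul_div_cancel₀ _ hV.ne']
  exact le_abs_self M

end Kernels

/-! ### Functions of finite energy are square integrable -/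

section SquareIntegrable

variable {N : ℕ} {Ω : Set (Eu N)} {u : Eu N → ℝ}

lemma memLp_comp_const_add (hu : MemLp u 2 volume) (h : Eu N) :
    MemLp (fun x => u (h + x)) 2 volume :=
  hu.comp_measurePreserving (measurePreserving_add_left volume h)

lemma aemeasurable_comp_const_add (hu : AEMeasurable u volume) (h : Eu N) :
    AEMeasurable (fun x => u (h + x)) volume :=
  hu.comp_quasiMeasurePreserving (measurePreserving_add_left volume h).quasiMeasurePreserving

/-- Almost every difference `u(h + ·) - u` with `|h| ≤ 1` is square integrable; telescoping along a
direction `h` until `Ω` is left shows that `u` itself is. -/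
theorem MemForm.memLp (hN : 1 ≤ N) (hΩ : Bornology.IsBounded Ω) (hu : MemForm Ω (kNear 0) u) :
    MemLp u 2 volume := by
  have := nontrivial_eu hN
  have h1 := (measurePreserving_add_prod (volume : Measure (Eu N))
    (volume : Measure (Eu N))).integrable_comp_of_integrable hu.integrable
  have h2 := h1.prod_right_ae
  obtain ⟨e, he⟩ := exists_norm_eq (Eu N) (show (0 : ℝ) ≤ 3 / 4 by norm_num)
  obtain ⟨h, hint, hh⟩ := (Measure.dense_of_ae h2).exists_mem_open
    (Metric.isOpen_ball (x := e) (ε := 1 / 4)) ⟨e, Metric.mem_ball_self (by norm_num)⟩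
  rw [Metric.mem_ball, dist_eq_norm] at hh
  have hn1 : ‖h‖ ≤ 1 := by
    have := norm_add_le (h - e) e
    rw [sub_add_cancel] at this
    linarith
  have hn2 : 1 / 2 ≤ ‖h‖ := by
    have := norm_sub_norm_le e h
    rw [norm_sub_rev] at this
    linarith
  have hk : kNear 0 h ≠ 0 := by
    rw [kNear_of_le hn1]
    exact inv_ne_zero (Real.rpow_pos_of_pos (by linarith) _).ne'
  have hD : MemLp (fun x => u (h + x) - u x) 2 volume := by
    have hm : AEStronglyMeasurable (fun x => u (h + x) - u x) volume :=
      ((aemeasurable_comp_const_add hu.aemeasurable h).sub hu.aemeasurable).aestronglyMeasurable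
    rw [memLp_two_iff_integrable_sq hm]
    have h3 := Integrable.const_mul hint (kNear 0 h)⁻¹
    refine h3.congr (ae_of_all _ fun x => ?_)
    simp only [Function.comp, add_sub_cancel_right]
    field_simp
  have hn : ∀ n : ℕ, MemLp (fun x => u (n • h + x) - u x) 2 volume := by
    intro n
    induction n with
    | zero => simp
    | succ n ih =>
      have h4 := (memLp_comp_const_add hD (n • h)).add ih
      refine h4.ae_eq (ae_of_all _ fun x => ?_)
      simp only [Pi.add_apply, succ_nsmul]
      rw [← add_assoc, add_comm h (n • h)]
      ring
  obtain ⟨R, hR⟩ := hΩ.subset_closedBall 0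
  obtain ⟨n, hn'⟩ := exists_nat_gt (4 * R)
  refine (hn n).mono hu.aemeasurable.aestronglyMeasurable (ae_of_all _ fun x => ?_)
  by_cases hx : x ∈ Ω
  · have hx' : n • h + x ∉ Ω := by
      intro h5
      have h6 := mem_closedBall_zero_iff.1 (hR h5)
      have h7 := mem_closedBall_zero_iff.1 (hR hx)
      have h8 : ‖n • h‖ ≤ ‖n • h + x‖ + ‖x‖ := by
        simpa using norm_sub_le (n • h + x) x
      have h10 : ‖n • h‖ = n * ‖h‖ := by
        rw [← Nat.cast_smul_eq_nsmul ℝ, norm_smul, Real.norm_natCast]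
      have h9 : (n : ℝ) * (1 / 2) ≤ n * ‖h‖ := mul_le_mul_of_nonneg_left hn2 n.cast_nonneg
      linarith
    simp [hu.eq_zero _ hx']
  · simp [hu.eq_zero x hx]

end SquareIntegrable

/-! ### Compactness of the energy space in `L²` -/

section Compactness

open scoped RealInnerProductSpace

/-- A bounded sequence in a separable real Hilbert space has a weakly convergent subsequence. -/
lemma exists_subseq_weak {H : Type*} [NormedAddCommGroup H] [InnerProductSpace ℝ H]
    [CompleteSpace H] [TopologicalSpace.SeparableSpace H] (f : ℕ → H) (R : ℝ)
    (hf : ∀ n, ‖f n‖ ≤ R) :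
    ∃ φ : ℕ → ℕ, StrictMono φ ∧ ∃ F : H, ∀ g : H,
      Tendsto (fun n => ⟪f (φ n), g⟫) atTop (𝓝 ⟪F, g⟫) := by
  have hc := WeakDual.isSeqCompact_closedBall ℝ H (0 : StrongDual ℝ H) R
  obtain ⟨a, -, φ, hφ, hlim⟩ := hc (x := fun n =>
    StrongDual.toWeakDual (InnerProductSpace.toDual ℝ H (f n))) (fun n => by
      rw [mem_preimage, mem_closedBall_zero_iff]
      change ‖InnerProductSpace.toDual ℝ H (f n)‖ ≤ R
      rw [LinearIsometryEquiv.norm_map]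
      exact hf n)
  refine ⟨φ, hφ, (InnerProductSpace.toDual ℝ H).symm (WeakDual.toStrongDual a), fun g => ?_⟩
  rw [InnerProductSpace.toDual_symm_apply]
  exact ((WeakDual.eval_continuous g).tendsto a).comp hlim

variable {N : ℕ} {Ω : Set (Eu N)}

lemma gagliardo_sub_le {k u w : Eu N → ℝ} (hk : Measurable k) (hk0 : ∀ z, 0 ≤ k z)
    (hu : MemForm Ω k u) (hw : MemForm Ω k w) :
    gagliardo k (fun x => u x - w x) (fun x => u x - w x)
      ≤ 2 * gagliardo k u u + 2 * gagliardo k w w := by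
  unfold gagliardo
  rw [← integral_const_mul, ← integral_const_mul,
    ← integral_add (hu.integrable.const_mul 2) (hw.integrable.const_mul 2)]
  refine integral_mono (hu.sub hk hk0 hw).integrable
    ((hu.integrable.const_mul 2).add (hw.integrable.const_mul 2)) fun p => ?_
  have := mul_nonneg (hk0 (p.1 - p.2)) (sq_nonneg ((u p.1 - u p.2) + (w p.1 - w p.2)))
  simp only
  nlinarith

/-- Convolution with the logarithmic kernel on the annulus `δ ≤ |z| ≤ 1`. -/
noncomputable def annulusConv (δ : ℝ) (u : Eu N → ℝ) (x : Eu N) : ℝ :=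
  ∫ y, kAnnulus δ (x - y) * u y

lemma memLp_kAnnulus {δ : ℝ} (hδ : 0 < δ) (x : Eu N) :
    MemLp (fun y : Eu N => kAnnulus δ (x - y)) 2 volume := by
  have h : MemLp (kAnnulus δ : Eu N → ℝ) 2 volume := by
    rw [memLp_two_iff_integrable_sq (measurable_kAnnulus δ).aestronglyMeasurable]
    refine ((integrable_kAnnulus hδ).const_mul (δ ^ N)⁻¹).mono'
      ((measurable_kAnnulus δ).pow_const 2).aestronglyMeasurable (ae_of_all _ fun z => ?_)
    rw [Real.norm_eq_abs, abs_of_nonneg (sq_nonneg _), sq]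
    exact mul_le_mul_of_nonneg_right (kAnnulus_le hδ z) (kAnnulus_nonneg δ z)
  exact h.comp_measurePreserving (Measure.measurePreserving_sub_left volume x)

lemma norm_toLp_sq {u : Eu N → ℝ} (hu : MemLp u 2 volume) : ‖hu.toLp‖ ^ 2 = ∫ x, u x * u x := by
  rw [← real_inner_self_eq_norm_sq, L2.inner_def]
  refine integral_congr_ae ?_
  filter_upwards [hu.coeFn_toLp] with x hx
  simp [hx, sq]

lemma annulusConv_eq_inner {δ : ℝ} (hδ : 0 < δ) {u : Eu N → ℝ} (hu : MemLp u 2 volume)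
    (x : Eu N) : annulusConv δ u x = ⟪hu.toLp, (memLp_kAnnulus hδ x).toLp⟫ := by
  rw [L2.inner_def]
  refine integral_congr_ae ?_
  filter_upwards [hu.coeFn_toLp, (memLp_kAnnulus hδ x).coeFn_toLp] with y h1 h2
  simp [h1, h2]

lemma aestronglyMeasurable_annulusConv {δ : ℝ} {u : Eu N → ℝ} (hu : MemLp u 2 volume) :
    AEStronglyMeasurable (annulusConv δ u) volume :=
  AEStronglyMeasurable.integral_prod_right'
    (f := fun p : Eu N × Eu N => kAnnulus δ (p.1 - p.2) * u p.2)
    ((aestronglyMeasurable_kernel (measurable_kAnnulus δ)).mul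
      (aestronglyMeasurable_snd hu.aemeasurable))

lemma exists_abs_annulusConv_le {δ : ℝ} (hδ : 0 < δ) :
    ∃ K : ℝ, 0 ≤ K ∧ ∀ (u : Eu N → ℝ) (hu : MemLp u 2 volume) (x : Eu N),
      |annulusConv δ u x| ≤ ‖hu.toLp‖ * K := by
  refine ⟨‖(memLp_kAnnulus hδ (0 : Eu N)).toLp‖, norm_nonneg _, fun u hu x => ?_⟩
  rw [annulusConv_eq_inner hδ hu]
  refine (abs_real_inner_le_norm _ _).trans_eq ?_
  congr 1
  have h1 := norm_toLp_sq (memLp_kAnnulus hδ (0 : Eu N))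
  have h2 := norm_toLp_sq (memLp_kAnnulus hδ x)
  have h3 : ∀ x : Eu N, ∫ y, kAnnulus δ (x - y) * kAnnulus δ (x - y)
      = ∫ y : Eu N, kAnnulus δ y * kAnnulus δ y := fun x =>
    integral_sub_left_eq_self (fun y : Eu N => kAnnulus δ y * kAnnulus δ y) volume x
  rw [h3] at h1 h2
  exact (pow_left_inj₀ (norm_nonneg _) (norm_nonneg _) two_ne_zero).1 (h2.trans h1.symm)

lemma isFiniteMeasure_restrict_closure (hΩ : Bornology.IsBounded Ω) :
    IsFiniteMeasure (volume.restrict (closure Ω)) :=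
  ⟨by rw [Measure.restrict_apply_univ]; exact hΩ.closure.measure_lt_top⟩

lemma memLp_annulusConv (hΩ : Bornology.IsBounded Ω) {δ : ℝ} (hδ : 0 < δ) {u : Eu N → ℝ}
    (hu : MemLp u 2 volume) : MemLp (annulusConv δ u) 2 (volume.restrict (closure Ω)) := by
  have := isFiniteMeasure_restrict_closure hΩ
  obtain ⟨K, -, hK⟩ := exists_abs_annulusConv_le (N := N) hδ
  exact MemLp.of_bound (aestronglyMeasurable_annulusConv hu).restrict _
    (ae_of_all _ fun x => hK u hu x)

/-- Convolution with the bounded kernel `kAnnulus δ` turns weak convergence into strong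
convergence on bounded sets. -/
lemma tendsto_integral_annulusConv_sub_sq (hΩ : Bornology.IsBounded Ω) {δ : ℝ} (hδ : 0 < δ)
    (u : ℕ → Eu N → ℝ) (hu : ∀ n, MemLp (u n) 2 volume) (A : ℝ) (hA : ∀ n, ‖(hu n).toLp‖ ≤ A)
    (F : Lp ℝ 2 (volume : Measure (Eu N)))
    (hF : ∀ g, Tendsto (fun n => ⟪(hu n).toLp, g⟫) atTop (𝓝 ⟪F, g⟫)) :
    Tendsto (fun n => ∫ x in closure Ω, (annulusConv δ (u n) x - annulusConv δ F x) ^ 2)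
      atTop (𝓝 0) := by
  have := isFiniteMeasure_restrict_closure hΩ
  obtain ⟨K, hK0, hK⟩ := exists_abs_annulusConv_le (N := N) hδ
  have hFm := Lp.memLp F
  have hFF : hFm.toLp = F := Lp.toLp_coeFn F hFm
  have h0 : ∫ x in closure Ω, (0 : ℝ) = 0 := by simp
  rw [← h0]
  refine tendsto_integral_of_dominated_convergence (fun _ => (A * K + ‖F‖ * K) ^ 2) (fun n => ?_)
    (integrable_const _) (fun n => ae_of_all _ fun x => ?_) (ae_of_all _ fun x => ?_)
  · exact (((aestronglyMeasurable_annulusConv (hu n)).sub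
      (aestronglyMeasurable_annulusConv hFm)).pow 2).restrict
  · rw [Real.norm_eq_abs, abs_of_nonneg (sq_nonneg _), ← sq_abs]
    refine pow_le_pow_left₀ (abs_nonneg _) ((abs_sub _ _).trans (add_le_add ?_ ?_)) 2
    · exact (hK _ (hu n) x).trans (mul_le_mul_of_nonneg_right (hA n) hK0)
    · have := hK _ hFm x
      rwa [hFF] at this
  · have h1 : Tendsto (fun n => annulusConv δ (u n) x) atTop (𝓝 (annulusConv δ F x)) := by
      simp only [annulusConv_eq_inner hδ (hu _), annulusConv_eq_inner hδ hFm, hFF]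
      exact hF _
    simpa using (h1.sub_const (annulusConv δ F x)).pow 2

/-- The `L²` norm is controlled by the logarithmic energy, with a small factor, and the
convolution with a bounded kernel. -/
lemma mass_mul_integral_sq_le (hΩ : Bornology.IsBounded Ω) {δ : ℝ} (hδ : 0 < δ) {d : Eu N → ℝ}
    (hd : MemLp d 2 volume) (hdE : MemForm Ω (kNear 0) d)
    {m : ℝ} (hm : m = ∫ z : Eu N, kAnnulus δ z) (hm1 : 1 ≤ m) :
    m * ∫ x, d x * d x ≤ gagliardo (kNear 0) d d
      + ∫ x in closure Ω, annulusConv δ d x ^ 2 := by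
  have hk := integrable_kAnnulus (N := N) hδ
  have hkm := measurable_kAnnulus (N := N) δ
  have e1 := gagliardo_eq_of_integrable hk hkm (kAnnulus_neg δ) hd hd
  have hE : gagliardo (kAnnulus δ) d d ≤ gagliardo (kNear 0) d d := by
    have := gagliardo_mono (k := kNear 0) (k' := kAnnulus δ) (c := 1) hdE
      ⟨hdE.aemeasurable, hdE.eq_zero, integrable_gagliardo_of_memLp hk hkm (kAnnulus_neg δ) hd hd⟩
      fun z => by rw [one_mul]; exact kAnnulus_le_kNear δ z
    rwa [one_mul] at this
  have hdd := integrable_mul_of_memLp hd hd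
  have hI : interaction (kAnnulus δ) d d = ∫ x in closure Ω, d x * annulusConv δ d x := by
    unfold interaction
    rw [Measure.volume_eq_prod, integral_prod _
      (integrable_interaction_of_memLp hk hkm (kAnnulus_neg δ) hd hd),
      ← setIntegral_eq_integral_of_forall_compl_eq_zero (s := closure Ω)]
    · congr 1 with x
      unfold annulusConv
      rw [← integral_const_mul]
      congr 1 with y
      ring
    · intro x hx
      simp [hdE.eq_zero x fun h => hx (subset_closure h)]
  have hc := memLp_annulusConv hΩ hδ hd
  have hI2 : 2 * interaction (kAnnulus δ) d d
      ≤ m * (∫ x, d x * d x) + m⁻¹ * ∫ x in closure Ω, annulusConv δ d x ^ 2 := by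
    rw [hI, ← setIntegral_eq_integral_of_forall_compl_eq_zero (f := fun x => d x * d x)
      (s := closure Ω) (fun x hx => by simp [hdE.eq_zero x fun h => hx (subset_closure h)]),
      ← integral_const_mul, ← integral_const_mul, ← integral_const_mul,
      ← integral_add (hdd.restrict.const_mul m) (hc.integrable_sq.const_mul _)]
    refine integral_mono (((hd.restrict _).integrable_mul hc).const_mul 2)
      ((hdd.restrict.const_mul m).add (hc.integrable_sq.const_mul _)) fun x => ?_
    have hm0 : 0 < m := by linarith
    have := mul_nonneg (inv_nonneg.2 hm0.le) (sq_nonneg (m * d x - annulusConv δ d x))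
    have e : m⁻¹ * (m * d x - annulusConv δ d x) ^ 2
        = m * (d x * d x) + m⁻¹ * annulusConv δ d x ^ 2 - 2 * (d x * annulusConv δ d x) := by
      field_simp
      ring
    simp only
    linarith
  have hpos : 0 ≤ ∫ x in closure Ω, annulusConv δ d x ^ 2 := integral_nonneg fun x => sq_nonneg _
  have : m⁻¹ * ∫ x in closure Ω, annulusConv δ d x ^ 2
      ≤ ∫ x in closure Ω, annulusConv δ d x ^ 2 :=
    mul_le_of_le_one_left hpos (inv_le_one_of_one_le₀ hm1)
  rw [← hm] at e1
  linarith

/-- **Compactness.** A sequence bounded in `L²` and in the logarithmic energy has a subsequence that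
converges in `L²` and almost everywhere. -/
theorem exists_subseq_tendsto (hN : 1 ≤ N) (hΩ : Bornology.IsBounded Ω) (hΩm : MeasurableSet Ω)
    (u : ℕ → Eu N → ℝ) (hu : ∀ n, MemForm Ω (kNear 0) (u n)) (A : ℝ)
    (hA : ∀ n, ∫ x, u n x * u n x ≤ A) (hE : ∀ n, gagliardo (kNear 0) (u n) (u n) ≤ A) :
    ∃ φ : ℕ → ℕ, StrictMono φ ∧ ∃ v : Eu N → ℝ, MemLp v 2 volume ∧ (∀ x ∉ Ω, v x = 0) ∧
      Tendsto (fun n => ∫ x, (u (φ n) x - v x) * (u (φ n) x - v x)) atTop (𝓝 0) ∧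
      ∀ᵐ x, Tendsto (fun n => u (φ n) x) atTop (𝓝 (v x)) := by
  have hmem : ∀ n, MemLp (u n) 2 volume := fun n => (hu n).memLp hN hΩ
  have : Fact ((2 : ENNReal) ≠ ⊤) := ⟨ENNReal.ofNat_ne_top⟩
  obtain ⟨φ, hφ, F, hF⟩ := exists_subseq_weak (fun n => (hmem n).toLp) (√A) fun n => by
    apply Real.le_sqrt_of_sq_le
    rw [norm_toLp_sq]
    exact hA n
  have hsq : ∀ m n, ‖(hmem (φ n)).toLp - (hmem (φ m)).toLp‖ ^ 2
      = ∫ x, (u (φ n) x - u (φ m) x) * (u (φ n) x - u (φ m) x) := fun m n => by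
    rw [← MemLp.toLp_sub, norm_toLp_sq]
    rfl
  have hcauchy : CauchySeq fun n => (hmem (φ n)).toLp := by
    rw [Metric.cauchySeq_iff]
    intro ε hε
    -- a kernel of large mass makes the energy contribution small
    obtain ⟨δ, hδ, hM⟩ := exists_le_integral_kAnnulus hN (max 1 (16 * A / ε ^ 2))
    set M := ∫ z : Eu N, kAnnulus δ z with hMdef
    have hM1 : 1 ≤ M := (le_max_left _ _).trans hM
    have hM2 : 16 * A / ε ^ 2 ≤ M := (le_max_right _ _).trans hM
    have hlim := tendsto_integral_annulusConv_sub_sq hΩ hδ (fun n => u (φ n))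
      (fun n => hmem (φ n)) (√A) (fun n => by
        apply Real.le_sqrt_of_sq_le
        rw [norm_toLp_sq]
        exact hA _) F hF
    obtain ⟨n₀, hn₀⟩ := eventually_atTop.1 (hlim.eventually (gt_mem_nhds
      (show (0 : ℝ) < ε ^ 2 / 8 by positivity)))
    refine ⟨n₀, fun m hm n hn => ?_⟩
    rw [dist_eq_norm]
    refine lt_of_pow_lt_pow_left₀ 2 hε.le ?_
    rw [hsq]
    have hd := (hmem (φ m)).sub (hmem (φ n))
    have hdE := (hu (φ m)).sub (measurable_kNear 0) (kNear_nonneg 0) (hu (φ n))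
    have h1 := mass_mul_integral_sq_le hΩ hδ hd hdE hMdef hM1
    have h2 := gagliardo_sub_le (measurable_kNear 0) (kNear_nonneg 0) (hu (φ m)) (hu (φ n))
    have h3 : ∫ x in closure Ω, annulusConv δ (u (φ m) - u (φ n)) x ^ 2
        ≤ 2 * (∫ x in closure Ω, (annulusConv δ (u (φ m)) x - annulusConv δ F x) ^ 2)
          + 2 * ∫ x in closure Ω, (annulusConv δ (u (φ n)) x - annulusConv δ F x) ^ 2 := by
      have hFm := memLp_annulusConv hΩ hδ (Lp.memLp F)
      have i1 := ((memLp_annulusConv hΩ hδ (hmem (φ m))).sub hFm).integrable_sq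
      have i2 := ((memLp_annulusConv hΩ hδ (hmem (φ n))).sub hFm).integrable_sq
      simp only [Pi.sub_apply] at i1 i2
      rw [← integral_const_mul, ← integral_const_mul,
        ← integral_add (i1.const_mul 2) (i2.const_mul 2)]
      refine integral_mono (memLp_annulusConv hΩ hδ hd).integrable_sq
        ((i1.const_mul 2).add (i2.const_mul 2)) fun x => ?_
      have : annulusConv δ (u (φ m) - u (φ n)) x
          = annulusConv δ (u (φ m)) x - annulusConv δ (u (φ n)) x := by
        unfold annulusConv
        rw [← integral_sub (integrable_mul_of_memLp (memLp_kAnnulus hδ x) (hmem (φ m)))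
          (integrable_mul_of_memLp (memLp_kAnnulus hδ x) (hmem (φ n)))]
        congr 1 with y
        simp only [Pi.sub_apply]
        ring
      simp only [this]
      nlinarith [sq_nonneg (annulusConv δ (u (φ m)) x - annulusConv δ F x
        + (annulusConv δ (u (φ n)) x - annulusConv δ F x))]
    have h4 := hn₀ m hm
    have h5 := hn₀ n hn
    have h6 := hE (φ m)
    have h7 := hE (φ n)
    simp only [Pi.sub_apply] at h1
    set S := ∫ x, (u (φ m) x - u (φ n) x) * (u (φ m) x - u (φ n) x)
    have h8 : M * S < 4 * A + ε ^ 2 / 2 := by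
      have e : gagliardo (kNear 0) (u (φ m) - u (φ n)) (u (φ m) - u (φ n))
        = gagliardo (kNear 0) (fun x => u (φ m) x - u (φ n) x) fun x => u (φ m) x - u (φ n) x := rfl
      rw [e] at h1
      linarith
    have h9 : 16 * A ≤ M * ε ^ 2 := (div_le_iff₀ (by positivity)).1 hM2
    have h10 : 0 < ε ^ 2 := by positivity
    by_contra hcon
    rw [not_lt] at hcon
    nlinarith
  obtain ⟨f, hf⟩ := cauchySeq_tendsto_of_complete hcauchy
  set v : Eu N → ℝ := Ω.indicator f with hv
  have hvm : MemLp v 2 volume := (Lp.memLp f).indicator hΩm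
  have hle : ∀ n, ∫ x, (u (φ n) x - v x) * (u (φ n) x - v x) ≤ ‖(hmem (φ n)).toLp - f‖ ^ 2 := by
    intro n
    have : ‖(hmem (φ n)).toLp - f‖ ^ 2 = ∫ x, (u (φ n) x - f x) * (u (φ n) x - f x) := by
      rw [← Lp.toLp_coeFn f (Lp.memLp f), ← MemLp.toLp_sub, norm_toLp_sq]
      rw [Lp.toLp_coeFn f (Lp.memLp f)]
      rfl
    rw [this]
    have h1 := (hmem (φ n)).sub hvm
    have h2 := (hmem (φ n)).sub (Lp.memLp f)
    refine integral_mono (integrable_mul_of_memLp h1 h1) (integrable_mul_of_memLp h2 h2)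
      fun x => ?_
    by_cases hx : x ∈ Ω
    · simp [hv, hx]
    · simp only [hv, indicator_of_notMem hx, (hu (φ n)).eq_zero x hx, sub_zero, mul_zero]
      exact mul_self_nonneg _
  have hzero : Tendsto (fun n => ‖(hmem (φ n)).toLp - f‖ ^ 2) atTop (𝓝 0) := by
    simpa using (tendsto_iff_norm_sub_tendsto_zero.1 hf).pow 2
  have hL2 := squeeze_zero (fun n => integral_nonneg fun x => mul_self_nonneg _) hle hzero
  have hmeas := tendstoInMeasure_of_tendsto_Lp hf
  obtain ⟨ψ, hψ, hae⟩ := hmeas.exists_seq_tendsto_ae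
  refine ⟨φ ∘ ψ, hφ.comp hψ, v, hvm, fun x hx => indicator_of_notMem hx _,
    hL2.comp hψ.tendsto_atTop, ?_⟩
  have hcoe := ae_all_iff.2 fun n => (hmem (φ n)).coeFn_toLp
  filter_upwards [hae, hcoe] with x h1 h2
  by_cases hx : x ∈ Ω
  · simpa [hv, hx, h2] using h1
  · simp only [hv, indicator_of_notMem hx, Function.comp, (hu _).eq_zero x hx]
    exact tendsto_const_nhds

end Compactness

/-! ### Lower semicontinuity of the forms along bounded sequences -/

/-- Pairs of kernels to which the spectral theory applies: `k` is at least as singular as the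
logarithmic kernel (with constant `c`), and `j` is nonnegative, even, bounded by `C`, and positive
at distance at least one, where `k` may vanish. -/
structure Admissible {N : ℕ} (c C : ℝ) (k j : Eu N → ℝ) : Prop where
  pos : 0 < c
  measurable_k : Measurable k
  le_k : ∀ z, c * kNear 0 z ≤ k z
  measurable_j : Measurable j
  j_nonneg : ∀ z, 0 ≤ j z
  j_le : ∀ z, j z ≤ C
  j_neg : ∀ z, j (-z) = j z
  j_pos : ∀ z, 1 ≤ ‖z‖ → 0 < j z

section LowerSemicontinuity

variable {N : ℕ} {Ω : Set (Eu N)} {c C : ℝ} {k j : Eu N → ℝ} {b : ℝ} {u v w : Eu N → ℝ}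

lemma Admissible.k_nonneg (h : Admissible c C k j) (z : Eu N) : 0 ≤ k z :=
  (mul_nonneg h.pos.le (kNear_nonneg 0 z)).trans (h.le_k z)

lemma Admissible.abs_j_le (h : Admissible c C k j) (z : Eu N) : |j z| ≤ C := by
  rw [abs_of_nonneg (h.j_nonneg z)]
  exact h.j_le z

lemma Admissible.memForm_kNear (h : Admissible c C k j) (hu : MemForm Ω k u) :
    MemForm Ω (kNear 0) u := hu.mono h.pos (measurable_kNear 0) (kNear_nonneg 0) h.le_k

lemma Admissible.memLp (h : Admissible c C k j) (hN : 1 ≤ N) (hΩ : Bornology.IsBounded Ω)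
    (hu : MemForm Ω k u) : MemLp u 2 volume := (h.memForm_kNear hu).memLp hN hΩ

lemma Admissible.integrable (h : Admissible c C k j) (hN : 1 ≤ N) (hΩ : Bornology.IsBounded Ω)
    (hu : MemForm Ω k u) : Integrable u :=
  integrable_of_memLp hΩ (h.memLp hN hΩ hu) hu.eq_zero

lemma Admissible.abs_interaction_self_le (h : Admissible c C k j) (hΩ : Bornology.IsBounded Ω)
    (hu : MemLp u 2 volume) (hu0 : ∀ x ∉ Ω, u x = 0) :
    |interaction j u u| ≤ C * (volume.real (closure Ω) * ∫ x, u x * u x) := by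
  have hi := integrable_of_memLp hΩ hu hu0
  refine (abs_interaction_le h.abs_j_le hi hi).trans ?_
  rw [← sq]
  exact mul_le_mul_of_nonneg_left (integral_abs_sq_le hΩ hu hu0)
    ((h.j_nonneg 0).trans (h.j_le 0))

/-- Fatou's lemma for real-valued nonnegative functions whose integrals are bounded by a convergent
sequence. -/
lemma integrable_and_integral_le_of_tendsto {α : Type*} [MeasurableSpace α] {μ : Measure α}
    {f : ℕ → α → ℝ} {g : α → ℝ} (hf : ∀ n, Integrable (f n) μ) (h0 : ∀ n x, 0 ≤ f n x)
    (hlim : ∀ᵐ x ∂μ, Tendsto (fun n => f n x) atTop (𝓝 (g x))) {a : ℕ → ℝ} {γ : ℝ}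
    (ha : Tendsto a atTop (𝓝 γ)) (hle : ∀ n, ∫ x, f n x ∂μ ≤ a n) :
    Integrable g μ ∧ ∫ x, g x ∂μ ≤ γ := by
  have hg : AEMeasurable g μ :=
    aemeasurable_of_tendsto_metrizable_ae atTop (fun n => (hf n).aemeasurable) hlim
  have hg0 : 0 ≤ᵐ[μ] g := hlim.mono fun x hx => ge_of_tendsto' hx fun n => h0 n x
  have hγ : 0 ≤ γ := ge_of_tendsto' ha fun n => (integral_nonneg (h0 n)).trans (hle n)
  have hmain : ∫⁻ x, ENNReal.ofReal (g x) ∂μ ≤ ENNReal.ofReal γ := by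
    calc ∫⁻ x, ENNReal.ofReal (g x) ∂μ
        = ∫⁻ x, liminf (fun n => ENNReal.ofReal (f n x)) atTop ∂μ := by
          refine lintegral_congr_ae ?_
          filter_upwards [hlim] with x hx
          exact ((ENNReal.continuous_ofReal.tendsto _).comp hx).liminf_eq.symm
      _ ≤ liminf (fun n => ∫⁻ x, ENNReal.ofReal (f n x) ∂μ) atTop :=
          lintegral_liminf_le' fun n => (hf n).aemeasurable.ennreal_ofReal
      _ ≤ liminf (fun n => ENNReal.ofReal (a n)) atTop := by
          refine liminf_le_liminf (Eventually.of_forall fun n => ?_)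
          rw [← ofReal_integral_eq_lintegral_ofReal (hf n) (ae_of_all _ (h0 n))]
          exact ENNReal.ofReal_le_ofReal (hle n)
      _ = ENNReal.ofReal γ := ((ENNReal.continuous_ofReal.tendsto _).comp ha).liminf_eq
  have hint : Integrable g μ := by
    refine ⟨hg.aestronglyMeasurable, ?_⟩
    rw [hasFiniteIntegral_iff_ofReal hg0]
    exact hmain.trans_lt ENNReal.ofReal_lt_top
  refine ⟨hint, ?_⟩
  rw [← ofReal_integral_eq_lintegral_ofReal hint hg0] at hmain
  exact (ENNReal.ofReal_le_ofReal_iff hγ).1 hmain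

lemma tendsto_integral_mul_self {u : ℕ → Eu N → ℝ} {v : Eu N → ℝ}
    (hu : ∀ n, MemLp (u n) 2 volume) (hv : MemLp v 2 volume)
    (h : Tendsto (fun n => ∫ x, (u n x - v x) * (u n x - v x)) atTop (𝓝 0)) :
    Tendsto (fun n => ∫ x, u n x * u n x) atTop (𝓝 (∫ x, v x * v x)) := by
  have h1 : Tendsto (fun n => ‖(hu n).toLp - hv.toLp‖) atTop (𝓝 0) := by
    have h2 := h.sqrt
    rw [Real.sqrt_zero] at h2
    refine h2.congr fun n => ?_
    rw [← MemLp.toLp_sub, eq_comm, ← Real.sqrt_sq (norm_nonneg _), norm_toLp_sq]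
    rfl
  have h3 := ((tendsto_iff_norm_sub_tendsto_zero.2 h1).norm).pow 2
  simpa only [norm_toLp_sq] using h3

lemma tendsto_integral_abs {u : ℕ → Eu N → ℝ} (hΩ : Bornology.IsBounded Ω)
    (hu : ∀ n, MemLp (u n) 2 volume) (hu0 : ∀ n, ∀ x ∉ Ω, u n x = 0)
    (h : Tendsto (fun n => ∫ x, u n x * u n x) atTop (𝓝 0)) :
    Tendsto (fun n => ∫ x, |u n x|) atTop (𝓝 0) := by
  have h1 := (h.const_mul (volume.real (closure Ω))).sqrt
  rw [mul_zero, Real.sqrt_zero] at h1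
  exact squeeze_zero (fun n => integral_nonneg fun x => abs_nonneg _)
    (fun n => Real.le_sqrt_of_sq_le (integral_abs_sq_le hΩ (hu n) (hu0 n))) h1

lemma tendsto_interaction_kernel {ι : Type*} {l : Filter ι} [l.IsCountablyGenerated]
    {C : ℝ} {j : ι → Eu N → ℝ} {j' : Eu N → ℝ}
    (hjm : ∀ n, Measurable (j n)) (hjC : ∀ᶠ n in l, ∀ z, |j n z| ≤ C)
    (hj : ∀ z, Tendsto (fun n => j n z) l (𝓝 (j' z))) (hu : Integrable u) (hv : Integrable v) :
    Tendsto (fun n => interaction (j n) u v) l (𝓝 (interaction j' u v)) := by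
  refine tendsto_integral_filter_of_dominated_convergence
    (fun p : Eu N × Eu N => C * ‖u p.1 * v p.2‖) (Eventually.of_forall fun n =>
      aestronglyMeasurable_interaction (hjm n) hu.aemeasurable hv.aemeasurable)
    (hjC.mono fun n hn => ae_of_all _ fun p => ?_) ((hu.mul_prod hv).norm.const_mul C)
    (ae_of_all _ fun p => (hj _).mul_const _)
  rw [norm_mul]
  exact mul_le_mul_of_nonneg_right (hn _) (norm_nonneg _)

/-- Continuity of the interaction under `L²` convergence and bounded pointwise convergence of the
kernels. -/
lemma tendsto_interaction {C : ℝ} {j : ℕ → Eu N → ℝ} {j' : Eu N → ℝ} {u : ℕ → Eu N → ℝ}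
    (hΩ : Bornology.IsBounded Ω) (hjm : ∀ n, Measurable (j n)) (hjC : ∀ n z, |j n z| ≤ C)
    (hjn : ∀ n z, j n (-z) = j n z)
    (hj : ∀ z, Tendsto (fun n => j n z) atTop (𝓝 (j' z)))
    (hu : ∀ n, MemLp (u n) 2 volume) (hu0 : ∀ n, ∀ x ∉ Ω, u n x = 0)
    (hv : MemLp v 2 volume) (hv0 : ∀ x ∉ Ω, v x = 0)
    (h : Tendsto (fun n => ∫ x, (u n x - v x) * (u n x - v x)) atTop (𝓝 0)) :
    Tendsto (fun n => interaction (j n) (u n) (u n)) atTop (𝓝 (interaction j' v v)) := by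
  have hui := fun n => integrable_of_memLp hΩ (hu n) (hu0 n)
  have hvi := integrable_of_memLp hΩ hv hv0
  have hd : Tendsto (fun n => ∫ x, |u n x - v x|) atTop (𝓝 0) :=
    tendsto_integral_abs (u := fun n x => u n x - v x) hΩ (fun n => (hu n).sub hv)
      (fun n x hx => by simp [hu0 n x hx, hv0 x hx]) h
  have h1 := tendsto_interaction_kernel hjm (Eventually.of_forall hjC) hj hvi hvi
  suffices h2 : Tendsto (fun n => interaction (j n) (u n) (u n) - interaction (j n) v v)
      atTop (𝓝 0) by
    simpa using h2.add h1
  have hbound : ∀ n, |interaction (j n) (u n) (u n) - interaction (j n) v v|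
      ≤ C * ((∫ x, |u n x - v x|) * ((∫ x, |u n x - v x|) + 2 * ∫ x, |v x|)) := by
    intro n
    have hdi : Integrable (fun x => u n x - v x) := (hui n).sub hvi
    have e : ∀ w, Integrable w → interaction (j n) (u n) w
        = interaction (j n) (fun x => u n x - v x) w + interaction (j n) v w := by
      intro w hw
      rw [← interaction_add_left (hjm n) (hjC n) hdi hvi hw]
      simp
    have e2 : interaction (j n) (u n) (u n) - interaction (j n) v v
        = interaction (j n) (fun x => u n x - v x) (fun x => u n x - v x)
          + 2 * interaction (j n) (fun x => u n x - v x) v := by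
      have e3 := e (u n) (hui n)
      have e4 := interaction_comm (hjn n) (fun x => u n x - v x) (u n)
      have e5 := interaction_comm (hjn n) v (u n)
      have e6 := interaction_comm (hjn n) v (fun x => u n x - v x)
      have e7 := e _ hdi
      have e8 := e _ hvi
      linarith
    rw [e2]
    have b1 := abs_interaction_le (hjC n) hdi hdi
    have b2 := abs_interaction_le (hjC n) hdi hvi
    refine (abs_add_le _ _).trans ?_
    rw [abs_mul, abs_two]
    linarith
  have h3 : Tendsto (fun n => C * ((∫ x, |u n x - v x|) *
      ((∫ x, |u n x - v x|) + 2 * ∫ x, |v x|))) atTop (𝓝 0) := by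
    simpa using (hd.mul (hd.add_const (2 * ∫ x, |v x|))).const_mul C
  exact squeeze_zero_norm hbound h3

/-- **Compactness and lower semicontinuity.** Normalized functions whose forms are bounded above by
a convergent sequence subconverge in `L²`, and the limit form at the limit function is at most the
limit of the bounds. The kernels may vary with the index. -/
theorem exists_subseq_kernelForm_le (hN : 1 ≤ N) (hΩ : Bornology.IsBounded Ω)
    (hΩm : MeasurableSet Ω) {k j : ℕ → Eu N → ℝ} {b : ℕ → ℝ} {k' j' : Eu N → ℝ} {b' : ℝ}
    (hadm : ∀ n, Admissible c C (k n) (j n))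
    (hk : ∀ z, Tendsto (fun n => k n z) atTop (𝓝 (k' z)))
    (hj : ∀ z, Tendsto (fun n => j n z) atTop (𝓝 (j' z))) (hb : Tendsto b atTop (𝓝 b'))
    {u : ℕ → Eu N → ℝ} (hu : ∀ n, MemForm Ω (k n) (u n)) (hnorm : ∀ n, ∫ x, u n x * u n x = 1)
    {m : ℕ → ℝ} {μ : ℝ} (hm : Tendsto m atTop (𝓝 μ))
    (hle : ∀ n, kernelForm (k n) (j n) (b n) (u n) (u n) ≤ m n) :
    ∃ φ : ℕ → ℕ, StrictMono φ ∧ ∃ v : Eu N → ℝ, MemForm Ω k' v ∧ ∫ x, v x * v x = 1 ∧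
      kernelForm k' j' b' v v ≤ μ ∧
      Tendsto (fun n => ∫ x, (u (φ n) x - v x) * (u (φ n) x - v x)) atTop (𝓝 0) ∧
      ∀ᵐ x, Tendsto (fun n => u (φ n) x) atTop (𝓝 (v x)) := by
  have hc := (hadm 0).pos
  have hmem : ∀ n, MemLp (u n) 2 volume := fun n => (hadm n).memLp hN hΩ (hu n)
  have hG : ∀ n, gagliardo (k n) (u n) (u n)
      ≤ m n + interaction (j n) (u n) (u n) - b n := by
    intro n
    have := hle n
    rw [kernelForm, hnorm n] at this
    linarith
  obtain ⟨M, hM⟩ := hm.bddAbove_range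
  obtain ⟨B, hB⟩ := hb.bddBelow_range
  have hE : ∀ n, gagliardo (kNear 0) (u n) (u n)
      ≤ max 1 (c⁻¹ * (M + C * volume.real (closure Ω) - B)) := by
    intro n
    refine le_max_of_le_right ?_
    rw [le_inv_mul_iff₀ hc]
    have h1 := gagliardo_mono (hu n) ((hadm n).memForm_kNear (hu n)) (hadm n).le_k
    have h2 := (le_abs_self _).trans
      ((hadm n).abs_interaction_self_le hΩ (hmem n) (hu n).eq_zero)
    rw [hnorm n, mul_one] at h2
    have h3 := hM (mem_range_self n)
    have h4 := hB (mem_range_self n)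
    have h5 := hG n
    linarith
  obtain ⟨φ, hφ, v, hv, hv0, hL2, hae⟩ := exists_subseq_tendsto hN hΩ hΩm u
    (fun n => (hadm n).memForm_kNear (hu n)) _ (fun n => (hnorm n).le.trans (le_max_left _ _)) hE
  have hI := tendsto_interaction (j := fun n => j (φ n)) (u := fun n => u (φ n)) (j' := j') hΩ
    (fun n => (hadm _).measurable_j)
    (fun n => (hadm _).abs_j_le) (fun n => (hadm _).j_neg)
    (fun z => (hj z).comp hφ.tendsto_atTop) (fun n => hmem _) (fun n => (hu _).eq_zero) hv hv0 hL2
  have hnv : ∫ x, v x * v x = 1 := by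
    have := tendsto_integral_mul_self (fun n => hmem (φ n)) hv hL2
    simp only [hnorm] at this
    exact tendsto_nhds_unique this tendsto_const_nhds
  have hae1 : ∀ᵐ p : Eu N × Eu N, Tendsto (fun n => u (φ n) p.1) atTop (𝓝 (v p.1)) :=
    Measure.quasiMeasurePreserving_fst.ae hae
  have hae2 : ∀ᵐ p : Eu N × Eu N, Tendsto (fun n => u (φ n) p.2) atTop (𝓝 (v p.2)) :=
    Measure.quasiMeasurePreserving_snd.ae hae
  obtain ⟨hint, hfin⟩ := integrable_and_integral_le_of_tendsto
    (f := fun n (p : Eu N × Eu N) => k (φ n) (p.1 - p.2) *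
      ((u (φ n) p.1 - u (φ n) p.2) * (u (φ n) p.1 - u (φ n) p.2)))
    (g := fun p : Eu N × Eu N => k' (p.1 - p.2) * ((v p.1 - v p.2) * (v p.1 - v p.2)))
    (fun n => (hu (φ n)).integrable)
    (fun n p => mul_nonneg ((hadm _).k_nonneg _) (mul_self_nonneg _))
    (by
      filter_upwards [hae1, hae2] with p h1 h2
      exact ((hk _).comp hφ.tendsto_atTop).mul ((h1.sub h2).mul (h1.sub h2)))
    (((hm.comp hφ.tendsto_atTop).add hI).sub (hb.comp hφ.tendsto_atTop))
    (fun n => hG (φ n))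
  refine ⟨φ, hφ, v, ⟨hv.aemeasurable, hv0, hint⟩, hnv, ?_, hL2, hae⟩
  rw [kernelForm, hnv]
  change gagliardo k' v v ≤ _ at hfin
  linarith

end LowerSemicontinuity

/-! ### The first eigenvalue and eigenfunction of an admissible form -/

/-- Weak eigenfunctions of the form with kernels `k`, `j` and zero-order coefficient `b`. -/
def IsWeakEigen {N : ℕ} (Ω : Set (Eu N)) (k j : Eu N → ℝ) (b lam : ℝ) (u : Eu N → ℝ) : Prop :=
  MemForm Ω k u ∧ ∀ φ, MemForm Ω k φ → kernelForm k j b u φ = lam * ∫ x, u x * φ x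

/-- `lam` is a lower bound for the Rayleigh quotient. -/
def IsRayleighBound {N : ℕ} (Ω : Set (Eu N)) (k j : Eu N → ℝ) (b lam : ℝ) : Prop :=
  ∀ w, MemForm Ω k w → lam * ∫ x, w x * w x ≤ kernelForm k j b w w

section Eigen

variable {N : ℕ} {Ω : Set (Eu N)} {c C : ℝ} {k j : Eu N → ℝ} {b lam : ℝ} {u v w : Eu N → ℝ}

lemma kernelForm_add_left (h : Admissible c C k j) (hN : 1 ≤ N) (hΩ : Bornology.IsBounded Ω)
    (hu : MemForm Ω k u) (hv : MemForm Ω k v) (hw : MemForm Ω k w) :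
    kernelForm k j b (fun x => u x + v x) w = kernelForm k j b u w + kernelForm k j b v w := by
  have hum := h.memLp hN hΩ hu
  have hvm := h.memLp hN hΩ hv
  have hwm := h.memLp hN hΩ hw
  have e : ∫ x, (u x + v x) * w x = (∫ x, u x * w x) + ∫ x, v x * w x := by
    rw [← integral_add (integrable_mul_of_memLp hum hwm) (integrable_mul_of_memLp hvm hwm)]
    congr 1 with x
    ring
  rw [kernelForm, gagliardo_add_left h.measurable_k h.k_nonneg hu hv hw,
    interaction_add_left h.measurable_j h.abs_j_le (h.integrable hN hΩ hu)
      (h.integrable hN hΩ hv) (h.integrable hN hΩ hw), e, kernelForm, kernelForm]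
  ring

lemma kernelForm_const_mul_left (k j : Eu N → ℝ) (b : ℝ) (u w : Eu N → ℝ) (t : ℝ) :
    kernelForm k j b (fun x => t * u x) w = t * kernelForm k j b u w := by
  have e : ∫ x, t * u x * w x = t * ∫ x, u x * w x := by
    rw [← integral_const_mul]
    congr 1 with x
    ring
  rw [kernelForm, gagliardo_const_mul_left, interaction_const_mul_left, e, kernelForm]
  ring

lemma kernelForm_comm (h : Admissible c C k j) (b : ℝ) (u w : Eu N → ℝ) :
    kernelForm k j b u w = kernelForm k j b w u := by
  simp only [kernelForm, gagliardo_comm k u w, interaction_comm h.j_neg u w, mul_comm (u _)]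

lemma kernelForm_add_const_mul (h : Admissible c C k j) (hN : 1 ≤ N)
    (hΩ : Bornology.IsBounded Ω) (hu : MemForm Ω k u) (hw : MemForm Ω k w) (t : ℝ) :
    kernelForm k j b (fun x => u x + t * w x) (fun x => u x + t * w x)
      = kernelForm k j b u u + 2 * t * kernelForm k j b u w + t ^ 2 * kernelForm k j b w w := by
  have htw := hw.const_mul t
  have hs := hu.add h.measurable_k h.k_nonneg htw
  rw [kernelForm_add_left h hN hΩ hu htw hs, kernelForm_const_mul_left,
    kernelForm_comm h b u, kernelForm_comm h b w, kernelForm_add_left h hN hΩ hu htw hu,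
    kernelForm_add_left h hN hΩ hu htw hw, kernelForm_const_mul_left, kernelForm_const_mul_left,
    kernelForm_comm h b w u]
  ring

lemma integral_add_const_mul_sq (hu : MemLp u 2 volume) (hw : MemLp w 2 volume) (t : ℝ) :
    ∫ x, (u x + t * w x) * (u x + t * w x)
      = (∫ x, u x * u x) + 2 * t * (∫ x, u x * w x) + t ^ 2 * ∫ x, w x * w x := by
  have h1 := integrable_mul_of_memLp hu hu
  have h2 := (integrable_mul_of_memLp hu hw).const_mul (2 * t)
  have h3 := (integrable_mul_of_memLp hw hw).const_mul (t ^ 2)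
  have h12 : Integrable fun x => u x * u x + 2 * t * (u x * w x) := h1.add h2
  rw [← integral_const_mul, ← integral_const_mul, ← integral_add h1 h2, ← integral_add h12 h3]
  congr 1 with x
  ring

/-- First variation: a function attaining the lower bound of the Rayleigh quotient is a weak
eigenfunction. -/
lemma IsRayleighBound.isWeakEigen (hb : IsRayleighBound Ω k j b lam) (h : Admissible c C k j)
    (hN : 1 ≤ N) (hΩ : Bornology.IsBounded Ω) (hu : MemForm Ω k u)
    (he : kernelForm k j b u u = lam * ∫ x, u x * u x) : IsWeakEigen Ω k j b lam u := by
  refine ⟨hu, fun φ hφ => ?_⟩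
  have key : ∀ t : ℝ, 0 ≤ (kernelForm k j b φ φ - lam * ∫ x, φ x * φ x) * (t * t)
      + (2 * (kernelForm k j b u φ - lam * ∫ x, u x * φ x)) * t + 0 := by
    intro t
    have h1 := hb _ (hu.add h.measurable_k h.k_nonneg (hφ.const_mul t))
    rw [kernelForm_add_const_mul h hN hΩ hu hφ,
      integral_add_const_mul_sq (h.memLp hN hΩ hu) (h.memLp hN hΩ hφ), he] at h1
    linarith
  have h2 := discrim_le_zero key
  rw [discrim, mul_zero, sub_zero] at h2
  have h3 := pow_eq_zero_iff two_ne_zero |>.1 (le_antisymm h2 (sq_nonneg _))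
  linarith

lemma IsWeakEigen.sub (hu : IsWeakEigen Ω k j b lam u) (hw : IsWeakEigen Ω k j b lam w)
    (h : Admissible c C k j) (hN : 1 ≤ N) (hΩ : Bornology.IsBounded Ω) :
    IsWeakEigen Ω k j b lam (fun x => u x - w x) := by
  have hw' := hw.1.const_mul (-1)
  have e : (fun x => u x - w x) = fun x => u x + -1 * w x := by
    ext x
    ring
  refine ⟨hu.1.sub h.measurable_k h.k_nonneg hw.1, fun φ hφ => ?_⟩
  have hφm := h.memLp hN hΩ hφ
  have e2 : ∫ x, (u x - w x) * φ x = (∫ x, u x * φ x) - ∫ x, w x * φ x := by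
    rw [← integral_sub (integrable_mul_of_memLp (h.memLp hN hΩ hu.1) hφm)
      (integrable_mul_of_memLp (h.memLp hN hΩ hw.1) hφm)]
    congr 1 with x
    ring
  rw [e2, e, kernelForm_add_left h hN hΩ hu.1 hw' hφ, kernelForm_const_mul_left, hu.2 φ hφ,
    hw.2 φ hφ]
  ring

lemma integral_mul_self_pos (hu : MemLp u 2 volume) (hne : ¬ u =ᵐ[volume] 0) :
    0 < ∫ x, u x * u x := by
  refine (integral_nonneg fun x => mul_self_nonneg _).lt_of_ne fun h => hne ?_
  have := (integral_eq_zero_iff_of_nonneg (fun x => mul_self_nonneg (u x))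
    (integrable_mul_of_memLp hu hu)).1 h.symm
  filter_upwards [this] with x hx
  simpa using hx

lemma IsRayleighBound.le_of_isWeakEigen (hb : IsRayleighBound Ω k j b lam)
    (h : Admissible c C k j) (hN : 1 ≤ N) (hΩ : Bornology.IsBounded Ω) {μ : ℝ}
    (hu : IsWeakEigen Ω k j b μ u) (hne : ¬ u =ᵐ[volume] 0) : lam ≤ μ := by
  have h1 := hb u hu.1
  rw [hu.2 u hu.1] at h1
  exact le_of_mul_le_mul_right h1 (integral_mul_self_pos (h.memLp hN hΩ hu.1) hne)

lemma neg_le_kernelForm (h : Admissible c C k j) (hN : 1 ≤ N) (hΩ : Bornology.IsBounded Ω)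
    (hu : MemForm Ω k u) (hnorm : ∫ x, u x * u x = 1) :
    -(C * volume.real (closure Ω)) + b ≤ kernelForm k j b u u := by
  have h1 := (le_abs_self _).trans (h.abs_interaction_self_le hΩ (h.memLp hN hΩ hu) hu.eq_zero)
  have h2 := gagliardo_nonneg h.k_nonneg u
  rw [kernelForm, hnorm]
  rw [hnorm] at h1
  linarith

/-- The direct method: the minimum of the Rayleigh quotient is attained. -/
theorem exists_minimizer (h : Admissible c C k j) (hN : 1 ≤ N) (hΩ : Bornology.IsBounded Ω)
    (hΩm : MeasurableSet Ω) (hne : ∃ w, MemForm Ω k w ∧ ¬ w =ᵐ[volume] 0) :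
    ∃ lam, IsRayleighBound Ω k j b lam ∧
      ∃ u, MemForm Ω k u ∧ ∫ x, u x * u x = 1 ∧ kernelForm k j b u u = lam := by
  set S := {q | ∃ w, MemForm Ω k w ∧ ∫ x, w x * w x = 1 ∧ kernelForm k j b w w = q} with hS
  have hscale : ∀ w, MemForm Ω k w → 0 < ∫ x, w x * w x →
      (∫ x, w x * w x)⁻¹ * kernelForm k j b w w ∈ S := by
    intro w hw hpos
    set A := ∫ x, w x * w x
    have hs : (√A)⁻¹ * (√A)⁻¹ = A⁻¹ := by
      rw [← mul_inv, Real.mul_self_sqrt hpos.le]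
    refine ⟨_, hw.const_mul (√A)⁻¹, ?_, ?_⟩
    · have : ∫ x, (√A)⁻¹ * w x * ((√A)⁻¹ * w x) = A⁻¹ * A := by
        rw [← integral_const_mul, ← hs]
        congr 1 with x
        ring
      rw [this, inv_mul_cancel₀ hpos.ne']
    · rw [kernelForm_const_mul_left, kernelForm_comm h, kernelForm_const_mul_left, ← mul_assoc, hs]
  have hSne : S.Nonempty := by
    obtain ⟨w, hw, hw0⟩ := hne
    exact ⟨_, hscale w hw (integral_mul_self_pos (h.memLp hN hΩ hw) hw0)⟩
  have hbdd : BddBelow S := by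
    refine ⟨-(C * volume.real (closure Ω)) + b, ?_⟩
    rintro q ⟨w, hw, hw1, rfl⟩
    exact neg_le_kernelForm h hN hΩ hw hw1
  obtain ⟨q, -, hq, hqS⟩ := exists_seq_tendsto_sInf hSne hbdd
  choose u hu hu1 huq using hqS
  obtain ⟨φ, -, v, hv, hv1, hvle, -⟩ := exists_subseq_kernelForm_le (Ω := Ω) hN hΩ hΩm
    (fun _ => h) (fun z => tendsto_const_nhds) (fun z => tendsto_const_nhds)
    (tendsto_const_nhds (x := b)) hu hu1 hq fun n => (huq n).le
  refine ⟨sInf S, fun w hw => ?_, v, hv, hv1, le_antisymm hvle (csInf_le hbdd ⟨v, hv, hv1, rfl⟩)⟩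
  by_cases hw0 : w =ᵐ[volume] 0
  · have e : ∫ x, w x * w x = 0 :=
      integral_eq_zero_of_ae (hw0.mono fun x hx => by simp [hx])
    have h1 := (h.abs_interaction_self_le hΩ (h.memLp hN hΩ hw) hw.eq_zero)
    rw [e, mul_zero, mul_zero] at h1
    have h2 := gagliardo_nonneg h.k_nonneg w
    rw [kernelForm, e, abs_nonpos_iff.1 h1]
    linarith
  · have hpos := integral_mul_self_pos (h.memLp hN hΩ hw) hw0
    have := csInf_le hbdd (hscale w hw hpos)
    rwa [le_inv_mul_iff₀ hpos, mul_comm] at this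

lemma kernelForm_abs_le (h : Admissible c C k j) (hN : 1 ≤ N) (hΩ : Bornology.IsBounded Ω)
    (hu : MemForm Ω k u) :
    kernelForm k j b (fun x => |u x|) (fun x => |u x|) ≤ kernelForm k j b u u := by
  have hi := h.integrable hN hΩ hu
  have h1 : gagliardo k (fun x => |u x|) (fun x => |u x|) ≤ gagliardo k u u := by
    refine integral_mono (hu.abs h.measurable_k h.k_nonneg).integrable hu.integrable fun p => ?_
    refine mul_le_mul_of_nonneg_left ?_ (h.k_nonneg _)
    rw [← abs_mul_abs_self (|u _| - _), ← abs_mul_abs_self (u _ - _)]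
    exact mul_self_le_mul_self (abs_nonneg _) (abs_abs_sub_abs_le _ _)
  have h2 : interaction j u u ≤ interaction j (fun x => |u x|) (fun x => |u x|) := by
    refine integral_mono (integrable_interaction h.measurable_j h.abs_j_le hi hi)
      (integrable_interaction h.measurable_j h.abs_j_le hi.abs hi.abs) fun p => ?_
    refine mul_le_mul_of_nonneg_left ?_ (h.j_nonneg _)
    rw [← abs_mul]
    exact le_abs_self _
  simp only [kernelForm, abs_mul_abs_self]
  linarith

/-- Taking absolute values lowers the form by a positive integral wherever `u(x) u(y) < 0`, so a
minimizer has a constant sign. -/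
theorem IsRayleighBound.nonneg_or_nonpos (hb : IsRayleighBound Ω k j b lam)
    (h : Admissible c C k j) (hN : 1 ≤ N) (hΩ : Bornology.IsBounded Ω) (hu : MemForm Ω k u)
    (he : kernelForm k j b u u = lam * ∫ x, u x * u x) :
    (∀ᵐ x, 0 ≤ u x) ∨ ∀ᵐ x, u x ≤ 0 := by
  have hi := h.integrable hN hΩ hu
  have habs := hu.abs h.measurable_k h.k_nonneg
  have hle := hb _ habs
  simp only [abs_mul_abs_self] at hle
  rw [← he] at hle
  set f : Eu N × Eu N → ℝ := fun p => k (p.1 - p.2) * ((u p.1 - u p.2) * (u p.1 - u p.2))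
    - k (p.1 - p.2) * ((|u p.1| - |u p.2|) * (|u p.1| - |u p.2|)) with hf
  set g : Eu N × Eu N → ℝ := fun p => j (p.1 - p.2) * (|u p.1| * |u p.2|)
    - j (p.1 - p.2) * (u p.1 * u p.2) with hg
  have hf' : ∀ p, f p = 2 * k (p.1 - p.2) * (|u p.1 * u p.2| - u p.1 * u p.2) := by
    intro p
    simp only [hf, abs_mul]
    linear_combination k (p.1 - p.2) * (-abs_mul_abs_self (u p.1) - abs_mul_abs_self (u p.2))
  have hg' : ∀ p, g p = j (p.1 - p.2) * (|u p.1 * u p.2| - u p.1 * u p.2) := by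
    intro p
    simp only [hg, abs_mul]
    ring
  have hfi : Integrable f := hu.integrable.sub habs.integrable
  have hji := integrable_interaction h.measurable_j h.abs_j_le hi hi
  have hji' := integrable_interaction h.measurable_j h.abs_j_le hi.abs hi.abs
  have hgi : Integrable g := hji'.sub hji
  have hf0 : ∀ p, 0 ≤ f p := fun p => by
    rw [hf']
    exact mul_nonneg (mul_nonneg zero_le_two (h.k_nonneg _)) (sub_nonneg.2 (le_abs_self _))
  have hg0 : ∀ p, 0 ≤ g p := fun p => by
    rw [hg']
    exact mul_nonneg (h.j_nonneg _) (sub_nonneg.2 (le_abs_self _))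
  have hfg : (∫ p, f p) + ∫ p, g p ≤ 0 := by
    rw [integral_sub hu.integrable habs.integrable, integral_sub hji' hji]
    simp only [kernelForm, abs_mul_abs_self, gagliardo, interaction] at hle
    linarith
  have hf1 := (integral_eq_zero_iff_of_nonneg hf0 hfi).1
    (le_antisymm (by linarith [integral_nonneg (μ := volume) (f := g) hg0]) (integral_nonneg hf0))
  have hg1 := (integral_eq_zero_iff_of_nonneg hg0 hgi).1
    (le_antisymm (by linarith [integral_nonneg (μ := volume) (f := f) hf0]) (integral_nonneg hg0))
  have hdiag : ∀ᵐ p : Eu N × Eu N, p.1 - p.2 ≠ 0 := by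
    have := nontrivial_eu hN
    have h0 : ∀ᵐ z : Eu N, z ≠ 0 := by
      rw [ae_iff]
      simp
    exact (quasiMeasurePreserving_sub_of_right_invariant volume volume).ae h0
  have hprod : ∀ᵐ p : Eu N × Eu N, 0 ≤ u p.1 * u p.2 := by
    filter_upwards [hf1, hg1, hdiag] with p h1 h2 h3
    rw [hf'] at h1
    rw [hg'] at h2
    have hpos : 0 < 2 * k (p.1 - p.2) ∨ 0 < j (p.1 - p.2) := by
      rcases le_or_gt 1 ‖p.1 - p.2‖ with h4 | h4
      · exact Or.inr (h.j_pos _ h4)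
      · left
        have h5 : 0 < kNear 0 (p.1 - p.2) := by
          rw [kNear_of_le h4.le]
          exact inv_pos.2 (Real.rpow_pos_of_pos (norm_pos_iff.2 h3) _)
        have := h.le_k (p.1 - p.2)
        have := mul_pos h.pos h5
        linarith
    have h6 : |u p.1 * u p.2| - u p.1 * u p.2 = 0 := by
      rcases hpos with h5 | h5
      · exact (mul_eq_zero.1 h1).resolve_left h5.ne'
      · exact (mul_eq_zero.1 h2).resolve_left h5.ne'
    rw [← sub_eq_zero.1 h6]
    exact abs_nonneg _
  have hae := Measure.ae_ae_of_ae_prod hprod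
  by_contra! hcon
  obtain ⟨hneg, hpos⟩ := hcon
  obtain ⟨x, hx1, hx2⟩ := (hpos.and_eventually hae).exists
  obtain ⟨y, hy1, hy2⟩ := (hneg.and_eventually hx2).exists
  exact absurd hy2 (not_le.2 (mul_neg_of_pos_of_neg hx1 hy1))

/-- Two nonnegative normalized eigenfunctions for the bottom eigenvalue agree: their difference is
again an eigenfunction, hence of one sign, and their norms coincide. -/
theorem IsRayleighBound.ae_eq (hb : IsRayleighBound Ω k j b lam) (h : Admissible c C k j)
    (hN : 1 ≤ N) (hΩ : Bornology.IsBounded Ω) (hu : IsWeakEigen Ω k j b lam u)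
    (hv : IsWeakEigen Ω k j b lam v) (hu0 : ∀ᵐ x, 0 ≤ u x) (hv0 : ∀ᵐ x, 0 ≤ v x)
    (hu1 : ∫ x, u x * u x = 1) (hv1 : ∫ x, v x * v x = 1) : u =ᵐ[volume] v := by
  have hum := h.memLp hN hΩ hu.1
  have hvm := h.memLp hN hΩ hv.1
  -- it suffices to treat ordered functions
  have main : ∀ {f g : Eu N → ℝ}, MemLp f 2 volume → MemLp g 2 volume → (∀ᵐ x, 0 ≤ g x) →
      ∫ x, f x * f x = 1 → ∫ x, g x * g x = 1 → (∀ᵐ x, g x ≤ f x) → f =ᵐ[volume] g := by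
    intro f g hf hg hg0 hf1 hg1 hle
    have hff := integrable_mul_of_memLp hf hf
    have hgg := integrable_mul_of_memLp hg hg
    have h0 : 0 ≤ᵐ[volume] fun x => f x * f x - g x * g x := by
      filter_upwards [hg0, hle] with x h1 h2
      exact sub_nonneg.2 (mul_self_le_mul_self h1 h2)
    have hz := (integral_eq_zero_iff_of_nonneg_ae h0 (hff.sub hgg)).1 (by
      rw [integral_sub hff hgg, hf1, hg1, sub_self])
    filter_upwards [hz, hg0, hle] with x h1 h2 h3
    have h4 : f x * f x - g x * g x = 0 := h1
    nlinarith
  have hw := hu.sub hv h hN hΩ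
  rcases hb.nonneg_or_nonpos h hN hΩ hw.1 (hw.2 _ hw.1) with hs | hs
  · exact main hum hvm hv0 hu1 hv1 (hs.mono fun x hx => sub_nonneg.1 hx)
  · exact (main hvm hum hu0 hv1 hu1 (hs.mono fun x hx => sub_nonpos.1 hx)).symm

end Eigen

/-! ### Translations are continuous in the logarithmic energy -/

/-- The squared norm of the logarithmic energy space. -/
noncomputable def energyNormSq {N : ℕ} (u : Eu N → ℝ) : ℝ :=
  gagliardo (kNear 0) u u + ∫ x, u x * u x

section Translation

variable {N : ℕ} {Ω : Set (Eu N)} {k : Eu N → ℝ} {u v w : Eu N → ℝ}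

lemma tendsto_integral_translate_sub_sq (hu : MemLp u 2 volume) :
    Tendsto (fun z => ∫ x, (u (x - z) - u x) * (u (x - z) - u x)) (𝓝 0) (𝓝 0) := by
  have : Fact ((2 : ENNReal) ≠ ⊤) := ⟨ENNReal.ofNat_ne_top⟩
  let G : C(Eu N, C(Eu N, Eu N)) :=
    ContinuousMap.curry ⟨fun p : Eu N × Eu N => p.2 - p.1, by fun_prop⟩
  have hG : ∀ z, MeasurePreserving (G z) (volume : Measure (Eu N)) volume :=
    fun z => measurePreserving_sub_right volume z
  have h := Filter.Tendsto.compMeasurePreservingLp (l := 𝓝 (0 : Eu N))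
    (tendsto_const_nhds (x := hu.toLp)) (G.continuous.tendsto 0) hG (hG 0) ENNReal.ofNat_ne_top
  have h2 := ((tendsto_iff_norm_sub_tendsto_zero.1 h).pow 2)
  rw [zero_pow two_ne_zero] at h2
  refine h2.congr fun z => ?_
  rw [Lp.toLp_compMeasurePreserving, Lp.toLp_compMeasurePreserving, ← MemLp.toLp_sub, norm_toLp_sq]
  refine integral_congr_ae (ae_of_all _ fun x => ?_)
  simp [G]

lemma MemForm.univ (hu : MemForm Ω k u) : MemForm Set.univ k u :=
  ⟨hu.aemeasurable, fun x hx => absurd (mem_univ x) hx, hu.integrable⟩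

lemma measurePreserving_translate_pair (z : Eu N) :
    MeasurePreserving (fun p : Eu N × Eu N => (p.1 - z, p.2 - z)) volume volume :=
  (measurePreserving_sub_right volume z).prod (measurePreserving_sub_right volume z)

lemma MemForm.translate (hu : MemForm Ω k u) (z : Eu N) :
    MemForm Set.univ k (fun x => u (x - z)) where
  aemeasurable := hu.aemeasurable.comp_quasiMeasurePreserving
    (measurePreserving_sub_right volume z).quasiMeasurePreserving
  eq_zero x hx := absurd (mem_univ x) hx
  integrable := by
    have := (measurePreserving_translate_pair z).integrable_comp_of_integrable hu.integrable
    refine this.congr (ae_of_all _ fun p => ?_)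
    simp [Function.comp]

lemma gagliardo_translate (k u : Eu N → ℝ) (z : Eu N) :
    gagliardo k (fun x => u (x - z)) (fun x => u (x - z)) = gagliardo k u u := by
  have := (measurePreserving_translate_pair z).integral_comp
    ((MeasurableEquiv.subRight z).prodCongr (MeasurableEquiv.subRight z)).measurableEmbedding
    (fun p : Eu N × Eu N => k (p.1 - p.2) * ((u p.1 - u p.2) * (u p.1 - u p.2)))
  rw [gagliardo, gagliardo, ← this]
  simp

lemma tendsto_gagliardo_kAnnulus (hN : 1 ≤ N) (hu : MemForm Ω (kNear 0) u) :
    Tendsto (fun n : ℕ => gagliardo (kAnnulus (1 / ((n : ℝ) + 1))) u u) atTop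
      (𝓝 (gagliardo (kNear 0) u u)) := by
  refine tendsto_integral_of_dominated_convergence _
    (fun n => aestronglyMeasurable_gagliardo (measurable_kAnnulus _) hu.aemeasurable
      hu.aemeasurable) hu.integrable (fun n => ae_of_all _ fun p => ?_) (ae_of_all _ fun p => ?_)
  · rw [Real.norm_eq_abs, abs_of_nonneg (mul_nonneg (kAnnulus_nonneg _ _) (mul_self_nonneg _))]
    exact mul_le_mul_of_nonneg_right (kAnnulus_le_kNear _ _) (mul_self_nonneg _)
  · refine Tendsto.mul_const _ (tendsto_const_nhds.congr' ?_)
    rcases eq_or_ne p.1 p.2 with h0 | h0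
    · refine Eventually.of_forall fun n => ?_
      have e0 : kAnnulus (1 / ((n : ℝ) + 1)) (0 : Eu N) = 0 := indicator_of_notMem (fun h => by
        have h1 : 0 < 1 / ((n : ℝ) + 1) := by positivity
        have h2 := h.1
        rw [norm_zero] at h2
        linarith) _
      have e1 : kNear 0 (0 : Eu N) = 0 := by
        rw [kNear_of_le (by simp)]
        simp only [norm_zero, mul_zero, add_zero, Real.rpow_natCast, inv_eq_zero]
        exact zero_pow (by omega)
      simp only [h0, sub_self, e0, e1]
    · have hpos : 0 < ‖p.1 - p.2‖ := norm_pos_iff.2 (sub_ne_zero.2 h0)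
      have := tendsto_one_div_add_atTop_nhds_zero_nat (𝕜 := ℝ)
      filter_upwards [this.eventually (gt_mem_nhds hpos)] with n hn
      rcases le_or_gt ‖p.1 - p.2‖ 1 with h | h
      · rw [kNear_of_le h, kAnnulus, indicator_of_mem (show ‖p.1 - p.2‖ ∈ Icc _ _ from ⟨hn.le, h⟩)]
      · rw [kNear_of_lt h, kAnnulus_eq_zero h]

lemma gagliardo_le_of_integrable (hk : Integrable k) (hkm : Measurable k) (hk0 : ∀ z, 0 ≤ k z)
    (hk' : ∀ z, k (-z) = k z) (hu : MemLp u 2 volume) :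
    gagliardo k u u ≤ 4 * (∫ z, k z) * ∫ x, u x * u x := by
  have huu := integrable_mul_of_memLp hu hu
  have h1 := (integrable_kernel_mul_fst hk hk' huu).const_mul 2
  have h2 := (integrable_kernel_mul_snd hk huu).const_mul 2
  have e1 := integral_kernel_mul_fst hk hk' huu
  have e2 := integral_kernel_mul_snd hk huu
  calc gagliardo k u u ≤ ∫ p : Eu N × Eu N, 2 * (k (p.1 - p.2) * (u p.1 * u p.1))
        + 2 * (k (p.1 - p.2) * (u p.2 * u p.2)) := by
        refine integral_mono (integrable_gagliardo_of_memLp hk hkm hk' hu hu) (h1.add h2)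
          fun p => ?_
        have := mul_nonneg (hk0 (p.1 - p.2)) (mul_self_nonneg (u p.1 + u p.2))
        simp only
        nlinarith
    _ = _ := by
        rw [integral_add h1 h2, integral_const_mul, integral_const_mul, e1, e2]
        ring

/-- Near the diagonal the energy of `u(· - z) - u` is at most four times that of `u`, uniformly in
`z`; away from the diagonal it is controlled by the `L²` norm. -/
theorem exists_energyNormSq_translate_sub_le (hN : 1 ≤ N) (hu : MemForm Ω (kNear 0) u)
    (hum : MemLp u 2 volume) {ε : ℝ} (hε : 0 < ε) :
    ∃ τ > 0, ∀ z : Eu N, ‖z‖ < τ → energyNormSq (fun x => u (x - z) - u x) ≤ ε := by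
  obtain ⟨n, hn⟩ := ((tendsto_gagliardo_kAnnulus hN hu).eventually (lt_mem_nhds
    (show gagliardo (kNear 0) u u - ε / 8 < gagliardo (kNear 0) u u by linarith))).exists
  set δ : ℝ := 1 / ((n : ℝ) + 1)
  have hδ : 0 < δ := by positivity
  set m := ∫ z : Eu N, kAnnulus δ z
  have hm : 0 ≤ m := integral_nonneg (kAnnulus_nonneg δ)
  obtain ⟨τ, hτ, hτ'⟩ := Metric.eventually_nhds_iff.1
    ((tendsto_integral_translate_sub_sq hum).eventually (gt_mem_nhds
      (show 0 < ε / (2 * (4 * m + 1)) by positivity)))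
  refine ⟨τ, hτ, fun z hz => ?_⟩
  have hzL := hτ' (y := z) (by rwa [dist_zero_right])
  set e : Eu N → ℝ := fun x => u (x - z) - u x with he
  have hem : MemLp e 2 volume :=
    (hum.comp_measurePreserving (measurePreserving_sub_right volume z)).sub hum
  have heF : MemForm Set.univ (kNear 0) e :=
    (hu.translate z).sub (measurable_kNear 0) (kNear_nonneg 0) hu.univ
  -- the part of the kernel near the origin
  set κ : Eu N → ℝ := fun z => kNear 0 z - kAnnulus δ z with hκ
  have hκm : Measurable κ := (measurable_kNear 0).sub (measurable_kAnnulus δ)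
  have hκ0 : ∀ z, 0 ≤ κ z := fun z => sub_nonneg.2 (kAnnulus_le_kNear δ z)
  have hκle : ∀ z, 1 * κ z ≤ kNear 0 z := fun z => by
    rw [one_mul]
    exact sub_le_self _ (kAnnulus_nonneg δ z)
  have huκ := hu.univ.mono one_pos hκm hκ0 hκle
  have huκz := (hu.translate z).mono one_pos hκm hκ0 hκle
  have hsplit : ∀ f : Eu N → ℝ, MemForm Set.univ (kNear 0) f → MemLp f 2 volume →
      gagliardo (kNear 0) f f = gagliardo κ f f + gagliardo (kAnnulus δ) f f := by
    intro f hf hfm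
    unfold gagliardo
    rw [← integral_add (hf.mono one_pos hκm hκ0 hκle).integrable (integrable_gagliardo_of_memLp
      (integrable_kAnnulus hδ) (measurable_kAnnulus δ) (kAnnulus_neg δ) hfm hfm)]
    congr 1 with p
    simp only [hκ]
    ring
  have h1 := hsplit e heF hem
  have h2 := hsplit u hu.univ hum
  have h3 := gagliardo_sub_le hκm hκ0 huκz huκ
  rw [gagliardo_translate] at h3
  have h4 := gagliardo_le_of_integrable (integrable_kAnnulus hδ) (measurable_kAnnulus δ)
    (kAnnulus_nonneg δ) (kAnnulus_neg δ) hem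
  have h5 : (4 * m + 1) * ∫ x, e x * e x ≤ ε / 2 := by
    have := mul_le_mul_of_nonneg_left hzL.le (show 0 ≤ 4 * m + 1 by positivity)
    refine this.trans_eq ?_
    field_simp
  rw [energyNormSq]
  change gagliardo κ e e ≤ _ at h3
  change gagliardo (kAnnulus δ) e e ≤ 4 * m * _ at h4
  linarith

end Translation

/-! ### Averages of translates -/

section Mollification

variable {N : ℕ} {Ω : Set (Eu N)} {u : Eu N → ℝ}

lemma ofReal_sq_integral_le {α : Type*} [MeasurableSpace α] {P : Measure α}
    [IsProbabilityMeasure P] {f : α → ℝ} (hf : Integrable f P) :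
    ENNReal.ofReal ((∫ x, f x ∂P) * ∫ x, f x ∂P) ≤ ∫⁻ x, ENNReal.ofReal (f x * f x) ∂P := by
  by_cases h : Integrable (fun x => f x * f x) P
  · rw [← ofReal_integral_eq_lintegral_ofReal h (ae_of_all _ fun x => mul_self_nonneg _)]
    refine ENNReal.ofReal_le_ofReal ?_
    set m := ∫ x, f x ∂P
    have h1 : 0 ≤ ∫ x, (f x - m) * (f x - m) ∂P := integral_nonneg fun x => mul_self_nonneg _
    have h2 : ∫ x, (f x - m) * (f x - m) ∂P = (∫ x, f x * f x ∂P) - 2 * m * m + m * m := by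
      have e : ∀ x, (f x - m) * (f x - m) = f x * f x - 2 * m * f x + m * m := fun x => by ring
      simp only [e]
      have h3 : Integrable (fun x => f x * f x - 2 * m * f x) P := h.sub (hf.const_mul _)
      rw [integral_add h3 (integrable_const _), integral_sub h (hf.const_mul _),
        integral_const_mul, integral_const, probReal_univ, one_smul]
    linarith
  · have : ∫⁻ x, ENNReal.ofReal (f x * f x) ∂P = ⊤ := by
      by_contra hne
      refine h ⟨hf.aestronglyMeasurable.mul hf.aestronglyMeasurable, ?_⟩
      rw [hasFiniteIntegral_iff_ofReal (ae_of_all _ fun x => mul_self_nonneg _)]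
      exact lt_top_iff_ne_top.2 hne
    rw [this]
    exact le_top

lemma energyNormSq_le_of_lintegral {e : Eu N → ℝ} (he : Measurable e) {ε : ℝ}
    (hε : 0 ≤ ε)
    (h : (∫⁻ p : Eu N × Eu N, ENNReal.ofReal
        (kNear 0 (p.1 - p.2) * ((e p.1 - e p.2) * (e p.1 - e p.2))))
      + ∫⁻ x, ENNReal.ofReal (e x * e x) ≤ ENNReal.ofReal ε) : energyNormSq e ≤ ε := by
  have h1 : ∀ p : Eu N × Eu N, 0 ≤ kNear 0 (p.1 - p.2) * ((e p.1 - e p.2) * (e p.1 - e p.2)) :=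
    fun p => mul_nonneg (kNear_nonneg 0 _) (mul_self_nonneg _)
  rw [energyNormSq, gagliardo, integral_eq_lintegral_of_nonneg_ae (ae_of_all _ h1)
    (aestronglyMeasurable_gagliardo (measurable_kNear 0) he.aemeasurable he.aemeasurable),
    integral_eq_lintegral_of_nonneg_ae (ae_of_all _ fun x => mul_self_nonneg _)
    (he.mul he).aestronglyMeasurable, ← ENNReal.toReal_add]
  · exact ENNReal.toReal_le_of_le_ofReal hε h
  · exact ((le_self_add.trans h).trans_lt ENNReal.ofReal_lt_top).ne
  · exact ((le_add_self.trans h).trans_lt ENNReal.ofReal_lt_top).ne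

/-- **Jensen's inequality** for averages of translates: if all translates of `u` by elements of a
ball are `ε`-close to `u` in energy, then so is any average of them. -/
theorem energyNormSq_average_sub_le (hu : MemForm Ω (kNear 0) u) (hum : Measurable u)
    (hu2 : MemLp u 2 volume) {P : Measure (Eu N)} [IsProbabilityMeasure P]
    (hint : ∀ x, Integrable (fun z => u (x - z)) P) {ε : ℝ} (hε : 0 ≤ ε)
    (hP : ∀ᵐ z ∂P, energyNormSq (fun x => u (x - z) - u x) ≤ ε) :
    energyNormSq (fun x => (∫ z, u (x - z) ∂P) - u x) ≤ ε := by
  have hvm : Measurable fun x => ∫ z, u (x - z) ∂P :=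
    (StronglyMeasurable.integral_prod_right' (f := fun p : Eu N × Eu N => u (p.1 - p.2))
      (hum.comp (measurable_fst.sub measurable_snd)).stronglyMeasurable).measurable
  refine energyNormSq_le_of_lintegral (hvm.sub hum) hε ?_
  -- the integrands for a single translate
  set D : Eu N → Eu N → ℝ := fun z x => u (x - z) - u x with hD
  have hDint : ∀ x, Integrable (fun z => D z x) P := fun x => (hint x).sub (integrable_const _)
  have hDe : ∀ x, (∫ z, u (x - z) ∂P) - u x = ∫ z, D z x ∂P := fun x => by
    rw [integral_sub (hint x) (integrable_const _), integral_const]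
    simp
  have hDm : Measurable (Function.uncurry D) :=
    (hum.comp (measurable_snd.sub measurable_fst)).sub (hum.comp measurable_snd)
  have b1 : ∀ p : Eu N × Eu N, ENNReal.ofReal (kNear 0 (p.1 - p.2) *
      (((∫ z, u (p.1 - z) ∂P) - u p.1 - ((∫ z, u (p.2 - z) ∂P) - u p.2)) *
        ((∫ z, u (p.1 - z) ∂P) - u p.1 - ((∫ z, u (p.2 - z) ∂P) - u p.2))))
      ≤ ∫⁻ z, ENNReal.ofReal (kNear 0 (p.1 - p.2) * ((D z p.1 - D z p.2) * (D z p.1 - D z p.2)))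
        ∂P := by
    intro p
    rw [hDe, hDe, ← integral_sub (hDint _) (hDint _), ENNReal.ofReal_mul (kNear_nonneg 0 _)]
    simp only [ENNReal.ofReal_mul (kNear_nonneg 0 (p.1 - p.2))]
    rw [lintegral_const_mul' _ _ ENNReal.ofReal_ne_top]
    gcongr
    exact ofReal_sq_integral_le ((hDint _).sub (hDint _))
  have b2 : ∀ x, ENNReal.ofReal (((∫ z, u (x - z) ∂P) - u x) * ((∫ z, u (x - z) ∂P) - u x))
      ≤ ∫⁻ z, ENNReal.ofReal (D z x * D z x) ∂P := by
    intro x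
    rw [hDe]
    exact ofReal_sq_integral_le (hDint x)
  have m1 : Measurable (Function.uncurry fun (p : Eu N × Eu N) (z : Eu N) => ENNReal.ofReal
      (kNear 0 (p.1 - p.2) * ((D z p.1 - D z p.2) * (D z p.1 - D z p.2)))) := by
    have a1 : Measurable fun q : (Eu N × Eu N) × Eu N => D q.2 q.1.1 :=
      hDm.comp (measurable_snd.prodMk (measurable_fst.comp measurable_fst))
    have a2 : Measurable fun q : (Eu N × Eu N) × Eu N => D q.2 q.1.2 :=
      hDm.comp (measurable_snd.prodMk (measurable_snd.comp measurable_fst))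
    have a3 : Measurable fun q : (Eu N × Eu N) × Eu N => kNear 0 (q.1.1 - q.1.2) :=
      (measurable_kNear 0).comp (by fun_prop)
    exact (a3.mul ((a1.sub a2).mul (a1.sub a2))).ennreal_ofReal
  have m2 : Measurable (Function.uncurry fun (x : Eu N) (z : Eu N) =>
      ENNReal.ofReal (D z x * D z x)) := by
    have a1 : Measurable fun q : Eu N × Eu N => D q.2 q.1 := hDm.comp measurable_swap
    exact (a1.mul a1).ennreal_ofReal
  calc _ ≤ (∫⁻ p : Eu N × Eu N, ∫⁻ z, ENNReal.ofReal (kNear 0 (p.1 - p.2) *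
          ((D z p.1 - D z p.2) * (D z p.1 - D z p.2))) ∂P)
        + ∫⁻ x, ∫⁻ z, ENNReal.ofReal (D z x * D z x) ∂P :=
        add_le_add (lintegral_mono b1) (lintegral_mono b2)
    _ = ∫⁻ z, ((∫⁻ p : Eu N × Eu N, ENNReal.ofReal (kNear 0 (p.1 - p.2) *
          ((D z p.1 - D z p.2) * (D z p.1 - D z p.2))))
        + ∫⁻ x, ENNReal.ofReal (D z x * D z x)) ∂P := by
        rw [lintegral_lintegral_swap m1.aemeasurable, lintegral_lintegral_swap m2.aemeasurable,
          lintegral_add_left (f := fun z => ∫⁻ p : Eu N × Eu N, ENNReal.ofReal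
            (kNear 0 (p.1 - p.2) * ((D z p.1 - D z p.2) * (D z p.1 - D z p.2))))
            m1.lintegral_prod_left']
    _ ≤ ∫⁻ z, ENNReal.ofReal ε ∂P := by
        refine lintegral_mono_ae ?_
        filter_upwards [hP] with z hz
        have hf : MemForm Set.univ (kNear 0) (D z) :=
          (hu.translate z).sub (measurable_kNear 0) (kNear_nonneg 0) hu.univ
        have hf2 : MemLp (D z) 2 volume :=
          (hu2.comp_measurePreserving (measurePreserving_sub_right volume z)).sub hu2
        rw [← ofReal_integral_eq_lintegral_ofReal hf.integrable
          (ae_of_all _ fun p => mul_nonneg (kNear_nonneg 0 _) (mul_self_nonneg _)),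
          ← ofReal_integral_eq_lintegral_ofReal (integrable_mul_of_memLp hf2 hf2)
          (ae_of_all _ fun x => mul_self_nonneg _), ← ENNReal.ofReal_add
          (integral_nonneg fun p => mul_nonneg (kNear_nonneg 0 _) (mul_self_nonneg _))
          (integral_nonneg fun x => mul_self_nonneg _)]
        exact ENNReal.ofReal_le_ofReal hz
    _ = ENNReal.ofReal ε := by simp

end Mollification

/-! ### Density of Lipschitz functions in the logarithmic energy space -/

/-- `u` is a limit, in the logarithmic energy space, of Lipschitz functions vanishing outside
`Ω`. -/
def IsLipschitzLimit {N : ℕ} (Ω : Set (Eu N)) (u : Eu N → ℝ) : Prop :=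
  ∀ ε > 0, ∃ φ : Eu N → ℝ, (∃ K, LipschitzWith K φ) ∧ (∀ x ∉ Ω, φ x = 0) ∧
    energyNormSq (fun x => u x - φ x) ≤ ε

section Density

variable {N : ℕ} {Ω : Set (Eu N)} {u v w : Eu N → ℝ}

lemma energyNormSq_congr_ae (h : u =ᵐ[volume] v) : energyNormSq u = energyNormSq v := by
  unfold energyNormSq gagliardo
  congr 1
  · refine integral_congr_ae ?_
    have h1 : ∀ᵐ p : Eu N × Eu N, u p.1 = v p.1 := Measure.quasiMeasurePreserving_fst.ae h
    have h2 : ∀ᵐ p : Eu N × Eu N, u p.2 = v p.2 := Measure.quasiMeasurePreserving_snd.ae h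
    filter_upwards [h1, h2] with p h1 h2
    rw [h1, h2]
  · refine integral_congr_ae ?_
    filter_upwards [h] with x hx
    rw [hx]

lemma MemForm.congr_ae {k : Eu N → ℝ} (hu : MemForm Ω k u) (h : u =ᵐ[volume] v)
    (hv : ∀ x ∉ Ω, v x = 0) : MemForm Ω k v where
  aemeasurable := hu.aemeasurable.congr h
  eq_zero := hv
  integrable := by
    refine hu.integrable.congr ?_
    have h1 : ∀ᵐ p : Eu N × Eu N, u p.1 = v p.1 := Measure.quasiMeasurePreserving_fst.ae h
    have h2 : ∀ᵐ p : Eu N × Eu N, u p.2 = v p.2 := Measure.quasiMeasurePreserving_snd.ae h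
    filter_upwards [h1, h2] with p h1 h2
    rw [h1, h2]

lemma IsLipschitzLimit.congr_ae (hv : IsLipschitzLimit Ω v) (h : u =ᵐ[volume] v) :
    IsLipschitzLimit Ω u := by
  intro ε hε
  obtain ⟨φ, hφ, hφ0, hle⟩ := hv ε hε
  refine ⟨φ, hφ, hφ0, ?_⟩
  rwa [energyNormSq_congr_ae (v := fun x => v x - φ x) (h.mono fun x hx => by simp only [hx])]

/-- Lipschitz functions supported in a bounded set have finite energy of every order less
than `2`. -/
lemma memForm_of_lipschitz (hN : 1 ≤ N) (hΩ : Bornology.IsBounded Ω) {s : ℝ} (hs : s < 1)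
    {φ : Eu N → ℝ} {K : NNReal} (hφ : LipschitzWith K φ) (hφ0 : ∀ x ∉ Ω, φ x = 0) :
    MemForm Ω (kNear s) φ where
  aemeasurable := hφ.continuous.measurable.aemeasurable
  eq_zero := hφ0
  integrable := by
    have hm : MeasurableSet (closure Ω) := isClosed_closure.measurableSet
    have hone : Integrable ((closure Ω).indicator fun _ => (1 : ℝ)) :=
      (integrable_indicator_iff hm).2 (integrableOn_const hΩ.closure.measure_lt_top.ne)
    have hk := integrable_sq_mul_kNear hN hs
    have hk' : ∀ z : Eu N, ‖-z‖ ^ 2 * kNear s (-z) = ‖z‖ ^ 2 * kNear s z := fun z => by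
      rw [norm_neg, kNear_neg]
    refine (((integrable_kernel_mul_fst hk hk' hone).add
      (integrable_kernel_mul_snd hk hone)).const_mul ((K : ℝ) ^ 2)).mono'
      (aestronglyMeasurable_gagliardo (measurable_kNear s) hφ.continuous.measurable.aemeasurable
        hφ.continuous.measurable.aemeasurable) (ae_of_all _ fun p => ?_)
    rw [Real.norm_eq_abs, abs_of_nonneg (mul_nonneg (kNear_nonneg s _) (mul_self_nonneg _)),
      Pi.add_apply, ← mul_add]
    set I₁ := (closure Ω).indicator (fun _ => (1 : ℝ)) p.1 with hI₁
    set I₂ := (closure Ω).indicator (fun _ => (1 : ℝ)) p.2 with hI₂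
    have hI₁0 : 0 ≤ I₁ := indicator_nonneg (fun _ _ => zero_le_one) _
    have hI₂0 : 0 ≤ I₂ := indicator_nonneg (fun _ _ => zero_le_one) _
    by_cases hp : p.1 ∈ Ω ∨ p.2 ∈ Ω
    · have hI : 1 ≤ I₁ + I₂ := by
        rcases hp with hp | hp
        · rw [hI₁, indicator_of_mem (subset_closure hp)]
          linarith
        · rw [hI₂, indicator_of_mem (subset_closure hp)]
          linarith
      have h1 : |φ p.1 - φ p.2| ≤ K * ‖p.1 - p.2‖ := by
        simpa [Real.dist_eq, dist_eq_norm] using hφ.dist_le_mul p.1 p.2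
      have h2 : (φ p.1 - φ p.2) * (φ p.1 - φ p.2) ≤ (K : ℝ) ^ 2 * ‖p.1 - p.2‖ ^ 2 := by
        rw [← abs_mul_abs_self, ← mul_pow, sq]
        exact mul_self_le_mul_self (abs_nonneg _) h1
      calc kNear s (p.1 - p.2) * ((φ p.1 - φ p.2) * (φ p.1 - φ p.2))
          ≤ kNear s (p.1 - p.2) * ((K : ℝ) ^ 2 * ‖p.1 - p.2‖ ^ 2) :=
            mul_le_mul_of_nonneg_left h2 (kNear_nonneg s _)
        _ = (K : ℝ) ^ 2 * (‖p.1 - p.2‖ ^ 2 * kNear s (p.1 - p.2)) * 1 := by ring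
        _ ≤ (K : ℝ) ^ 2 * (‖p.1 - p.2‖ ^ 2 * kNear s (p.1 - p.2)) * (I₁ + I₂) :=
            mul_le_mul_of_nonneg_left hI (mul_nonneg (sq_nonneg _)
              (mul_nonneg (sq_nonneg _) (kNear_nonneg s _)))
        _ = _ := by ring
    · push Not at hp
      rw [hφ0 _ hp.1, hφ0 _ hp.2, sub_zero, mul_zero, mul_zero]
      exact mul_nonneg (sq_nonneg _) (mul_nonneg (mul_nonneg (sq_nonneg _) (kNear_nonneg s _))
        (add_nonneg hI₁0 hI₂0))

/-- The energy space is stable under multiplication by Lipschitz functions with values in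
`[0, 1]`. -/
lemma MemForm.lipschitz_mul (hN : 1 ≤ N) (hΩ : Bornology.IsBounded Ω)
    (hu : MemForm Ω (kNear 0) u) {χ : Eu N → ℝ} {K : NNReal} (hχ : LipschitzWith K χ)
    (hχ0 : ∀ x, 0 ≤ χ x) (hχ1 : ∀ x, χ x ≤ 1) : MemForm Ω (kNear 0) (fun x => χ x * u x) where
  aemeasurable := hχ.continuous.measurable.aemeasurable.mul hu.aemeasurable
  eq_zero x hx := by simp [hu.eq_zero x hx]
  integrable := by
    have hum := hu.memLp hN hΩ
    have hk := integrable_sq_mul_kNear hN (show (0 : ℝ) < 1 by norm_num)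
    have hm : AEMeasurable (fun x => χ x * u x) volume :=
      hχ.continuous.measurable.aemeasurable.mul hu.aemeasurable
    refine ((hu.integrable.const_mul 2).add ((integrable_kernel_mul_snd hk
      (integrable_mul_of_memLp hum hum)).const_mul (2 * (K : ℝ) ^ 2))).mono'
      (aestronglyMeasurable_gagliardo (measurable_kNear 0) hm hm) (ae_of_all _ fun p => ?_)
    rw [Real.norm_eq_abs, abs_of_nonneg (mul_nonneg (kNear_nonneg 0 _) (mul_self_nonneg _)),
      Pi.add_apply]
    have h1 : |χ p.1 - χ p.2| ≤ K * ‖p.1 - p.2‖ := by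
      simpa [Real.dist_eq, dist_eq_norm] using hχ.dist_le_mul p.1 p.2
    have h2 : (χ p.1 - χ p.2) * (χ p.1 - χ p.2) ≤ (K : ℝ) ^ 2 * ‖p.1 - p.2‖ ^ 2 := by
      rw [← abs_mul_abs_self, ← mul_pow, sq]
      exact mul_self_le_mul_self (abs_nonneg _) h1
    have h3 : χ p.1 * χ p.1 ≤ 1 := by nlinarith [hχ0 p.1, hχ1 p.1]
    have h4 : (χ p.1 * u p.1 - χ p.2 * u p.2) * (χ p.1 * u p.1 - χ p.2 * u p.2)
        ≤ 2 * ((u p.1 - u p.2) * (u p.1 - u p.2))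
          + 2 * (K : ℝ) ^ 2 * (‖p.1 - p.2‖ ^ 2 * (u p.2 * u p.2)) := by
      have a1 := mul_le_mul_of_nonneg_right h3 (mul_self_nonneg (u p.1 - u p.2))
      have a2 := mul_le_mul_of_nonneg_right h2 (mul_self_nonneg (u p.2))
      have a3 := mul_self_nonneg (χ p.1 * (u p.1 - u p.2) - (χ p.1 - χ p.2) * u p.2)
      nlinarith
    refine (mul_le_mul_of_nonneg_left h4 (kNear_nonneg 0 _)).trans_eq ?_
    ring

lemma energyNormSq_add_le (hu : MemForm Ω (kNear 0) u) (hv : MemForm Ω (kNear 0) v)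
    (hu2 : MemLp u 2 volume) (hv2 : MemLp v 2 volume) :
    energyNormSq (fun x => u x + v x) ≤ 2 * energyNormSq u + 2 * energyNormSq v := by
  have h1 := gagliardo_sub_le (measurable_kNear 0) (kNear_nonneg 0) hu (hv.const_mul (-1))
  have e1 : gagliardo (kNear 0) (fun x => -1 * v x) (fun x => -1 * v x) =
      gagliardo (kNear 0) v v := by
    rw [gagliardo_const_mul_left, gagliardo_comm, gagliardo_const_mul_left]
    ring
  have e2 : (fun x => u x - -1 * v x) = fun x => u x + v x := by
    ext x
    ring
  rw [e1, e2] at h1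
  have h2 : ∫ x, (u x + v x) * (u x + v x) ≤ 2 * (∫ x, u x * u x) + 2 * ∫ x, v x * v x := by
    have i1 := (integrable_mul_of_memLp hu2 hu2).const_mul 2
    have i2 := (integrable_mul_of_memLp hv2 hv2).const_mul 2
    rw [← integral_const_mul, ← integral_const_mul, ← integral_add i1 i2]
    refine integral_mono (integrable_mul_of_memLp (hu2.add hv2) (hu2.add hv2)) (i1.add i2)
      fun x => ?_
    nlinarith [mul_self_nonneg (u x - v x)]
  unfold energyNormSq
  linarith

lemma IsLipschitzLimit.add (hN : 1 ≤ N) (hΩ : Bornology.IsBounded Ω)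
    (hu : MemForm Ω (kNear 0) u) (hv : MemForm Ω (kNear 0) v) (hu' : IsLipschitzLimit Ω u)
    (hv' : IsLipschitzLimit Ω v) : IsLipschitzLimit Ω (fun x => u x + v x) := by
  intro ε hε
  obtain ⟨φ, ⟨K, hφ⟩, hφ0, hφe⟩ := hu' (ε / 4) (by positivity)
  obtain ⟨ψ, ⟨L, hψ⟩, hψ0, hψe⟩ := hv' (ε / 4) (by positivity)
  refine ⟨fun x => φ x + ψ x, ⟨K + L, hφ.add hψ⟩, fun x hx => by simp [hφ0 x hx, hψ0 x hx], ?_⟩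
  have h1 := hu.sub (measurable_kNear 0) (kNear_nonneg 0)
    (memForm_of_lipschitz hN hΩ zero_lt_one hφ hφ0)
  have h2 := hv.sub (measurable_kNear 0) (kNear_nonneg 0)
    (memForm_of_lipschitz hN hΩ zero_lt_one hψ hψ0)
  have h3 := energyNormSq_add_le h1 h2 (h1.memLp hN hΩ) (h2.memLp hN hΩ)
  have e : (fun x => u x + v x - (φ x + ψ x)) = fun x => u x - φ x + (v x - ψ x) := by
    ext x
    ring
  rw [e]
  linarith

/-- A Lipschitz probability density supported in a given ball. -/
lemma exists_lipschitz_density (p : Eu N) {q : ℝ} (hq : 0 < q) :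
    ∃ (ρ : Eu N → ℝ) (K : NNReal), LipschitzWith K ρ ∧ (∀ z, 0 ≤ ρ z) ∧
      (∀ z ∉ Metric.ball p q, ρ z = 0) ∧ MemLp ρ 2 volume ∧ Integrable ρ ∧ ∫ z, ρ z = 1 := by
  set f : Eu N → ℝ := fun z => max (q - dist z p) 0 with hf
  have hfl : LipschitzWith 1 f := by
    have h1 : LipschitzWith 1 fun z : Eu N => q - dist z p := by
      have := (LipschitzWith.const q).sub (LipschitzWith.dist_left p)
      simpa using this
    exact h1.max_const 0
  have hf0 : ∀ z ∉ Metric.ball p q, f z = 0 := by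
    intro z hz
    rw [Metric.mem_ball, not_lt] at hz
    exact max_eq_right (by linarith)
  have hcs : HasCompactSupport f := by
    refine HasCompactSupport.intro (isCompact_closedBall p q) fun z hz => hf0 z fun h => hz ?_
    exact Metric.ball_subset_closedBall h
  have hfp : 0 < ∫ z, f z := by
    refine hfl.continuous.integral_pos_of_hasCompactSupport_nonneg_nonzero hcs
      (fun z => le_max_right _ _) (x := p) ?_
    simp [hf, hq.ne', hq.le]
  set A := ∫ z, f z
  have hcont : Continuous fun z => A⁻¹ * f z := hfl.continuous.const_smul A⁻¹
  have hcs' : HasCompactSupport fun z => A⁻¹ * f z := hcs.mul_left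
  refine ⟨fun z => A⁻¹ * f z, ⟨A⁻¹, by positivity⟩, ?_, fun z => mul_nonneg (by positivity)
    (le_max_right _ _), fun z hz => by simp [hf0 z hz], hcont.memLp_of_hasCompactSupport hcs',
    hcont.integrable_of_hasCompactSupport hcs', ?_⟩
  · refine LipschitzWith.of_dist_le_mul fun x y => ?_
    have := hfl.dist_le_mul x y
    rw [Real.dist_eq, ← mul_sub, abs_mul, abs_of_pos (inv_pos.2 hfp)]
    rw [Real.dist_eq, NNReal.coe_one, one_mul] at this
    exact mul_le_mul_of_nonneg_left this (by positivity)
  · rw [integral_const_mul, inv_mul_cancel₀ hfp.ne']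

/-- Near each point of its closure, a bounded Lipschitz domain is mapped into itself by all
translations in a suitable small ball: at a boundary point these are translations nearly parallel
to the vertical direction. -/
lemma IsBoundedLipschitzDomain.exists_translations (hΩ : IsBoundedLipschitzDomain Ω) {z₀ : Eu N}
    (hz₀ : z₀ ∈ closure Ω) :
    ∃ r > 0, ∀ τ > 0, ∃ (p : Eu N) (q : ℝ), 0 < q ∧ Metric.ball p q ⊆ Metric.ball 0 τ ∧
      ∀ y ∈ Ω ∩ Metric.ball z₀ r, ∀ z ∈ Metric.ball p q, y + z ∈ Ω := by
  by_cases hin : z₀ ∈ Ω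
  · obtain ⟨R, hR, hball⟩ := Metric.isOpen_iff.1 hΩ.isOpen z₀ hin
    refine ⟨R / 2, by positivity, fun τ hτ => ⟨0, min τ (R / 2), by positivity,
      Metric.ball_subset_ball (min_le_left _ _), fun y hy z hz => hball ?_⟩⟩
    have h1 := Metric.mem_ball.1 hy.2
    have h2 := (mem_ball_zero_iff.1 hz).trans_le (min_le_right _ _)
    rw [Metric.mem_ball]
    calc dist (y + z) z₀ ≤ dist (y + z) y + dist y z₀ := dist_triangle _ _ _
      _ = ‖z‖ + dist y z₀ := by simp [dist_eq_norm]
      _ < R := by linarith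
  · have hfr : z₀ ∈ frontier Ω := by
      rw [frontier, hΩ.isOpen.interior_eq]
      exact ⟨hz₀, hin⟩
    obtain ⟨R, hR, ν, hν, K, g, hg, hiff⟩ := hΩ.lipschitz_boundary z₀ hfr
    refine ⟨R / 2, by positivity, fun τ hτ => ?_⟩
    set t := min τ (R / 2) / 2 with ht
    have ht0 : 0 < t := by positivity
    have htτ : 2 * t ≤ τ := by
      have := min_le_left τ (R / 2)
      linarith
    have htR : 2 * t ≤ R / 2 := by
      have := min_le_right τ (R / 2)
      linarith
    have hK : (0 : ℝ) ≤ K := K.2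
    set q := t / (2 * K + 2) with hq
    have hq0 : 0 < q := by positivity
    have hqt : q * (2 * K + 2) = t := by
      rw [hq]
      field_simp
    have hqt' : q ≤ t := by nlinarith
    have hnorm : ∀ z ∈ Metric.ball (t • ν) q, ‖z‖ < 2 * t := by
      intro z hz
      rw [Metric.mem_ball, dist_eq_norm] at hz
      have h1 := norm_add_le (z - t • ν) (t • ν)
      rw [sub_add_cancel, norm_smul, hν, mul_one, Real.norm_of_nonneg ht0.le] at h1
      linarith
    refine ⟨t • ν, q, hq0, fun z hz => ?_, fun y hy z hz => ?_⟩
    · rw [mem_ball_zero_iff]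
      exact (hnorm z hz).trans_le htτ
    · have hzn := hnorm z hz
      have hyR := Metric.mem_ball.1 hy.2
      have hy1 : y ∈ Metric.ball z₀ R := by
        rw [Metric.mem_ball]
        linarith
      have hyz : y + z ∈ Metric.ball z₀ R := by
        rw [Metric.mem_ball]
        calc dist (y + z) z₀ ≤ dist (y + z) y + dist y z₀ := dist_triangle _ _ _
          _ = ‖z‖ + dist y z₀ := by simp [dist_eq_norm]
          _ < R := by linarith
      rw [hiff _ hyz]
      have hgy := (hiff _ hy1).1 hy.1
      set d := z - t • ν with hd
      have hdq : ‖d‖ < q := by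
        rw [Metric.mem_ball, dist_eq_norm] at hz
        exact hz
      have hz' : z = d + t • ν := by rw [hd, sub_add_cancel]
      have hνν : inner ℝ ν ν = (1 : ℝ) := by rw [real_inner_self_eq_norm_sq, hν, one_pow]
      have hinz : inner ℝ ν z = inner ℝ ν d + t := by
        rw [hz', inner_add_right, inner_smul_right, hνν, mul_one]
      have hind : |inner ℝ ν d| ≤ ‖d‖ := by
        have := abs_real_inner_le_norm ν d
        rwa [hν, one_mul] at this
      have hdist : dist (y + z - inner ℝ ν (y + z) • ν) (y - inner ℝ ν y • ν) ≤ 2 * ‖d‖ := by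
        have e : y + z - inner ℝ ν (y + z) • ν - (y - inner ℝ ν y • ν)
            = d - inner ℝ ν d • ν := by
          rw [inner_add_right, hinz, hz']
          module
        rw [dist_eq_norm, e]
        have h1 := norm_sub_le d (inner ℝ ν d • ν)
        rw [norm_smul, hν, mul_one, Real.norm_eq_abs] at h1
        linarith
      have hgl := hg.dist_le_mul (y + z - inner ℝ ν (y + z) • ν) (y - inner ℝ ν y • ν)
      rw [Real.dist_eq] at hgl
      have h2 := (le_abs_self _).trans hgl
      have h3 : (K : ℝ) * dist (y + z - inner ℝ ν (y + z) • ν) (y - inner ℝ ν y • ν)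
          ≤ K * (2 * q) := mul_le_mul_of_nonneg_left (by linarith) hK
      rw [inner_add_right, hinz] at *
      have h4 := (abs_le.1 hind).1
      nlinarith

lemma energyNormSq_sub_comm (u v : Eu N → ℝ) :
    energyNormSq (fun x => u x - v x) = energyNormSq (fun x => v x - u x) := by
  unfold energyNormSq gagliardo
  congr 1
  · congr 1 with p
    ring
  · congr 1 with x
    ring

/-- A function of finite energy supported near a point of the closure is a limit of Lipschitz
functions: push its support into `Ω` and mollify. -/
lemma IsLipschitzLimit.of_localized (hN : 1 ≤ N) (hΩ : Bornology.IsBounded Ω) (hΩo : IsOpen Ω)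
    {z₀ : Eu N} {r : ℝ}
    (htrans : ∀ τ > 0, ∃ (p : Eu N) (q : ℝ), 0 < q ∧ Metric.ball p q ⊆ Metric.ball 0 τ ∧
      ∀ y ∈ Ω ∩ Metric.ball z₀ r, ∀ z ∈ Metric.ball p q, y + z ∈ Ω)
    (hu : MemForm Ω (kNear 0) u) (hu0 : ∀ x ∉ Metric.ball z₀ r, u x = 0) :
    IsLipschitzLimit Ω u := by
  -- replace `u` by a Borel representative with the same support property
  set S := Ω ∩ Metric.ball z₀ r with hS
  have hSm : MeasurableSet S := (hΩo.inter Metric.isOpen_ball).measurableSet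
  set v : Eu N → ℝ := S.indicator (hu.aemeasurable.mk u) with hv
  have hvm : Measurable v := hu.aemeasurable.measurable_mk.indicator hSm
  have hv0 : ∀ x ∉ S, v x = 0 := fun x hx => indicator_of_notMem hx _
  have huv : u =ᵐ[volume] v := by
    filter_upwards [hu.aemeasurable.ae_eq_mk] with x hx
    by_cases hxS : x ∈ S
    · rw [hv, indicator_of_mem hxS, hx]
    · rw [hv0 x hxS]
      by_cases hxΩ : x ∈ Ω
      · exact hu0 x fun h => hxS ⟨hxΩ, h⟩
      · exact hu.eq_zero x hxΩ
  refine IsLipschitzLimit.congr_ae ?_ huv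
  have hvF : MemForm Ω (kNear 0) v := hu.congr_ae huv fun x hx => hv0 x fun h => hx h.1
  have hv2 := hvF.memLp hN hΩ
  have hvi := integrable_of_memLp hΩ hv2 hvF.eq_zero
  intro ε hε
  obtain ⟨τ, hτ, hτε⟩ := exists_energyNormSq_translate_sub_le hN hvF hv2 hε
  obtain ⟨p, q, hq, hpq, hmap⟩ := htrans τ hτ
  obtain ⟨ρ, K, hρK, hρ0, hρsupp, hρ2, hρi, hρ1⟩ := exists_lipschitz_density p hq
  set P : Measure (Eu N) := volume.withDensity fun z => ENNReal.ofReal (ρ z) with hP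
  have hρm : Measurable fun z => ENNReal.ofReal (ρ z) :=
    hρK.continuous.measurable.ennreal_ofReal
  have hprob : IsProbabilityMeasure P := ⟨by
    rw [hP, withDensity_apply _ MeasurableSet.univ, Measure.restrict_univ,
      ← ofReal_integral_eq_lintegral_ofReal hρi (ae_of_all _ hρ0), hρ1, ENNReal.ofReal_one]⟩
  have hint : ∀ x, Integrable (fun z => v (x - z)) P := by
    intro x
    rw [hP, integrable_withDensity_iff_integrable_smul' hρm (ae_of_all _ fun z =>
      ENNReal.ofReal_lt_top)]
    simp only [ENNReal.toReal_ofReal (hρ0 _), smul_eq_mul]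
    exact integrable_mul_of_memLp hρ2
      (hv2.comp_measurePreserving (Measure.measurePreserving_sub_left volume x))
  have hconv : ∀ x, ∫ z, v (x - z) ∂P = ∫ z, ρ z * v (x - z) := by
    intro x
    rw [hP, integral_withDensity_eq_integral_toReal_smul hρm (ae_of_all _ fun z =>
      ENNReal.ofReal_lt_top)]
    simp only [ENNReal.toReal_ofReal (hρ0 _), smul_eq_mul]
  have hPae : ∀ᵐ z ∂P, energyNormSq (fun x => v (x - z) - v x) ≤ ε := by
    rw [hP, ae_withDensity_iff hρm]
    refine ae_of_all _ fun z hz => hτε z ?_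
    have hzb : z ∈ Metric.ball p q := by
      by_contra hcon
      exact hz (by rw [hρsupp z hcon, ENNReal.ofReal_zero])
    exact mem_ball_zero_iff.1 (hpq hzb)
  refine ⟨fun x => ∫ z, v (x - z) ∂P, ⟨K * (∫ x, |v x|).toNNReal, ?_⟩, fun x hx => ?_, ?_⟩
  · have hflip : ∀ x, ∫ z, v (x - z) ∂P = ∫ y, ρ (x - y) * v y := by
      intro x
      rw [hconv, ← integral_sub_left_eq_self _ volume x]
      simp
    have hρint : ∀ x, Integrable fun y => ρ (x - y) * v y := fun x =>
      integrable_mul_of_memLp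
        (hρ2.comp_measurePreserving (Measure.measurePreserving_sub_left volume x)) hv2
    refine LipschitzWith.of_dist_le_mul fun x y => ?_
    rw [Real.dist_eq, hflip, hflip, ← integral_sub (hρint x) (hρint y)]
    have hbound := norm_integral_le_of_norm_le (hvi.abs.const_mul (K * dist x y))
      (f := fun w => ρ (x - w) * v w - ρ (y - w) * v w) (ae_of_all _ fun w => by
        rw [← sub_mul, norm_mul]
        have := hρK.dist_le_mul (x - w) (y - w)
        rw [dist_sub_right] at this
        exact mul_le_mul_of_nonneg_right this (norm_nonneg _))
    rw [integral_const_mul] at hbound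
    rw [NNReal.coe_mul, Real.coe_toNNReal _ (integral_nonneg fun x => abs_nonneg _)]
    rw [Real.norm_eq_abs] at hbound
    linarith
  · simp only [hconv]
    refine integral_eq_zero_of_ae (ae_of_all _ fun z => ?_)
    by_cases hz : z ∈ Metric.ball p q
    · have : v (x - z) = 0 := hv0 _ fun h => hx (by
        have := hmap _ h z hz
        rwa [sub_add_cancel] at this)
      simp [this]
    · simp [hρsupp z hz]
  · rw [energyNormSq_sub_comm]
    exact energyNormSq_average_sub_le hvF hvm hv2 hint hε.le hPae

/-- A Lipschitz cutoff equal to one on `ball z (r / 2)` and vanishing outside `ball z r`. -/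
lemma exists_lipschitz_cutoff (z : Eu N) {r : ℝ} (hr : 0 < r) :
    ∃ (χ : Eu N → ℝ) (K : NNReal), LipschitzWith K χ ∧ (∀ x, 0 ≤ χ x) ∧ (∀ x, χ x ≤ 1) ∧
      (∀ x ∈ Metric.ball z (r / 2), χ x = 1) ∧ ∀ x ∉ Metric.ball z r, χ x = 0 := by
  have h1 : LipschitzWith (0 + ⟨2 / r, by positivity⟩ * 1)
      fun x : Eu N => 2 - (2 / r) * dist x z :=
    (LipschitzWith.const 2).sub
      ((LipschitzWith.of_dist_le_mul (K := ⟨2 / r, by positivity⟩)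
        (f := fun t : ℝ => 2 / r * t) fun a b => by
          rw [Real.dist_eq, ← mul_sub, abs_mul, abs_of_pos (by positivity : 0 < 2 / r)]
          rfl).comp (LipschitzWith.dist_left z))
  refine ⟨fun x => max (min (2 - (2 / r) * dist x z) 1) 0, _, (h1.min_const 1).max_const 0,
    fun x => le_max_right _ _, fun x => max_le (min_le_right _ _) zero_le_one, fun x hx => ?_,
    fun x hx => ?_⟩
  · have h2 : 2 / r * dist x z ≤ 1 := by
      rw [Metric.mem_ball] at hx
      rw [div_mul_eq_mul_div, div_le_one hr]
      linarith
    have h3 : 1 ≤ 2 - 2 / r * dist x z := by linarith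
    simp only [min_eq_right h3]
    exact max_eq_left zero_le_one
  · have h2 : 2 ≤ 2 / r * dist x z := by
      rw [Metric.mem_ball, not_lt] at hx
      rw [div_mul_eq_mul_div, le_div_iff₀ hr]
      linarith
    exact max_eq_right ((min_le_left _ _).trans (by linarith))

/-- **Density.** On a bounded Lipschitz domain, Lipschitz functions vanishing outside the domain are
dense in the logarithmic energy space. -/
theorem IsBoundedLipschitzDomain.isLipschitzLimit (hN : 1 ≤ N) (hΩ : IsBoundedLipschitzDomain Ω)
    (hu : MemForm Ω (kNear 0) u) : IsLipschitzLimit Ω u := by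
  have hex : ∀ z₀ : Eu N, ∃ r > 0, z₀ ∈ closure Ω → ∀ τ > 0, ∃ (p : Eu N) (q : ℝ), 0 < q ∧
      Metric.ball p q ⊆ Metric.ball 0 τ ∧
      ∀ y ∈ Ω ∩ Metric.ball z₀ r, ∀ z ∈ Metric.ball p q, y + z ∈ Ω := by
    intro z₀
    by_cases h : z₀ ∈ closure Ω
    · obtain ⟨r, hr, hr'⟩ := hΩ.exists_translations h
      exact ⟨r, hr, fun _ => hr'⟩
    · exact ⟨1, one_pos, fun h' => absurd h' h⟩
  choose r hr hr' using hex
  -- peel off one ball of a finite cover at a time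
  have key : ∀ t : Finset (Eu N), (∀ z ∈ t, z ∈ closure Ω) → ∀ u, MemForm Ω (kNear 0) u →
      (∀ x, (∀ z ∈ t, x ∉ Metric.ball z (r z / 2)) → u x = 0) → IsLipschitzLimit Ω u := by
    classical
    intro t
    induction t using Finset.induction_on with
    | empty =>
      intro _ u hu hu0 ε hε
      refine ⟨0, ⟨0, LipschitzWith.const 0⟩, fun x _ => rfl, ?_⟩
      have : u = 0 := funext fun x => hu0 x (by simp)
      simp [this, energyNormSq, gagliardo, hε.le]
    | insert a t ha ih =>
      intro hcl u hu hu0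
      obtain ⟨χ, K, hχK, hχ0, hχ1, hχin, hχout⟩ := exists_lipschitz_cutoff a (hr a)
      have hK' : LipschitzWith K fun x => 1 - χ x := by
        have := (LipschitzWith.const (1 : ℝ)).sub hχK
        simpa using this
      have hu1 := hu.lipschitz_mul hN hΩ.isBounded hχK hχ0 hχ1
      have hu2 := hu.lipschitz_mul hN hΩ.isBounded hK' (fun x => sub_nonneg.2 (hχ1 x))
        (fun x => sub_le_self _ (hχ0 x))
      have h1 := IsLipschitzLimit.of_localized hN hΩ.isBounded hΩ.isOpen
        (hr' a (hcl a (Finset.mem_insert_self a t))) hu1 fun x hx => by simp [hχout x hx]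
      have h2 := ih (fun z hz => hcl z (Finset.mem_insert_of_mem hz)) _ hu2 fun x hx => by
        by_cases hxa : x ∈ Metric.ball a (r a / 2)
        · simp [hχin x hxa]
        · rw [hu0 x fun z hz => ?_, mul_zero]
          rcases Finset.mem_insert.1 hz with rfl | hz
          · exact hxa
          · exact hx z hz
      have e : u = fun x => χ x * u x + (1 - χ x) * u x := by
        ext x
        ring
      rw [e]
      exact h1.add hN hΩ.isBounded hu1 hu2 h2
  obtain ⟨t, ht, hcov⟩ := hΩ.isBounded.isCompact_closure.elim_nhds_subcover
    (fun z => Metric.ball z (r z / 2)) fun z _ => Metric.ball_mem_nhds z (half_pos (hr z))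
  refine key t ht u hu fun x hx => hu.eq_zero x fun hxΩ => ?_
  obtain ⟨z, hz, hxz⟩ := mem_iUnion₂.1 (hcov (subset_closure hxΩ))
  exact hx z hz hxz

end Density

/-! ### Normalization constants -/

/-- `c_{N,s} / s`, which is continuous up to `s = 0`. -/
noncomputable def aFrac (N : ℕ) (s : ℝ) : ℝ :=
  (2 : ℝ) ^ (2 * s) * Real.pi ^ (-(N : ℝ) / 2) *
    (Real.Gamma (((N : ℝ) + 2 * s) / 2) / Real.Gamma (1 - s))

/-- The coefficient of `∫ u w` produced by the tail of the kernel of `(-Δ)^s`. -/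
noncomputable def dFrac (N : ℕ) (s : ℝ) : ℝ :=
  aFrac N s * (N * volume.real (Metric.ball (0 : Eu N) 1) / 2)

section Constants

variable {N : ℕ}

lemma cFrac_eq (N : ℕ) (s : ℝ) : cFrac N s = s * aFrac N s := by
  unfold cFrac aFrac
  ring

lemma aFrac_zero (N : ℕ) : aFrac N 0 = cLog N := by
  simp [aFrac, cLog]

lemma aFrac_pos (hN : 1 ≤ N) {s : ℝ} (hs0 : 0 ≤ s) (hs1 : s < 1) : 0 < aFrac N s := by
  have hN' : (1 : ℝ) ≤ N := by exact_mod_cast hN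
  unfold aFrac
  have h1 := Real.Gamma_pos_of_pos (show 0 < ((N : ℝ) + 2 * s) / 2 by linarith)
  have h2 := Real.Gamma_pos_of_pos (show 0 < 1 - s by linarith)
  have h3 := Real.pi_pos
  positivity

lemma cLog_pos (hN : 1 ≤ N) : 0 < cLog N := by
  rw [← aFrac_zero]
  exact aFrac_pos hN le_rfl one_pos

lemma dFrac_eq (hN : 1 ≤ N) (s : ℝ) :
    dFrac N s = (2 : ℝ) ^ (2 * s) * (Real.Gamma ((N : ℝ) / 2 + s) * (Real.Gamma (1 - s))⁻¹)
      * (Real.Gamma ((N : ℝ) / 2))⁻¹ := by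
  have hN' : (0 : ℝ) < (N : ℝ) / 2 := by
    have : (1 : ℝ) ≤ N := by exact_mod_cast hN
    linarith
  have hne : Nonempty (Fin N) := ⟨⟨0, hN⟩⟩
  have hG := Real.Gamma_pos_of_pos hN'
  have hvol : volume.real (Metric.ball (0 : Eu N) 1)
      = Real.pi ^ ((N : ℝ) / 2) / ((N : ℝ) / 2 * Real.Gamma ((N : ℝ) / 2)) := by
    rw [Measure.real, EuclideanSpace.volume_ball, Fintype.card_fin, ENNReal.ofReal_one, one_pow,
      one_mul, Real.Gamma_add_one hN'.ne', ENNReal.toReal_ofReal (by positivity), Real.sqrt_eq_rpow,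
      ← Real.rpow_natCast, ← Real.rpow_mul Real.pi_pos.le]
    congr 2
    ring
  have hpi : Real.pi ^ (-(N : ℝ) / 2) * Real.pi ^ ((N : ℝ) / 2) = 1 := by
    rw [← Real.rpow_add Real.pi_pos, neg_div, neg_add_cancel, Real.rpow_zero]
  rw [dFrac, aFrac, hvol, show ((N : ℝ) + 2 * s) / 2 = (N : ℝ) / 2 + s by ring]
  have hN0 : (N : ℝ) ≠ 0 := by
    intro h
    rw [h] at hN'
    simp at hN'
  calc _ = (2 : ℝ) ^ (2 * s) * (Real.Gamma ((N : ℝ) / 2 + s) / Real.Gamma (1 - s))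
        * (Real.pi ^ (-(N : ℝ) / 2) * Real.pi ^ ((N : ℝ) / 2)) *
        (N / (2 * ((N : ℝ) / 2 * Real.Gamma ((N : ℝ) / 2)))) := by ring
    _ = _ := by
        rw [hpi]
        field_simp

lemma dFrac_zero (hN : 1 ≤ N) : dFrac N 0 = 1 := by
  have hG := Real.Gamma_pos_of_pos (show (0 : ℝ) < (N : ℝ) / 2 by
    have : (1 : ℝ) ≤ N := by exact_mod_cast hN
    linarith)
  rw [dFrac_eq hN]
  simp [hG.ne']

lemma differentiableAt_Gamma_of_pos {x : ℝ} (hx : 0 < x) : DifferentiableAt ℝ Real.Gamma x :=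
  Real.differentiableAt_Gamma fun m h => by
    have : (0 : ℝ) ≤ m := m.cast_nonneg
    linarith

/-- The derivative at `s = 0` of the tail coefficient is `ρ_N`. -/
lemma hasDerivAt_dFrac (hN : 1 ≤ N) : HasDerivAt (dFrac N) (rhoLog N) 0 := by
  have hN' : (0 : ℝ) < (N : ℝ) / 2 := by
    have : (1 : ℝ) ≤ N := by exact_mod_cast hN
    linarith
  have hG := Real.Gamma_pos_of_pos hN'
  rw [show dFrac N = _ from funext (dFrac_eq hN)]
  have h1 : HasDerivAt (fun s : ℝ => (2 : ℝ) ^ (2 * s)) (2 * Real.log 2) 0 := by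
    have := ((hasDerivAt_id (0 : ℝ)).const_mul 2).const_rpow (a := 2) two_pos
    simpa [mul_comm] using this
  have h2 : HasDerivAt (fun s : ℝ => Real.Gamma ((N : ℝ) / 2 + s))
      (deriv Real.Gamma ((N : ℝ) / 2)) 0 := by
    have h := (differentiableAt_Gamma_of_pos hN').hasDerivAt
    rw [← add_zero ((N : ℝ) / 2)] at h
    simpa using h.comp_const_add ((N : ℝ) / 2) 0
  have h3 : HasDerivAt (fun s : ℝ => Real.Gamma (1 - s)) Real.eulerMascheroniConstant 0 := by
    have h := Real.hasDerivAt_Gamma_one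
    rw [← sub_zero (1 : ℝ)] at h
    simpa using h.comp_const_sub 1 0
  have h4 := h3.inv (by simp)
  have h5 := ((h1.mul (h2.mul h4)).mul_const (Real.Gamma ((N : ℝ) / 2))⁻¹)
  refine h5.congr_deriv ?_
  simp [rhoLog]
  field_simp
  ring

lemma continuousAt_aFrac (hN : 1 ≤ N) : ContinuousAt (aFrac N) 0 := by
  have hN' : (0 : ℝ) < (N : ℝ) / 2 := by
    have : (1 : ℝ) ≤ N := by exact_mod_cast hN
    linarith
  have h1 : ContinuousAt (fun s : ℝ => Real.Gamma (((N : ℝ) + 2 * s) / 2)) 0 :=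
    ContinuousAt.comp (g := Real.Gamma)
      (differentiableAt_Gamma_of_pos (by simpa using hN')).continuousAt (by fun_prop)
  have h2 : ContinuousAt (fun s : ℝ => Real.Gamma (1 - s)) 0 :=
    ContinuousAt.comp (g := Real.Gamma) (differentiableAt_Gamma_of_pos (by simp)).continuousAt
      (by fun_prop)
  have h3 : ContinuousAt (fun s : ℝ => (2 : ℝ) ^ (2 * s)) 0 :=
    ContinuousAt.rpow (by fun_prop) (by fun_prop) (Or.inl two_ne_zero)
  exact (h3.mul continuousAt_const).mul (h1.div h2 (by simp))

/-- The zero-order coefficient `(d(s) - 1) / s` of the rescaled form of `(-Δ)^s`. -/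
noncomputable def bFrac (N : ℕ) (s : ℝ) : ℝ := (dFrac N s - 1) / s

lemma tendsto_bFrac (hN : 1 ≤ N) : Tendsto (bFrac N) (𝓝[>] 0) (𝓝 (rhoLog N)) := by
  have h := hasDerivAt_iff_tendsto_slope.1 (hasDerivAt_dFrac hN)
  refine (h.mono_left (nhdsWithin_mono 0 fun x (hx : 0 < x) => hx.ne')).congr fun s => ?_
  rw [slope_def_field, dFrac_zero hN, sub_zero, bFrac]

end Constants

/-! ### The forms of the two operators in terms of the kernels -/

/-- The singular part of the kernel of order `2s`, normalized so that `s = 0` gives the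
logarithmic Laplacian. -/
noncomputable def nearKernel {N : ℕ} (s : ℝ) (z : Eu N) : ℝ := aFrac N s / 2 * kNear s z

/-- The tail of the kernel of order `2s`, with the same normalization. -/
noncomputable def farKernel {N : ℕ} (s : ℝ) (z : Eu N) : ℝ := aFrac N s * kFar s z

section Translate

variable {N : ℕ} {Ω : Set (Eu N)} {s : ℝ} {u w : Eu N → ℝ}

lemma admissible_of_bounds (hN : 1 ≤ N) (hs : 0 ≤ s) {c C : ℝ} (hc : 0 < c)
    (hca : c ≤ aFrac N s / 2) (hC : aFrac N s ≤ C) :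
    Admissible c C (nearKernel s : Eu N → ℝ) (farKernel s) where
  pos := hc
  measurable_k := (measurable_kNear s).const_mul _
  le_k z := mul_le_mul hca (kNear_mono hN le_rfl hs z) (kNear_nonneg 0 z) (hc.le.trans hca)
  measurable_j := (measurable_kFar s).const_mul _
  j_nonneg z := mul_nonneg (by linarith) (kFar_nonneg s z)
  j_le z := (mul_le_of_le_one_right (by linarith) (kFar_le_one hs z)).trans hC
  j_neg z := by rw [farKernel, kFar_neg, farKernel]
  j_pos z hz := by
    refine mul_pos (by linarith) ?_
    rw [kFar_of_le hz]
    exact inv_pos.2 (Real.rpow_pos_of_pos (by linarith) _)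

lemma admissible_self (hN : 1 ≤ N) (hs : 0 ≤ s) (hs1 : s < 1) :
    Admissible (aFrac N s / 2) (aFrac N s) (nearKernel s : Eu N → ℝ) (farKernel s) :=
  admissible_of_bounds hN hs (half_pos (aFrac_pos hN hs hs1)) le_rfl le_rfl

lemma memForm_nearKernel_iff (hN : 1 ≤ N) (hs : 0 ≤ s) (hs1 : s < 1) :
    MemForm Ω (nearKernel s) u ↔ MemForm Ω (kNear s) u := by
  have ha := half_pos (aFrac_pos hN hs hs1)
  constructor
  · intro h
    exact h.mono ha (measurable_kNear s) (kNear_nonneg s) fun z => le_rfl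
  · intro h
    refine h.mono (inv_pos.2 ha) ((measurable_kNear s).const_mul _)
      (fun z => mul_nonneg ha.le (kNear_nonneg s z)) fun z => ?_
    rw [nearKernel, inv_mul_cancel_left₀ ha.ne']

lemma gagliardo_nearKernel (s : ℝ) (u w : Eu N → ℝ) :
    gagliardo (nearKernel s) u w = aFrac N s / 2 * gagliardo (kNear s) u w := by
  unfold gagliardo nearKernel
  rw [← integral_const_mul]
  congr 1 with p
  ring

lemma interaction_farKernel (s : ℝ) (u w : Eu N → ℝ) :
    interaction (farKernel s) u w = aFrac N s * interaction (kFar s) u w := by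
  unfold interaction farKernel
  rw [← integral_const_mul]
  congr 1 with p
  ring

lemma measurableSet_norm_sub_le : MeasurableSet {p : Eu N × Eu N | ‖p.1 - p.2‖ ≤ 1} :=
  measurableSet_le (by fun_prop) measurable_const

lemma measurableSet_le_norm_sub : MeasurableSet {p : Eu N × Eu N | 1 ≤ ‖p.1 - p.2‖} :=
  measurableSet_le measurable_const (by fun_prop)

lemma indicator_le_eq (f : Eu N × Eu N → ℝ) :
    {p : Eu N × Eu N | ‖p.1 - p.2‖ ≤ 1}.indicator (fun p => f p / ‖p.1 - p.2‖ ^ N)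
      = fun p => kNear 0 (p.1 - p.2) * f p := by
  ext p
  by_cases h : ‖p.1 - p.2‖ ≤ 1
  · rw [indicator_of_mem (show p ∈ {p : Eu N × Eu N | ‖p.1 - p.2‖ ≤ 1} from h), kNear_of_le h,
      mul_zero, add_zero, Real.rpow_natCast, div_eq_inv_mul]
  · rw [indicator_of_notMem (show p ∉ {p : Eu N × Eu N | ‖p.1 - p.2‖ ≤ 1} from h),
      kNear_of_lt (not_le.1 h), zero_mul]

lemma indicator_ge_eq (f : Eu N × Eu N → ℝ) :
    {p : Eu N × Eu N | 1 ≤ ‖p.1 - p.2‖}.indicator (fun p => f p / ‖p.1 - p.2‖ ^ N)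
      = fun p => kFar 0 (p.1 - p.2) * f p := by
  ext p
  by_cases h : 1 ≤ ‖p.1 - p.2‖
  · rw [indicator_of_mem (show p ∈ {p : Eu N × Eu N | 1 ≤ ‖p.1 - p.2‖} from h), kFar_of_le h,
      mul_zero, add_zero, Real.rpow_natCast, div_eq_inv_mul]
  · rw [indicator_of_notMem (show p ∉ {p : Eu N × Eu N | 1 ≤ ‖p.1 - p.2‖} from h),
      kFar_of_lt (not_le.1 h), zero_mul]

lemma logForm_eq (u w : Eu N → ℝ) :
    logForm u w = kernelForm (nearKernel 0) (farKernel 0) (rhoLog N) u w := by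
  rw [kernelForm, gagliardo_nearKernel, interaction_farKernel, aFrac_zero, logForm,
    ← integral_indicator measurableSet_norm_sub_le, ← integral_indicator measurableSet_le_norm_sub,
    indicator_le_eq fun p : Eu N × Eu N => (u p.1 - u p.2) * (w p.1 - w p.2),
    indicator_ge_eq fun p : Eu N × Eu N => u p.1 * w p.2]
  rfl

lemma memLogSpace_iff (hN : 1 ≤ N) : MemLogSpace Ω u ↔ MemForm Ω (nearKernel 0) u := by
  rw [memForm_nearKernel_iff hN le_rfl one_pos]
  have e := indicator_le_eq fun p : Eu N × Eu N => (u p.1 - u p.2) ^ 2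
  have hiff : IntegrableOn (fun p : Eu N × Eu N => (u p.1 - u p.2) ^ 2 / ‖p.1 - p.2‖ ^ N)
      {p | ‖p.1 - p.2‖ ≤ 1} volume ↔ Integrable (fun p : Eu N × Eu N =>
        kNear 0 (p.1 - p.2) * ((u p.1 - u p.2) * (u p.1 - u p.2))) := by
    rw [← integrable_indicator_iff measurableSet_norm_sub_le, e]
    simp only [sq]
  exact ⟨fun h => ⟨h.1, h.2, hiff.1 h.3⟩, fun h => ⟨h.1, h.2, hiff.2 h.3⟩⟩

lemma ae_kernel_split (hN : 1 ≤ N) (s : ℝ) :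
    ∀ᵐ p : Eu N × Eu N, (‖p.1 - p.2‖ ^ ((N : ℝ) + 2 * s))⁻¹
      = kNear s (p.1 - p.2) + kFar s (p.1 - p.2) := by
  have := nontrivial_eu hN
  have h0 : ∀ᵐ z : Eu N, ‖z‖ ≠ 1 := by
    rw [ae_iff]
    have e : {z : Eu N | ¬‖z‖ ≠ 1} = Metric.sphere 0 1 := by
      ext z
      simp
    rw [e, Measure.addHaar_sphere]
  have h1 := (quasiMeasurePreserving_sub_of_right_invariant (volume : Measure (Eu N))
    (volume : Measure (Eu N))).ae h0
  filter_upwards [h1] with p hp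
  rcases lt_or_gt_of_ne hp with h | h
  · rw [kNear_of_le h.le, kFar_of_lt h, add_zero]
  · rw [kNear_of_lt h, kFar_of_le h.le, zero_add]

lemma memFracSpace_iff (hN : 1 ≤ N) (hΩ : Bornology.IsBounded Ω) (hs : 0 < s) (hs1 : s < 1) :
    MemFracSpace Ω s u ↔ MemForm Ω (nearKernel s) u := by
  constructor
  · intro h
    rw [memForm_nearKernel_iff hN hs.le hs1]
    refine ⟨h.memLp.aemeasurable, h.eq_zero, h.finite_energy.mono'
      (aestronglyMeasurable_gagliardo (measurable_kNear s) h.memLp.aemeasurable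
        h.memLp.aemeasurable) ?_⟩
    filter_upwards [ae_kernel_split hN s] with p hp
    rw [Real.norm_eq_abs, abs_of_nonneg (mul_nonneg (kNear_nonneg s _) (mul_self_nonneg _)),
      div_eq_inv_mul, hp, sq]
    exact mul_le_mul_of_nonneg_right (le_add_of_nonneg_right (kFar_nonneg s _))
      (mul_self_nonneg _)
  · intro h
    have hm := (admissible_self hN hs.le hs1).memLp hN hΩ h
    rw [memForm_nearKernel_iff hN hs.le hs1] at h
    refine ⟨hm, h.eq_zero, (h.integrable.add (integrable_gagliardo_of_memLp (integrable_kFar hN hs)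
      (measurable_kFar s) (kFar_neg s) hm hm)).congr ?_⟩
    filter_upwards [ae_kernel_split hN s] with p hp
    rw [div_eq_inv_mul, hp, Pi.add_apply]
    ring

/-- The form of `(-Δ)^s` is the `L²` inner product plus `s` times a form of the same shape as that
of the logarithmic Laplacian. -/
lemma fracForm_eq (hN : 1 ≤ N) (hΩ : Bornology.IsBounded Ω) (hs : 0 < s) (hs1 : s < 1)
    (hu : MemForm Ω (nearKernel s) u) (hw : MemForm Ω (nearKernel s) w) :
    fracForm s u w = (∫ x, u x * w x)
      + s * kernelForm (nearKernel s) (farKernel s) (bFrac N s) u w := by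
  have hadm := admissible_self (N := N) hN hs.le hs1
  have hum := hadm.memLp hN hΩ hu
  have hwm := hadm.memLp hN hΩ hw
  rw [memForm_nearKernel_iff hN hs.le hs1] at hu hw
  have hkf := integrable_kFar (N := N) hN hs
  have h1 : ∫ p : Eu N × Eu N, (u p.1 - u p.2) * (w p.1 - w p.2) / ‖p.1 - p.2‖ ^ ((N : ℝ) + 2 * s)
      = gagliardo (kNear s) u w + gagliardo (kFar s) u w := by
    unfold gagliardo
    rw [← integral_add (hu.integrable_mul (measurable_kNear s) (kNear_nonneg s) hw)
      (integrable_gagliardo_of_memLp hkf (measurable_kFar s) (kFar_neg s) hum hwm)]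
    refine integral_congr_ae ?_
    filter_upwards [ae_kernel_split hN s] with p hp
    rw [div_eq_inv_mul, hp]
    ring
  rw [fracForm, h1, gagliardo_eq_of_integrable hkf (measurable_kFar s) (kFar_neg s) hum hwm,
    integral_kFar hN hs, kernelForm, gagliardo_nearKernel, interaction_farKernel, cFrac_eq, bFrac,
    dFrac]
  field_simp
  ring

end Translate

/-! ### First eigenvalues of the logarithmic and of the fractional Laplacian -/

section Spectral

variable {N : ℕ} {Ω : Set (Eu N)} {s lam : ℝ} {u : Eu N → ℝ}

/-- A nonzero Lipschitz function vanishing outside a nonempty open set. -/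
lemma exists_lipschitz_ne_zero (hΩo : IsOpen Ω) (hne : Ω.Nonempty) :
    ∃ (φ : Eu N → ℝ) (K : NNReal), LipschitzWith K φ ∧ (∀ x ∉ Ω, φ x = 0) ∧
      ¬ φ =ᵐ[volume] 0 := by
  obtain ⟨x, hx⟩ := hne
  obtain ⟨r, hr, hball⟩ := Metric.isOpen_iff.1 hΩo x hx
  obtain ⟨χ, K, hχ, -, -, hχ1, hχ0⟩ := exists_lipschitz_cutoff x hr
  refine ⟨χ, K, hχ, fun y hy => hχ0 y fun h => hy (hball h), fun h => ?_⟩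
  have h1 := (Continuous.ae_eq_iff_eq volume hχ.continuous continuous_const).1 h
  have h2 := hχ1 x (Metric.mem_ball_self (half_pos hr))
  rw [h1] at h2
  exact zero_ne_one h2

/-- The bottom of the spectrum of an admissible form is attained at a nonnegative normalized
eigenfunction. -/
lemma exists_first_eigenpair {c C b : ℝ} {k j : Eu N → ℝ} (h : Admissible c C k j) (hN : 1 ≤ N)
    (hΩ : Bornology.IsBounded Ω) (hΩm : MeasurableSet Ω)
    (hne : ∃ w, MemForm Ω k w ∧ ¬ w =ᵐ[volume] 0) :
    ∃ lam, IsRayleighBound Ω k j b lam ∧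
      ∃ u, IsWeakEigen Ω k j b lam u ∧ (∀ x, 0 ≤ u x) ∧ ∫ x, u x * u x = 1 := by
  obtain ⟨lam, hb, u, hu, hu1, huq⟩ := exists_minimizer (b := b) h hN hΩ hΩm hne
  have habs := hu.abs h.measurable_k h.k_nonneg
  have hn : ∫ x, |u x| * |u x| = 1 := by simpa only [abs_mul_abs_self] using hu1
  refine ⟨lam, hb, _, hb.isWeakEigen h hN hΩ habs ?_, fun x => abs_nonneg (u x), hn⟩
  refine le_antisymm ((kernelForm_abs_le h hN hΩ hu).trans ?_) (hb _ habs)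
  rw [hn, huq, mul_one]

lemma not_ae_eq_zero_of_integral (hu : ∫ x, u x * u x = 1) : ¬ u =ᵐ[volume] 0 := by
  intro h
  have : ∫ x, u x * u x = 0 := integral_eq_zero_of_ae (h.mono fun x hx => by simp [hx])
  linarith

lemma setIntegral_mul_eq {w : Eu N → ℝ} (hu : ∀ x ∉ Ω, u x = 0) :
    ∫ x in Ω, u x * w x = ∫ x, u x * w x :=
  setIntegral_eq_integral_of_forall_compl_eq_zero fun x hx => by simp [hu x hx]

lemma isWeakLogSolution_iff (hN : 1 ≤ N) :
    IsWeakLogSolution Ω lam u ↔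
      IsWeakEigen Ω (nearKernel 0) (farKernel 0) (rhoLog N) lam u := by
  unfold IsWeakLogSolution IsWeakEigen
  simp only [memLogSpace_iff hN, logForm_eq]
  refine and_congr_right fun hu => forall₂_congr fun φ _ => ?_
  rw [setIntegral_mul_eq hu.eq_zero]

lemma isWeakFracSolution_iff (hN : 1 ≤ N) (hΩ : Bornology.IsBounded Ω) (hs : 0 < s)
    (hs1 : s < 1) :
    IsWeakFracSolution Ω s lam u ↔
      IsWeakEigen Ω (nearKernel s) (farKernel s) (bFrac N s) ((lam - 1) / s) u := by
  unfold IsWeakFracSolution IsWeakEigen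
  simp only [memFracSpace_iff hN hΩ hs hs1]
  refine and_congr_right fun hu => forall₂_congr fun φ hφ => ?_
  rw [setIntegral_mul_eq hu.eq_zero, fracForm_eq hN hΩ hs hs1 hu hφ]
  constructor
  · intro h
    rw [div_mul_eq_mul_div, eq_div_iff hs.ne']
    linarith
  · intro h
    rw [h]
    field_simp
    ring

lemma integral_sq_eq (hu : ∀ x ∉ Ω, u x = 0) : ∫ x in Ω, u x ^ 2 = ∫ x, u x * u x := by
  rw [← setIntegral_mul_eq hu]
  simp only [sq]

/-- The first eigenvalue of the logarithmic Laplacian is attained, and it is the bottom of the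
Rayleigh quotient. -/
lemma firstLogEigenvalue_spec (hN : 1 ≤ N) (hΩ : IsBoundedLipschitzDomain Ω) :
    IsLeast (logEigenvalues Ω) (firstLogEigenvalue Ω) ∧
      IsRayleighBound Ω (nearKernel 0) (farKernel 0) (rhoLog N) (firstLogEigenvalue Ω) ∧
      ∃ ξ, IsFirstLogEigenfunction Ω ξ := by
  have hadm := admissible_self (N := N) hN le_rfl one_pos
  obtain ⟨φ, K, hφ, hφ0, hφne⟩ := exists_lipschitz_ne_zero hΩ.isOpen hΩ.isConnected.nonempty
  obtain ⟨lam, hb, u, hu, hu0, hu1⟩ := exists_first_eigenpair (b := rhoLog N) hadm hN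
    hΩ.isBounded hΩ.isOpen.measurableSet ⟨φ, (memForm_nearKernel_iff hN le_rfl one_pos).2
      (memForm_of_lipschitz hN hΩ.isBounded one_pos hφ hφ0), hφne⟩
  have hleast : IsLeast (logEigenvalues Ω) lam := by
    refine ⟨⟨u, not_ae_eq_zero_of_integral hu1, (isWeakLogSolution_iff hN).2 hu⟩, ?_⟩
    rintro μ ⟨w, hw, hwe⟩
    exact hb.le_of_isWeakEigen hadm hN hΩ.isBounded ((isWeakLogSolution_iff hN).1 hwe) hw
  have heq : firstLogEigenvalue Ω = lam := hleast.csInf_eq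
  rw [heq]
  refine ⟨hleast, hb, u, ?_, ae_of_all _ hu0, ?_⟩
  · rw [heq]
    exact (isWeakLogSolution_iff hN).2 hu
  · rw [integral_sq_eq hu.1.eq_zero, hu1]

/-- The first eigenvalue of the fractional Laplacian is attained, and its rescaling is the bottom of
the Rayleigh quotient of the rescaled form. -/
lemma firstFracEigenvalue_spec (hN : 1 ≤ N) (hΩ : IsBoundedLipschitzDomain Ω) (hs : 0 < s)
    (hs1 : s < 1) :
    IsLeast (fracEigenvalues Ω s) (firstFracEigenvalue Ω s) ∧
      IsRayleighBound Ω (nearKernel s) (farKernel s) (bFrac N s)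
        ((firstFracEigenvalue Ω s - 1) / s) ∧
      ∃ v, IsFirstFracEigenfunction Ω s v := by
  have hadm := admissible_self (N := N) hN hs.le hs1
  obtain ⟨φ, K, hφ, hφ0, hφne⟩ := exists_lipschitz_ne_zero hΩ.isOpen hΩ.isConnected.nonempty
  obtain ⟨lam, hb, u, hu, hu0, hu1⟩ := exists_first_eigenpair (b := bFrac N s) hadm hN
    hΩ.isBounded hΩ.isOpen.measurableSet ⟨φ, (memForm_nearKernel_iff hN hs.le hs1).2
      (memForm_of_lipschitz hN hΩ.isBounded hs1 hφ hφ0), hφne⟩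
  have e : (1 + s * lam - 1) / s = lam := by
    field_simp
    ring
  have hu' : IsWeakFracSolution Ω s (1 + s * lam) u := by
    rw [isWeakFracSolution_iff hN hΩ.isBounded hs hs1, e]
    exact hu
  have hleast : IsLeast (fracEigenvalues Ω s) (1 + s * lam) := by
    refine ⟨⟨u, not_ae_eq_zero_of_integral hu1, hu'⟩, ?_⟩
    rintro μ ⟨w, hw, hwe⟩
    have := hb.le_of_isWeakEigen hadm hN hΩ.isBounded
      ((isWeakFracSolution_iff hN hΩ.isBounded hs hs1).1 hwe) hw
    rw [le_div_iff₀ hs] at this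
    linarith
  have heq : firstFracEigenvalue Ω s = 1 + s * lam := hleast.csInf_eq
  refine ⟨heq ▸ hleast, ?_, u, ?_, ae_of_all _ hu0, ?_⟩
  · rw [heq, e]
    exact hb
  · rw [heq]
    exact hu'
  · rw [integral_sq_eq hu.1.eq_zero, hu1]

lemma IsFirstLogEigenfunction.isWeakEigen (hN : 1 ≤ N) (hu : IsFirstLogEigenfunction Ω u) :
    IsWeakEigen Ω (nearKernel 0) (farKernel 0) (rhoLog N) (firstLogEigenvalue Ω) u ∧
      ∫ x, u x * u x = 1 :=
  ⟨(isWeakLogSolution_iff hN).1 hu.weak_solution, by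
    rw [← integral_sq_eq hu.weak_solution.1.eq_zero, hu.normalized]⟩

lemma IsFirstFracEigenfunction.isWeakEigen (hN : 1 ≤ N) (hΩ : Bornology.IsBounded Ω)
    (hs : 0 < s) (hs1 : s < 1) (hu : IsFirstFracEigenfunction Ω s u) :
    IsWeakEigen Ω (nearKernel s) (farKernel s) (bFrac N s)
      ((firstFracEigenvalue Ω s - 1) / s) u ∧ ∫ x, u x * u x = 1 :=
  ⟨(isWeakFracSolution_iff hN hΩ hs hs1).1 hu.weak_solution, by
    rw [← integral_sq_eq hu.weak_solution.1.eq_zero, hu.normalized]⟩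

lemma IsFirstLogEigenfunction.ae_eq (hN : 1 ≤ N) (hΩ : IsBoundedLipschitzDomain Ω)
    {v : Eu N → ℝ} (hu : IsFirstLogEigenfunction Ω u) (hv : IsFirstLogEigenfunction Ω v) :
    u =ᵐ[volume] v :=
  (firstLogEigenvalue_spec hN hΩ).2.1.ae_eq (admissible_self hN le_rfl one_pos) hN hΩ.isBounded
    (hu.isWeakEigen hN).1 (hv.isWeakEigen hN).1 hu.nonneg hv.nonneg (hu.isWeakEigen hN).2
    (hv.isWeakEigen hN).2

lemma IsFirstFracEigenfunction.ae_eq (hN : 1 ≤ N) (hΩ : IsBoundedLipschitzDomain Ω) (hs : 0 < s)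
    (hs1 : s < 1) {v : Eu N → ℝ} (hu : IsFirstFracEigenfunction Ω s u)
    (hv : IsFirstFracEigenfunction Ω s v) : u =ᵐ[volume] v :=
  (firstFracEigenvalue_spec hN hΩ hs hs1).2.1.ae_eq (admissible_self hN hs.le hs1) hN hΩ.isBounded
    (hu.isWeakEigen hN hΩ.isBounded hs hs1).1 (hv.isWeakEigen hN hΩ.isBounded hs hs1).1
    hu.nonneg hv.nonneg (hu.isWeakEigen hN hΩ.isBounded hs hs1).2
    (hv.isWeakEigen hN hΩ.isBounded hs hs1).2

end Spectral

/-! ### The limit of vanishing order -/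

section Limit

variable {N : ℕ} {Ω : Set (Eu N)} {lam : ℝ} {u ξ : Eu N → ℝ}

/-- For small `s` the rescaled kernels are admissible with constants independent of `s`. -/
lemma eventually_admissible (hN : 1 ≤ N) :
    ∀ᶠ s in 𝓝[>] (0 : ℝ), s ∈ Ioo (0 : ℝ) 1 ∧
      Admissible (cLog N / 4) (2 * cLog N) (nearKernel s : Eu N → ℝ) (farKernel s) := by
  have hc := cLog_pos hN
  have h1 : Tendsto (aFrac N) (𝓝[>] 0) (𝓝 (cLog N)) := by
    rw [← aFrac_zero]
    exact (continuousAt_aFrac hN).tendsto.mono_left nhdsWithin_le_nhds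
  filter_upwards [h1.eventually (lt_mem_nhds (show cLog N / 2 < cLog N by linarith)),
    h1.eventually (gt_mem_nhds (show cLog N < 2 * cLog N by linarith)),
    Ioo_mem_nhdsGT one_pos] with s h2 h3 h4
  exact ⟨h4, admissible_of_bounds hN h4.1.le (by linarith) (by linarith) h3.le⟩

lemma tendsto_nearKernel (hN : 1 ≤ N) {ι : Type*} {l : Filter ι} {s : ι → ℝ}
    (hs : Tendsto s l (𝓝 0)) (z : Eu N) :
    Tendsto (fun i => nearKernel (s i) z) l (𝓝 (nearKernel 0 z)) :=
  (((continuousAt_aFrac hN).tendsto.comp hs).div_const 2).mul (tendsto_kNear hN le_rfl hs z)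

lemma tendsto_farKernel (hN : 1 ≤ N) {ι : Type*} {l : Filter ι} {s : ι → ℝ}
    (hs : Tendsto s l (𝓝 0)) (z : Eu N) :
    Tendsto (fun i => farKernel (s i) z) l (𝓝 (farKernel 0 z)) :=
  ((continuousAt_aFrac hN).tendsto.comp hs).mul (tendsto_kFar hN le_rfl hs z)

/-- On Lipschitz functions the rescaled forms of `(-Δ)^s` converge to that of the logarithmic
Laplacian. -/
lemma tendsto_kernelForm_of_lipschitz (hN : 1 ≤ N) (hΩ : Bornology.IsBounded Ω) {φ : Eu N → ℝ}
    {K : NNReal} (hφ : LipschitzWith K φ) (hφ0 : ∀ x ∉ Ω, φ x = 0) :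
    Tendsto (fun s => kernelForm (nearKernel s) (farKernel s) (bFrac N s) φ φ) (𝓝[>] 0)
      (𝓝 (kernelForm (nearKernel 0) (farKernel 0) (rhoLog N) φ φ)) := by
  have hid : Tendsto (fun s : ℝ => s) (𝓝[>] 0) (𝓝 0) := tendsto_id.mono_left nhdsWithin_le_nhds
  have hhalf := memForm_of_lipschitz hN hΩ (show (1 / 2 : ℝ) < 1 by norm_num) hφ hφ0
  have hφi : Integrable φ := integrable_of_memLp hΩ
    ((memForm_of_lipschitz hN hΩ one_pos hφ hφ0).memLp hN hΩ) hφ0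
  have h1 : Tendsto (fun s => gagliardo (kNear s) φ φ) (𝓝[>] 0) (𝓝 (gagliardo (kNear 0) φ φ)) := by
    refine tendsto_integral_filter_of_dominated_convergence _ (Eventually.of_forall fun s =>
      aestronglyMeasurable_gagliardo (measurable_kNear s) hφi.aemeasurable hφi.aemeasurable) ?_
      hhalf.integrable (ae_of_all _ fun p => (tendsto_kNear hN le_rfl hid _).mul_const _)
    filter_upwards [Ioo_mem_nhdsGT (show (0 : ℝ) < 1 / 2 by norm_num)] with s hs
    refine ae_of_all _ fun p => ?_
    rw [Real.norm_eq_abs, abs_of_nonneg (mul_nonneg (kNear_nonneg s _) (mul_self_nonneg _))]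
    exact mul_le_mul_of_nonneg_right (kNear_mono hN hs.1.le hs.2.le _) (mul_self_nonneg _)
  have h2 : Tendsto (fun s => gagliardo (nearKernel s) φ φ) (𝓝[>] 0)
      (𝓝 (gagliardo (nearKernel 0) φ φ)) := by
    simp only [gagliardo_nearKernel]
    exact (((continuousAt_aFrac hN).tendsto.comp hid).div_const 2).mul h1
  have h3 : Tendsto (fun s => interaction (farKernel s) φ φ) (𝓝[>] 0)
      (𝓝 (interaction (farKernel 0) φ φ)) :=
    tendsto_interaction_kernel (C := 2 * cLog N) (fun s => (measurable_kFar s).const_mul _)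
      ((eventually_admissible hN).mono fun s hs => hs.2.abs_j_le)
      (fun z => tendsto_farKernel hN hid z) hφi hφi
  exact (h2.sub h3).add ((tendsto_bFrac hN).mul_const _)

/-- Almost optimal Lipschitz competitors for the Rayleigh quotient of the logarithmic Laplacian. -/
lemma exists_lipschitz_kernelForm_lt (hN : 1 ≤ N) (hΩ : IsBoundedLipschitzDomain Ω)
    (hξ : IsWeakEigen Ω (nearKernel 0) (farKernel 0) (rhoLog N) lam ξ)
    (hξ1 : ∫ x, ξ x * ξ x = 1) {ε : ℝ} (hε : 0 < ε) :
    ∃ (φ : Eu N → ℝ) (K : NNReal), LipschitzWith K φ ∧ (∀ x ∉ Ω, φ x = 0) ∧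
      0 < ∫ x, φ x * φ x ∧
      kernelForm (nearKernel 0) (farKernel 0) (rhoLog N) φ φ < (lam + ε) * ∫ x, φ x * φ x := by
  have hadm := admissible_self (N := N) hN le_rfl one_pos
  have hξF := (memForm_nearKernel_iff hN le_rfl one_pos).1 hξ.1
  have hξ2 := hξF.memLp hN hΩ.isBounded
  set a := aFrac N 0 with ha
  have ha0 : 0 < a := aFrac_pos hN le_rfl one_pos
  set V := volume.real (closure Ω) with hV
  have hV0 : 0 ≤ V := measureReal_nonneg
  -- `B` times the squared energy norm bounds the form minus `lam` times the mass; an error with mass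
  -- at most `1 / 4` leaves a competitor with mass at least `1 / 4`
  set B := a + a * V + |rhoLog N| + |lam| + 1 with hB
  have hB0 : 0 < B := by positivity
  obtain ⟨φ, ⟨K, hφK⟩, hφ0, hφe⟩ := hΩ.isLipschitzLimit hN hξF (min (1 / 4) (ε / (8 * B)))
    (by positivity)
  refine ⟨φ, K, hφK, hφ0, ?_⟩
  have hφF := memForm_of_lipschitz hN hΩ.isBounded one_pos hφK hφ0
  have hφ2 := hφF.memLp hN hΩ.isBounded
  set e : Eu N → ℝ := fun x => ξ x - φ x with he
  have heF : MemForm Ω (kNear 0) e := hξF.sub (measurable_kNear 0) (kNear_nonneg 0) hφF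
  have he2 := heF.memLp hN hΩ.isBounded
  have heF' := (memForm_nearKernel_iff (Ω := Ω) hN le_rfl one_pos).2 heF
  have hG0 := gagliardo_nonneg (kNear_nonneg 0) e
  have hI0 : 0 ≤ ∫ x, e x * e x := integral_nonneg fun x => mul_self_nonneg _
  have hφeq : φ = fun x => ξ x + -1 * e x := by
    ext x
    simp only [he]
    ring
  -- since `ξ` is an eigenfunction, the cross terms cancel
  have hform := kernelForm_add_const_mul (b := rhoLog N) hadm hN hΩ.isBounded hξ.1 heF' (-1)
  have hint := integral_add_const_mul_sq hξ2 he2 (-1)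
  rw [← hφeq, hξ.2 ξ hξ.1, hξ.2 e heF', hξ1] at hform
  simp only [hξ1] at hint
  have hint' : ∫ x, φ x * φ x = 1 + 2 * -1 * (∫ x, ξ x * e x) + (-1) ^ 2 * ∫ x, e x * e x := by
    rw [← hint]
    congr 1 with x
    simp only [he]
    ring
  have hee : kernelForm (nearKernel 0) (farKernel 0) (rhoLog N) e e - lam * ∫ x, e x * e x
      ≤ ε / 8 := by
    have h1 := (neg_abs_le _).trans' (neg_le_neg
      (hadm.abs_interaction_self_le hΩ.isBounded he2 heF.eq_zero))
    rw [kernelForm, gagliardo_nearKernel]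
    have h2 : energyNormSq e ≤ ε / (8 * B) := hφe.trans (min_le_right _ _)
    have h3 : energyNormSq e * B ≤ ε / 8 := by
      refine (mul_le_mul_of_nonneg_right h2 hB0.le).trans_eq ?_
      field_simp
    have h4 : rhoLog N * ∫ x, e x * e x ≤ |rhoLog N| * ∫ x, e x * e x :=
      mul_le_mul_of_nonneg_right (le_abs_self _) hI0
    have h5 : -lam * ∫ x, e x * e x ≤ |lam| * ∫ x, e x * e x :=
      mul_le_mul_of_nonneg_right (neg_le_abs _) hI0
    refine le_trans ?_ h3
    rw [energyNormSq, hB]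
    have p1 : 0 ≤ (a / 2 + a * V + |rhoLog N| + |lam| + 1) * gagliardo (kNear 0) e e := by
      positivity
    have p2 : 0 ≤ (a + 1) * ∫ x, e x * e x := by positivity
    nlinarith
  have hnorm : 1 / 4 ≤ ∫ x, φ x * φ x := by
    have h1 : 1 ≤ 2 * (∫ x, φ x * φ x) + 2 * ∫ x, e x * e x := by
      have i1 := (integrable_mul_of_memLp hφ2 hφ2).const_mul 2
      have i2 := (integrable_mul_of_memLp he2 he2).const_mul 2
      rw [← hξ1, ← integral_const_mul, ← integral_const_mul, ← integral_add i1 i2]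
      refine integral_mono (integrable_mul_of_memLp hξ2 hξ2) (i1.add i2) fun x => ?_
      simp only [he]
      nlinarith [mul_self_nonneg (φ x - (ξ x - φ x))]
    have h2 : energyNormSq e ≤ 1 / 4 := hφe.trans (min_le_left _ _)
    rw [energyNormSq] at h2
    linarith
  have hkey : kernelForm (nearKernel 0) (farKernel 0) (rhoLog N) φ φ - lam * ∫ x, φ x * φ x =
      kernelForm (nearKernel 0) (farKernel 0) (rhoLog N) e e - lam * ∫ x, e x * e x := by
    rw [hform, hint']
    ring
  have h4 := mul_le_mul_of_nonneg_left hnorm hε.le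
  refine ⟨by linarith, ?_⟩
  rw [add_mul]
  linarith

/-- The rescaled first eigenvalues `(λ₁ˢ - 1) / s` converge to the first eigenvalue of the
logarithmic Laplacian. -/
theorem tendsto_rescaled_firstFracEigenvalue (hN : 1 ≤ N) (hΩ : IsBoundedLipschitzDomain Ω) :
    Tendsto (fun s => (firstFracEigenvalue Ω s - 1) / s) (𝓝[>] 0) (𝓝 (firstLogEigenvalue Ω)) := by
  obtain ⟨-, hb, ξ, hξ⟩ := firstLogEigenvalue_spec hN hΩ
  refine tendsto_order.2 ⟨fun μ hμ => ?_, fun μ hμ => ?_⟩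
  · -- otherwise a subsequence of eigenfunctions would converge to a competitor below the minimum
    by_contra hcon
    have hfreq := (Filter.not_eventually.1 hcon).and_eventually (eventually_admissible hN)
    obtain ⟨s, hs, hs'⟩ := exists_seq_forall_of_frequently hfreq
    choose u hu using fun n => (firstFracEigenvalue_spec hN hΩ (hs' n).2.1.1 (hs' n).2.1.2).2.2
    have hs0 : Tendsto s atTop (𝓝 0) := hs.mono_right nhdsWithin_le_nhds
    have hw := fun n => (hu n).isWeakEigen hN hΩ.isBounded (hs' n).2.1.1 (hs' n).2.1.2
    obtain ⟨-, -, v, hv, hv1, hvle, -⟩ := exists_subseq_kernelForm_le hN hΩ.isBounded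
      hΩ.isOpen.measurableSet (fun n => (hs' n).2.2) (fun z => tendsto_nearKernel hN hs0 z)
      (fun z => tendsto_farKernel hN hs0 z) ((tendsto_bFrac hN).comp hs) (fun n => (hw n).1.1)
      (fun n => (hw n).2) (tendsto_const_nhds (x := μ)) fun n => by
        have h1 := (hw n).1.2 _ (hw n).1.1
        rw [(hw n).2, mul_one] at h1
        have h2 := not_lt.1 (hs' n).1
        exact h1.trans_le h2
    have := hb v hv
    rw [hv1] at this
    linarith
  · obtain ⟨hw, hw1⟩ := hξ.isWeakEigen hN
    obtain ⟨φ, K, hφ, hφ0, hpos, hlt⟩ := exists_lipschitz_kernelForm_lt hN hΩ hw hw1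
      (sub_pos.2 hμ)
    rw [add_sub_cancel] at hlt
    filter_upwards [(tendsto_kernelForm_of_lipschitz hN hΩ.isBounded hφ hφ0).eventually
      (gt_mem_nhds hlt), eventually_admissible (N := N) hN] with s h1 h2
    have h3 := (firstFracEigenvalue_spec hN hΩ h2.1.1 h2.1.2).2.1 φ
      ((memForm_nearKernel_iff hN h2.1.1.le h2.1.2).2
        (memForm_of_lipschitz hN hΩ.isBounded h2.1.2 hφ hφ0))
    exact lt_of_mul_lt_mul_right (h3.trans_lt h1) hpos.le

lemma eLpNorm_two_eq {f : Eu N → ℝ} (hf : MemLp f 2 volume) :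
    eLpNorm f 2 volume = ENNReal.ofReal (√(∫ x, f x * f x)) := by
  rw [← norm_toLp_sq hf, Real.sqrt_sq (norm_nonneg _), Lp.norm_toLp,
    ENNReal.ofReal_toReal hf.eLpNorm_ne_top]

/-- The first eigenfunctions of `(-Δ)^s` converge in `L²` to that of the logarithmic Laplacian. -/
theorem tendsto_firstFracEigenfunction (hN : 1 ≤ N) (hΩ : IsBoundedLipschitzDomain Ω)
    (hξ : IsFirstLogEigenfunction Ω ξ) {u : ℝ → Eu N → ℝ}
    (hu : ∀ s ∈ Ioo (0 : ℝ) 1, IsFirstFracEigenfunction Ω s (u s)) :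
    Tendsto (fun s => eLpNorm (u s - ξ) 2 (volume.restrict Ω)) (𝓝[>] 0) (𝓝 0) := by
  obtain ⟨-, hb, -⟩ := firstLogEigenvalue_spec hN hΩ
  refine tendsto_of_subseq_tendsto fun t ht => ?_
  obtain ⟨n₀, hn₀⟩ := eventually_atTop.1 (ht.eventually (eventually_admissible hN))
  set s : ℕ → ℝ := fun n => t (n + n₀) with hs
  have hs' : ∀ n, s n ∈ Ioo (0 : ℝ) 1 ∧ Admissible (cLog N / 4) (2 * cLog N)
      (nearKernel (s n) : Eu N → ℝ) (farKernel (s n)) := fun n => hn₀ _ (Nat.le_add_left _ _)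
  have hst : Tendsto s atTop (𝓝[>] 0) := ht.comp (tendsto_add_atTop_nat n₀)
  have hs0 : Tendsto s atTop (𝓝 0) := hst.mono_right nhdsWithin_le_nhds
  have hw := fun n => (hu (s n) (hs' n).1).isWeakEigen hN hΩ.isBounded (hs' n).1.1 (hs' n).1.2
  obtain ⟨φ, -, v, hv, hv1, hvle, hL2, hae⟩ := exists_subseq_kernelForm_le hN hΩ.isBounded
    hΩ.isOpen.measurableSet (fun n => (hs' n).2) (fun z => tendsto_nearKernel hN hs0 z)
    (fun z => tendsto_farKernel hN hs0 z) ((tendsto_bFrac hN).comp hst) (fun n => (hw n).1.1)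
    (fun n => (hw n).2) ((tendsto_rescaled_firstFracEigenvalue hN hΩ).comp hst) fun n => by
      have h1 := (hw n).1.2 _ (hw n).1.1
      rw [(hw n).2, mul_one] at h1
      exact h1.le
  have hadm := admissible_self (N := N) hN le_rfl one_pos
  have hv0 : ∀ᵐ x, 0 ≤ v x := by
    have hnn := ae_all_iff.2 fun n => (hu (s (φ n)) (hs' (φ n)).1).nonneg
    filter_upwards [hae, hnn] with x h1 h2
    exact ge_of_tendsto' h1 h2
  -- the limit attains the minimum, hence is the first eigenfunction
  have hve : IsWeakEigen Ω (nearKernel 0) (farKernel 0) (rhoLog N) (firstLogEigenvalue Ω) v := by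
    refine hb.isWeakEigen hadm hN hΩ.isBounded hv (le_antisymm ?_ (hb v hv))
    rwa [hv1, mul_one]
  have hvξ : v =ᵐ[volume] ξ := hb.ae_eq hadm hN hΩ.isBounded hve (hξ.isWeakEigen hN).1 hv0
    hξ.nonneg hv1 (hξ.isWeakEigen hN).2
  refine ⟨fun n => φ n + n₀, ?_⟩
  have hlim : Tendsto (fun n => ENNReal.ofReal (√(∫ x, (u (s (φ n)) x - v x) *
      (u (s (φ n)) x - v x)))) atTop (𝓝 0) := by
    have := (ENNReal.continuous_ofReal.tendsto _).comp hL2.sqrt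
    rwa [Real.sqrt_zero, ENNReal.ofReal_zero] at this
  refine tendsto_of_tendsto_of_tendsto_of_le_of_le tendsto_const_nhds hlim
    (fun n => zero_le) fun n => ?_
  have hm : MemLp (fun x => u (s (φ n)) x - v x) 2 volume :=
    ((hs' (φ n)).2.memLp hN hΩ.isBounded (hw (φ n)).1.1).sub (hadm.memLp hN hΩ.isBounded hv)
  calc eLpNorm (u (s (φ n)) - ξ) 2 (volume.restrict Ω)
      ≤ eLpNorm (u (s (φ n)) - ξ) 2 volume := eLpNorm_mono_measure _ Measure.restrict_le_self
    _ = eLpNorm (fun x => u (s (φ n)) x - v x) 2 volume := by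
        refine eLpNorm_congr_ae ?_
        filter_upwards [hvξ] with x hx
        rw [Pi.sub_apply, hx]
    _ = _ := eLpNorm_two_eq hm

end Limit

end LogLaplace

theorem theorem1p4 (N : ℕ) (hN : 1 ≤ N) (Ω : Set (EuclideanSpace ℝ (Fin N)))
    (hΩ : LogLaplace.IsBoundedLipschitzDomain Ω) :
    -- the first eigenvalues exist, i.e. they are smallest elements of the sets of eigenvalues
    IsLeast (LogLaplace.logEigenvalues Ω) (LogLaplace.firstLogEigenvalue Ω) ∧
    (∀ s ∈ Set.Ioo (0 : ℝ) 1,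
      IsLeast (LogLaplace.fracEigenvalues Ω s) (LogLaplace.firstFracEigenvalue Ω s)) ∧
    -- derivative at `s = 0` from the right, with the value `1` at `s = 0`
    HasDerivWithinAt (Function.update (LogLaplace.firstFracEigenvalue Ω) 0 1)
      (LogLaplace.firstLogEigenvalue Ω) (Set.Ici 0) 0 ∧
    -- the nonnegative normalized first eigenfunctions exist and are unique (almost everywhere)
    (∃ ξ, LogLaplace.IsFirstLogEigenfunction Ω ξ ∧
      ∀ η, LogLaplace.IsFirstLogEigenfunction Ω η → η =ᵐ[volume] ξ) ∧
    (∀ s ∈ Set.Ioo (0 : ℝ) 1, ∃ u, LogLaplace.IsFirstFracEigenfunction Ω s u ∧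
      ∀ v, LogLaplace.IsFirstFracEigenfunction Ω s v → v =ᵐ[volume] u) ∧
    -- `u_s → ξ_1` in `L²(Ω)` as `s → 0⁺`
    (∀ (ξ : EuclideanSpace ℝ (Fin N) → ℝ) (u : ℝ → EuclideanSpace ℝ (Fin N) → ℝ),
      LogLaplace.IsFirstLogEigenfunction Ω ξ →
      (∀ s ∈ Set.Ioo (0 : ℝ) 1, LogLaplace.IsFirstFracEigenfunction Ω s (u s)) →
      Tendsto (fun s => eLpNorm (u s - ξ) 2 (volume.restrict Ω)) (𝓝[>] 0) (𝓝 0)) := by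
  have hlog := LogLaplace.firstLogEigenvalue_spec hN hΩ
  refine ⟨hlog.1, fun s hs => (LogLaplace.firstFracEigenvalue_spec hN hΩ hs.1 hs.2).1,
    ?_, ?_, ?_, ?_⟩
  · rw [hasDerivWithinAt_iff_tendsto_slope, Ici_sdiff_left]
    refine (LogLaplace.tendsto_rescaled_firstFracEigenvalue hN hΩ).congr' ?_
    filter_upwards [self_mem_nhdsWithin] with s hs
    rw [slope_def_field, Function.update_self, Function.update_of_ne (ne_of_gt hs), sub_zero]
  · obtain ⟨ξ, hξ⟩ := hlog.2.2
    exact ⟨ξ, hξ, fun η hη => hη.ae_eq hN hΩ hξ⟩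
  · intro s hs
    obtain ⟨u, hu⟩ := (LogLaplace.firstFracEigenvalue_spec hN hΩ hs.1 hs.2).2.2
    exact ⟨u, hu, fun v hv => hv.ae_eq hN hΩ hs.1 hs.2 hu⟩
  · exact fun ξ u hξ hu => LogLaplace.tendsto_firstFracEigenfunction hN hΩ hξ hu
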